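/- **Model.** There are $n$ validators and synchronized rounds $r=0,1,2,\dots$; a slot consists of $4\Delta$ rounds ($\Delta\ge 1$), slot $t$ having its propose, vote, fast-confirm and merge rounds at $4\Delta t$, $4\Delta t+\Delta$, $4\Delta t+2\Delta$, $4\Delta t+3\Delta$. In each slot one proposer is elected uniformly at random; its identity is independent of everything known before it is revealed at round $4\Delta t$, in particular of which validators are corrupted or asleep in rounds $\le 4\Delta t$. An adaptive adversary corrupts validators (permanently) and puts honest validators to sleep. Let $A_r$ be the set of corrupted validators at round $r$. Let $H_r$ be the set of *active* validators at round $r$: those that are honest and awake, and have either always been awake or have completed the joining protocol (a validator waking up in $(4\Delta(t-1)+2\Delta,\,4\Delta t+2\Delta]$ becomes active at round $4\Delta(t+1)+\Delta$ if it stays awake; before that it sends nothing and does not change its output). Signatures are unforgeable, the network is synchronous from the start ($\mathsf{GST}=0$): messages sent by honest validators, and votes received by awake honest validators (directly or inside a proposal), reach every honest validator within $\Delta$ rounds, or when it wakes up; proposals for slot $t$ are forwarded only during its first $\Delta$ rounds. We assume $|\bigcup_r A_r|=f<n/3$, the sleepiness constraint $$|H_{4\Delta(t-1)+\Delta}\setminus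 A_{4\Delta t+\Delta}|>|A_{4\Delta t+\Delta}|\quad\text{for all } t\ge 1,$$ and $H_{4\Delta t}\neq\emptyset$ for every slot $t$ (so that in every slot an active honest proposer is elected with probability at least $1/n$). A chain is a sequence of blocks with increasing slots starting from genesis; its height is the slot of its last block ($-1$ for genesis); $\preceq$ is the prefix order. For vote sets $V,V'$, $\mathrm{mfc}(V,V',C,t)$ is the longest chain $c\succeq C$ such that $c=C$, or more than half of the validators with a vote in $V'$ from slot $\ge t-1$ have one and the same vote, for an extension of $c$, in both $V$ and $V'$; here only the latest vote from slot $\ge t-1$ of each non-equivocating validator counts. $\mathrm{fc}(V,t)$ is the longest chain $c$ such that at least $\frac23 n$ validators voted in slot $t$ for extensions of $c$, together with the set $Q$ of these votes, or (genesis, $\emptyset$) if there is none. **Protocol A** (probabilistically safe TOB-SVD with fast confirmations). Each validator keeps $V^{fr}$, $C^{fr}$ and a confirmed chain $\mathrm{Ch}$, initially empty, genesis, genesis. Let $V$ be its current set of received votes. *Propose*: the proposer computes $(C,Q)=\mathrm{fc}(V,t-1)$ and sends $(c_p,C,Q)$, where $c_p$ has height $t$, extends $m=\mathrm{mfc}(V,V,C,t)$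 and contains the current transaction pool (if $m$ has height $\ge t$, $c_p$ is unspecified). In rounds $4\Delta t,\dots,4\Delta t+\Delta$, on receiving a proposal $(c_p,C,Q)$ from the proposer of slot $t$ with $c_p$ of height $t$, $Q$ a certificate for $C$ (or $C$ genesis and $Q=\emptyset$) and $C^{fr}\preceq C$, it sets $C^{fr}:=C$. *Vote*: it computes $m=\mathrm{mfc}(V^{fr},V,C^{fr},t)$, sets $\mathrm{Ch}$ to the longest chain in $\{\mathrm{Ch},m^{\lceil\kappa}\}$ that is a prefix of $m$, where $m^{\lceil\kappa}$ is the longest prefix of $m$ of height $\le t-\kappa$, and votes for a chain of height $t$ proposed in slot $t$ that extends $m$, if there is one, and for $m$ otherwise. *Fast confirm*: it computes $(c,Q)=\mathrm{fc}(V,t)$; if $Q\ne\emptyset$ and $\mathrm{Ch}\not\succeq c$, it sets $\mathrm{Ch}:=c$. *Merge*: $V^{fr}:=V$ and $C^{fr}$ is set to the chain of $\mathrm{fc}(V,t)$. Let *Protocol A$'$* be Protocol A without the condition $\mathrm{Ch}\not\succeq c$ in the fast-confirm phase. **Protocol B** (full protocol). A checkpoint is a pair $J=(J.\mathrm{ch},J.c)$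 of a chain and a slot. Votes also carry a link $S\to T$ between checkpoints, valid if $S.\mathrm{ch}\preceq T.\mathrm{ch}$ and $S.c<T.c$. Justified in $V$ are $(\text{genesis},0)$ and every $T$ with a valid link $S\to T$ from a justified $S$ that is contained in votes in $V$ of at least $\frac23n$ validators; $GJ(V)$ is the justified checkpoint with greatest $c$. $T$ is finalized if it is $(\text{genesis},0)$, or is justified and has a valid link, supported in the same way, to a checkpoint with slot $T.c+1$; $GF(V)$ is the greatest finalized checkpoint. Protocol B is Protocol A with available chain $\mathrm{Ch}=\mathrm{chAva}$ and the following changes. $\mathrm{fc}(V,t)$ is replaced by $\mathrm{fc}'(V,t)$, which equals $\mathrm{fc}(V,t)$ if its chain extends $GJ(V).\mathrm{ch}$ and is $(GJ(V).\mathrm{ch},\emptyset)$ otherwise. Proposals also carry $GJ_p=GJ(V)$. Validators keep a checkpoint $GJ^{fr}$, initially $(\text{genesis},0)$ and set to $GJ(V)$ at merge. A proposal for slot $t$ received in rounds $4\Delta t,\dots,4\Delta t+\Delta$ is processed at the beginning of the vote round: if it comes from the proposer with $c_p$ of height $t$, $Q$ certifies $C$ (or $Q=\emptyset$ and $C=GJ_p.\mathrm{ch}$),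 $GJ_p$ is justified in $V$, and $GJ_p=GJ^{fr}$ or $GJ_p.c>GJ^{fr}.c$, then $GJ^{fr}:=GJ_p$; next, if $C^{fr}\not\succeq GJ_p.\mathrm{ch}$, $C^{fr}:=GJ_p.\mathrm{ch}$; next, if $C^{fr}\preceq C$, $C^{fr}:=C$. In the vote phase $GJ^{fr}.\mathrm{ch}$ is a third candidate for $\mathrm{chAva}$, and the vote carries the link $GJ^{fr}\to T$ with $T=(\mathrm{chAva},t)$ if $GJ^{fr}.c=t-1$ and $T=(GJ^{fr}.\mathrm{ch},t)$ otherwise. In the fast-confirm phase $\mathrm{chAva}$ is set to the chain $c$ of $\mathrm{fc}'(V,t)$ whenever $\mathrm{chAva}\not\succeq c$. The second output $\mathrm{chFin}$ is set to the longest common prefix of $\mathrm{chAva}$ and $GF(V).\mathrm{ch}$ in the vote phase and to $GF(V).\mathrm{ch}$ in the fast-confirm phase. **Theorem.** Fix $n$ and a time horizon $T(\kappa)$ polynomial in $\kappa$. There is a negligible function $\varepsilon(\kappa)$ such that for all $\kappa>1$, all $\Delta\ge1$ and every adversary as above, with probability at least $1-\varepsilon(\kappa)$ both of the following hold for Protocol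 A with $\mathrm{out}=\mathrm{Ch}$, and likewise for Protocol B with $\mathrm{out}=\mathrm{chAva}$: 1. (Safety) for all rounds $r,r'\le T(\kappa)$ and validators $i$ honest at $r$ and $j$ honest at $r'$, one of $\mathrm{out}_i^{r}$, $\mathrm{out}_j^{r'}$ is a prefix of the other; 2. (Liveness with confirmation time $8\kappa\Delta+\Delta$) for all rounds $r$ and $r'\le T(\kappa)$ with $r'\ge r+8\kappa\Delta+\Delta$, every transaction in the transaction pool at round $r$ is contained in $\mathrm{out}_i^{r'}$ for every $i\in H_{r'}$. For Protocol A$'$, Safety holds with probability at least $1-\varepsilon(\kappa)$. -/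

import Mathlib

namespace SleepyTOB

noncomputable section

open scoped Classical

/-! ### Blocks and chains -/

/-- A non-genesis block: a batch of transactions and the slot in which it is proposed. -/
structure Block (Tx : Type*) where
  body : Finset Tx
  slot : ℕ

/-- A chain, identified with the list of its non-genesis blocks from the oldest one to the tip.
Every block has a larger slot than its parent. The empty list is the genesis chain. -/
structure Chain (Tx : Type*) where
  blocks : List (Block Tx)
  increasing : blocks.Pairwise (fun b b' => b.slot < b'.slot)

namespace Chain

variable {Tx : Type*}

def genesis : Chain Tx := ⟨[], List.Pairwise.nil⟩

instance : Inhabited (Chain Tx) := ⟨genesis⟩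

/-- The height of a chain: the slot of its tip, which is `-1` for genesis. -/
def p (c : Chain Tx) : ℤ :=
  match c.blocks.getLast? with
  | none => -1
  | some b => b.slot

/-- `c` is a (not necessarily strict) prefix of `d`; equivalently `d` extends `c`. -/
def IsPrefix (c d : Chain Tx) : Prop := c.blocks <+: d.blocks

/-- The transaction `tx` belongs to the chain. -/
def Contains (c : Chain Tx) (tx : Tx) : Prop := ∃ b ∈ c.blocks, tx ∈ b.body

/-- The `κ`-deep prefix at slot `t`: the longest prefix of height at most `t - κ`. -/
def deep (κ t : ℕ) (c : Chain Tx) : Chain Tx :=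
  ⟨c.blocks.takeWhile (fun b => decide ((b.slot : ℤ) ≤ (t : ℤ) - (κ : ℤ))),
    c.increasing.sublist (List.takeWhile_sublist _)⟩

/-- An element of greatest height of a set of chains. -/
def longest (s : Set (Chain Tx)) : Chain Tx :=
  Classical.epsilon (fun c => c ∈ s ∧ ∀ d ∈ s, d.p ≤ c.p)

end Chain

infix:50 " ≼ " => Chain.IsPrefix

/-! ### Messages

The types `F` and `G` are those of the finality components of vote and propose messages. They are
trivial in the protocol without finality component. -/

/-- The message `[vote, chain, fin, slot, voter]`. -/
structure Vote (n : ℕ) (Tx F : Type*) where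
  chain : Chain Tx
  fin : F
  slot : ℕ
  voter : Fin n

/-- The message `[propose, chain, chC, Q, gj, slot, sender]`. -/
structure Proposal (n : ℕ) (Tx F G : Type*) where
  chain : Chain Tx
  chC : Chain Tx
  Q : Finset (Vote n Tx F)
  gj : G
  slot : ℕ
  sender : Fin n

/-- A finite set of messages, split into its votes and its proposals. -/
structure MsgSet (n : ℕ) (Tx F G : Type*) where
  votes : Finset (Vote n Tx F)
  proposals : Finset (Proposal n Tx F G)

namespace MsgSet

def empty {n : ℕ} {Tx F G : Type*} : MsgSet n Tx F G := ⟨∅, ∅⟩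

end MsgSet

/-! ### The majority fork-choice function -/

section ForkChoice

variable {n : ℕ} {Tx F : Type*}

/-- The validators that, according to the votes in `V`, voted for two different chains in the same
slot. -/
def equivocators (V : Finset (Vote n Tx F)) : Set (Fin n) :=
  {k | ∃ v ∈ V, ∃ w ∈ V, v.voter = k ∧ w.voter = k ∧ v.slot = w.slot ∧ v.chain ≠ w.chain}

/-- Discard the votes of equivocating validators. -/
def filEq (V : Finset (Vote n Tx F)) : Finset (Vote n Tx F) :=
  V.filter (fun v => v.voter ∉ equivocators V)

/-- Discard the votes that are expired at slot `t`, i.e. those from before slot `t - 1`. -/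
def filExp (V : Finset (Vote n Tx F)) (t : ℕ) : Finset (Vote n Tx F) :=
  V.filter (fun v => t ≤ v.slot + 1)

/-- Keep only the latest vote of every validator. -/
def filLmd (V : Finset (Vote n Tx F)) : Finset (Vote n Tx F) :=
  V.filter (fun v => ∀ w ∈ V, w.voter = v.voter → w.slot ≤ v.slot)

/-- The latest, non-expired, non-equivocating votes for extensions of `c`. The finality component of
a vote is irrelevant to the fork choice and is dropped. -/
def supporting (V : Finset (Vote n Tx F)) (c : Chain Tx) (t : ℕ) :
    Finset (Chain Tx × ℕ × Fin n) :=
  ((filLmd (filExp (filEq V) t)).filter (fun v => c ≼ v.chain)).image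
    (fun v => (v.chain, v.slot, v.voter))

/-- The validators with a non-expired vote in `V` at slot `t`. -/
def unexpiredVoters (V : Finset (Vote n Tx F)) (t : ℕ) : Finset (Fin n) :=
  (filExp V t).image Vote.voter

/-- The majority fork-choice function `mfc (V, V', cC, t)`: the longest extension of `cC` which is
`cC` or is supported, in `V` and in `V'`, by more than half of the voters of `V'`. -/
def mfc (V V' : Finset (Vote n Tx F)) (cC : Chain Tx) (t : ℕ) : Chain Tx :=
  Chain.longest {c | cC ≼ c ∧
    (c = cC ∨ (unexpiredVoters V' t).card < 2 * (supporting V c t ∩ supporting V' c t).card)}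

/-- The chains supported, in slot `t`, by the votes of at least two thirds of all validators. -/
def fastCands (V : Finset (Vote n Tx F)) (t : ℤ) : Set (Chain Tx) :=
  {c | 2 * n ≤ 3 * ((V.filter (fun v => (v.slot : ℤ) = t ∧ c ≼ v.chain)).image Vote.voter).card}

/-- The function `fastconfirmsimple`. -/
def fastConfirmSimple (V : Finset (Vote n Tx F)) (t : ℤ) : Chain Tx × Finset (Vote n Tx F) :=
  if (fastCands V t).Nonempty then
    (Chain.longest (fastCands V t),
      V.filter (fun v => (v.slot : ℤ) = t ∧ Chain.longest (fastCands V t) ≼ v.chain))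
  else (Chain.genesis, ∅)

/-- `Q` is a quorum certificate for the chain `c` in slot `t`. -/
def Certifies (Q : Finset (Vote n Tx F)) (c : Chain Tx) (t : ℤ) : Prop :=
  (∀ v ∈ Q, (v.slot : ℤ) = t ∧ c ≼ v.chain) ∧ 2 * n ≤ 3 * (Q.image Vote.voter).card

/-- `d` is a possible result of `Extend (c, t)` when the transaction pool is `pool`; nothing is
specified if the height of `c` is at least `t`. -/
def IsExtend (pool : Finset Tx) (c : Chain Tx) (t : ℕ) (d : Chain Tx) : Prop :=
  c.p < t → c ≼ d ∧ d.p = t ∧ ∀ tx ∈ pool, d.Contains tx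

end ForkChoice

/-! ### Time -/

/-- The slot of round `r`. -/
def slotOf (Δ r : ℕ) : ℕ := r / (4 * Δ)

def proposing (Δ t : ℕ) : ℕ := 4 * Δ * t

def voting (Δ t : ℕ) : ℕ := 4 * Δ * t + Δ

def fastConfirming (Δ t : ℕ) : ℕ := 4 * Δ * t + 2 * Δ

def merging (Δ t : ℕ) : ℕ := 4 * Δ * t + 3 * Δ

/-! ### Executions in the sleepy model with synchronous network -/

/-- The record of an execution. Here `corrupt r` is the set of adversarial validators at round `r`,
`awake r` is the set of validators that are not asleep at round `r` (this is only relevant for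
honest ones), `pool r` is the transaction pool, `view r i` is the set of messages received by
validator `i` by round `r`, `sent r i` is the set of messages that the honest validator `i` sends in
round `r`, and `state r i` is the local state of `i` after round `r`. -/
structure Execution (n : ℕ) (Tx F G S : Type*) where
  corrupt : ℕ → Finset (Fin n)
  awake : ℕ → Finset (Fin n)
  pool : ℕ → Finset Tx
  view : ℕ → Fin n → MsgSet n Tx F G
  sent : ℕ → Fin n → MsgSet n Tx F G
  state : ℕ → Fin n → S

namespace Execution

variable {n : ℕ} {Tx F G S : Type*}

/-- Validator `i` is honest at round `r`. -/
def Honest (e : Execution n Tx F G S) (r : ℕ) (i : Fin n) : Prop := i ∉ e.corrupt r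

/-- The validators active at round `r`: they are honest and awake, and either have never been asleep
or have completed the joining protocol. A validator that wakes up in a round
`w ∈ (voting (t-1) + Δ, voting t + Δ]` completes it at round `voting (t+1)`, provided that it stays
awake. -/
def active (e : Execution n Tx F G S) (Δ r : ℕ) : Set (Fin n) :=
  {i | e.Honest r i ∧ ((∀ r' ≤ r, i ∈ e.awake r') ∨
    ∃ t, voting Δ (t + 1) ≤ r ∧ ∀ r', voting Δ t + Δ ≤ r' → r' ≤ r → i ∈ e.awake r')}

/-- The validators that are ever corrupted; their number is `f`. -/
def everCorrupt (e : Execution n Tx F G S) : Set (Fin n) := {i | ∃ r, i ∈ e.corrupt r}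

/-- The constraints on corruption and sleepiness. -/
structure Compliant (e : Execution n Tx F G S) (Δ : ℕ) : Prop where
  corrupt_mono : ∀ r r', r ≤ r' → e.corrupt r ⊆ e.corrupt r'
  /-- `f < n / 3`. -/
  few_corrupt : 3 * e.everCorrupt.ncard < n
  /-- The sleepiness constraint, for every slot that has a predecessor. -/
  sleepiness : ∀ t, (e.corrupt (voting Δ (t + 1))).card <
    (e.active Δ (voting Δ t) \ (e.corrupt (voting Δ (t + 1)) : Set (Fin n))).ncard
  /-- In every slot some validator is active at the propose round. -/
  proposer_exists : ∀ t, (e.active Δ (proposing Δ t)).Nonempty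

/-- The network with delay bound `Δ` from round `0` on (`GST = 0`), gossip, message queueing for
validators that are asleep, and unforgeable signatures. -/
structure Synchronous (e : Execution n Tx F G S) (Δ : ℕ) : Prop where
  pool_mono : ∀ r r', r ≤ r' → e.pool r ⊆ e.pool r'
  view_votes_mono : ∀ r i, e.Honest (r + 1) i → (e.view r i).votes ⊆ (e.view (r + 1) i).votes
  view_proposals_mono : ∀ r i, e.Honest (r + 1) i →
    (e.view r i).proposals ⊆ (e.view (r + 1) i).proposals
  /-- A validator receives nothing while asleep. -/
  asleep : ∀ r i, e.Honest (r + 1) i → i ∉ e.awake (r + 1) → e.view (r + 1) i = e.view r i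
  /-- Messages sent by honest validators arrive within `Δ` rounds, or upon waking up. -/
  deliver_vote : ∀ r i r' j, e.Honest r i → r + Δ ≤ r' → e.Honest r' j → j ∈ e.awake r' →
    (e.sent r i).votes ⊆ (e.view r' j).votes
  deliver_proposal : ∀ r i r' j, e.Honest r i → r + Δ ≤ r' → e.Honest r' j → j ∈ e.awake r' →
    (e.sent r i).proposals ⊆ (e.view r' j).proposals
  /-- Votes are gossiped by honest validators that receive them. -/
  gossip_vote : ∀ r i r' j, e.Honest r i → i ∈ e.awake r → r + Δ ≤ r' → e.Honest r' j →
    j ∈ e.awake r' → (e.view r i).votes ⊆ (e.view r' j).votes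
  /-- Proposals for slot `t` are gossiped during the first `Δ` rounds of slot `t`. -/
  gossip_proposal : ∀ r i r' j, e.Honest r i → i ∈ e.awake r → r + Δ ≤ r' → e.Honest r' j →
    j ∈ e.awake r' → ∀ q ∈ (e.view r i).proposals, proposing Δ q.slot ≤ r →
      r < proposing Δ q.slot + Δ → q ∈ (e.view r' j).proposals
  /-- The votes contained in a received proposal are received with it. -/
  embedded : ∀ r i, e.Honest r i → ∀ q ∈ (e.view r i).proposals, q.Q ⊆ (e.view r i).votes
  /-- A received message of a validator that is still honest was sent by it before. -/
  unforgeable_vote : ∀ r i, e.Honest r i → ∀ v ∈ (e.view r i).votes, e.Honest r v.voter →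
    ∃ r' < r, v ∈ (e.sent r' v.voter).votes
  unforgeable_proposal : ∀ r i, e.Honest r i → ∀ q ∈ (e.view r i).proposals,
    e.Honest r q.sender → ∃ r' < r, q ∈ (e.sent r' q.sender).proposals

/-- The proposals that `i` receives in the rounds from `r₀` to `r`. -/
def newProposals (e : Execution n Tx F G S) (i : Fin n) (r₀ r : ℕ) :
    Finset (Proposal n Tx F G) :=
  (e.view r i).proposals \ (if r₀ = 0 then ∅ else (e.view (r₀ - 1) i).proposals)

/-- The local state of `i` before round `r`, where `s₀` is the initial state. -/
def prev (e : Execution n Tx F G S) (s₀ : S) (r : ℕ) (i : Fin n) : S :=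
  if r = 0 then s₀ else e.state (r - 1) i

/-- The chain `c` that `i` votes for in slot `t`, at round `r`, given the output `m` of the fork
choice: a chain proposed in slot `t` that extends `m` and has height `t` if there is one, and `m`
otherwise. -/
def IsVoteChoice (e : Execution n Tx F G S) (proposer : ℕ → Fin n) (i : Fin n) (r t : ℕ)
    (m c : Chain Tx) : Prop :=
  let P : Set (Chain Tx) := {d | m ≼ d ∧ d.p = t ∧
    ∃ q ∈ (e.view r i).proposals, q.slot = t ∧ q.sender = proposer t ∧ q.chain = d}
  (P.Nonempty → c ∈ P) ∧ (¬ P.Nonempty → c = m)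

/-! ### Security -/

/-- Safety of the confirmed chain `out`, for all rounds up to `T`. -/
def SafeUpTo (e : Execution n Tx F G S) (out : S → Chain Tx) (T : ℕ) : Prop :=
  ∀ r r' i j, r ≤ T → r' ≤ T → e.Honest r i → e.Honest r' j →
    out (e.state r i) ≼ out (e.state r' j) ∨ out (e.state r' j) ≼ out (e.state r i)

/-- Liveness of the confirmed chain `out` with confirmation time `Tconf`, for all rounds up to
`T`. -/
def LiveUpTo (e : Execution n Tx F G S) (out : S → Chain Tx) (Δ T Tconf : ℕ) : Prop :=
  ∀ r r' i, r + Tconf ≤ r' → r' ≤ T → i ∈ e.active Δ r' →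
    ∀ tx ∈ e.pool r, (out (e.state r' i)).Contains tx

end Execution

/-! ### The variant of TOB-SVD with fast confirmations -/

structure TobState (n : ℕ) (Tx : Type*) where
  frozen : Finset (Vote n Tx Unit)
  chFrozen : Chain Tx
  confirmed : Chain Tx

section Tob

variable {n : ℕ} {Tx : Type*}

def TobState.init : TobState n Tx := ⟨∅, Chain.genesis, Chain.genesis⟩

abbrev TobExecution (n : ℕ) (Tx : Type*) := Execution n Tx Unit Unit (TobState n Tx)

/-- Validity of a propose message: it comes from the proposer of its slot, the proposed chain has
the right height, and the certificate certifies `chC` (none is needed for genesis). -/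
def tobValid (proposer : ℕ → Fin n) (q : Proposal n Tx Unit Unit) : Prop :=
  q.sender = proposer q.slot ∧ q.chain.p = q.slot ∧
    (Certifies q.Q q.chC ((q.slot : ℤ) - 1) ∨ (q.Q = ∅ ∧ q.chC = Chain.genesis))

/-- The update of `chFrozen` upon receiving a proposal. -/
def tobOnProposal (proposer : ℕ → Fin n) (c : Chain Tx) (q : Proposal n Tx Unit Unit) : Chain Tx :=
  if tobValid proposer q ∧ c ≼ q.chC then q.chC else c

/-- What the honest validator `i`, awake at round `r`, does in this round; `s` and `s'` are its
states before and after the round, `V` is its set of received votes, and `t` is the slot of `r`.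
If `guarded` holds then a fast-confirmed candidate that the confirmed chain already extends is
ignored; otherwise it always replaces the confirmed chain. -/
structure TobStep (e : TobExecution n Tx) (proposer : ℕ → Fin n) (Δ κ : ℕ) (guarded : Prop)
    (r : ℕ) (i : Fin n) (t : ℕ) (V : Finset (Vote n Tx Unit)) (s s' : TobState n Tx) : Prop where
  propose :
    if r = proposing Δ t ∧ i ∈ e.active Δ r ∧ i = proposer t then
      ∃ c, IsExtend (e.pool r) (mfc V V (fastConfirmSimple V ((t : ℤ) - 1)).1 t) t c ∧
        (e.sent r i).proposals = {⟨c, (fastConfirmSimple V ((t : ℤ) - 1)).1,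
          (fastConfirmSimple V ((t : ℤ) - 1)).2, (), t, i⟩}
    else (e.sent r i).proposals = ∅
  vote :
    if r = voting Δ t ∧ i ∈ e.active Δ r then
      ∃ c, e.IsVoteChoice proposer i r t (mfc s.frozen V s'.chFrozen t) c ∧
        (e.sent r i).votes = {⟨c, (), t, i⟩}
    else (e.sent r i).votes = ∅
  confirmed : s'.confirmed =
    if r = voting Δ t ∧ i ∈ e.active Δ r then
      Chain.longest {c | (c = s.confirmed ∨ c = (mfc s.frozen V s'.chFrozen t).deep κ t) ∧
        c ≼ mfc s.frozen V s'.chFrozen t}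
    else if r = fastConfirming Δ t ∧ i ∈ e.active Δ r ∧ (fastConfirmSimple V t).2 ≠ ∅ ∧
        (guarded → ¬ (fastConfirmSimple V t).1 ≼ s.confirmed) then
      (fastConfirmSimple V t).1
    else s.confirmed
  frozen : s'.frozen = if r = merging Δ t then V else s.frozen
  /-- Outside merge rounds, `chFrozen` is updated by the proposals for slot `t` that are received in
  this round, in some order, if this is one of the rounds from `4Δt` to `4Δt + Δ`. -/
  chFrozen :
    if r = merging Δ t then s'.chFrozen = (fastConfirmSimple V t).1
    else if r ≤ voting Δ t then
      ∃ l : List (Proposal n Tx Unit Unit), l.Nodup ∧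
        l.toFinset = (e.newProposals i r r).filter (fun q => q.slot = t) ∧
        s'.chFrozen = l.foldl (tobOnProposal proposer) s.chFrozen
    else s'.chFrozen = s.chFrozen

/-- All honest validators follow the protocol; those that are asleep do nothing. -/
def TobFollows (e : TobExecution n Tx) (proposer : ℕ → Fin n) (Δ κ : ℕ) (guarded : Prop) : Prop :=
  ∀ r i, e.Honest r i →
    (i ∈ e.awake r → TobStep e proposer Δ κ guarded r i (slotOf Δ r) (e.view r i).votes
      (e.prev TobState.init r i) (e.state r i)) ∧
    (i ∉ e.awake r → e.state r i = e.prev TobState.init r i ∧ e.sent r i = MsgSet.empty)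

/-- A compliant execution with `GST = 0` of the protocol without finality component. -/
def IsTobExecution (e : TobExecution n Tx) (proposer : ℕ → Fin n) (Δ κ : ℕ) (guarded : Prop) :
    Prop :=
  e.Compliant Δ ∧ e.Synchronous Δ ∧ TobFollows e proposer Δ κ guarded

end Tob

/-! ### Justification and finalization -/

structure Checkpoint (Tx : Type*) where
  chain : Chain Tx
  c : ℕ

/-- The vote `source → target`. -/
structure FinVote (Tx : Type*) where
  source : Checkpoint Tx
  target : Checkpoint Tx

section Finality

variable {n : ℕ} {Tx : Type*}

instance : Inhabited (Checkpoint Tx) := ⟨⟨Chain.genesis, 0⟩⟩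

/-- Checkpoints are ordered by their slot, with equality only for identical checkpoints. -/
def Checkpoint.le (C D : Checkpoint Tx) : Prop := C.c < D.c ∨ C = D

def FinVote.Valid (w : FinVote Tx) : Prop :=
  w.source.chain ≼ w.target.chain ∧ w.source.c < w.target.c

/-- At least two thirds of the validators issued the finality vote `w`. -/
def Supermajority (V : Finset (Vote n Tx (FinVote Tx))) (w : FinVote Tx) : Prop :=
  2 * n ≤ 3 * ((V.filter (fun v => v.fin = w)).image Vote.voter).card

/-- The checkpoints justified in `V`. -/
inductive Justified (V : Finset (Vote n Tx (FinVote Tx))) : Checkpoint Tx → Prop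
  | genesis : Justified V ⟨Chain.genesis, 0⟩
  | link (S C : Checkpoint Tx) : Justified V S → FinVote.Valid ⟨S, C⟩ → Supermajority V ⟨S, C⟩ →
      Justified V C

/-- The checkpoints finalized in `V`. -/
def Finalized (V : Finset (Vote n Tx (FinVote Tx))) (C : Checkpoint Tx) : Prop :=
  C = ⟨Chain.genesis, 0⟩ ∨
    (Justified V C ∧ ∃ D : Checkpoint Tx, D.c = C.c + 1 ∧ FinVote.Valid ⟨C, D⟩ ∧
      Supermajority V ⟨C, D⟩)

/-- The greatest justified checkpoint in `V`. -/
def greatestJustified (V : Finset (Vote n Tx (FinVote Tx))) : Checkpoint Tx :=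
  Classical.epsilon (fun C => Justified V C ∧ ∀ D, Justified V D → D.c ≤ C.c)

/-- The greatest finalized checkpoint in `V`. -/
def greatestFinalized (V : Finset (Vote n Tx (FinVote Tx))) : Checkpoint Tx :=
  Classical.epsilon (fun C => Finalized V C ∧ ∀ D, Finalized V D → D.c ≤ C.c)

/-- The function `fastconfirm`. -/
def fastConfirm (V : Finset (Vote n Tx (FinVote Tx))) (t : ℤ) :
    Chain Tx × Finset (Vote n Tx (FinVote Tx)) :=
  if (greatestJustified V).chain ≼ (fastConfirmSimple V t).1 then fastConfirmSimple V t
  else ((greatestJustified V).chain, ∅)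

end Finality

/-! ### The full protocol -/

structure FullState (n : ℕ) (Tx : Type*) where
  frozen : Finset (Vote n Tx (FinVote Tx))
  chFrozen : Chain Tx
  gjFrozen : Checkpoint Tx
  chAva : Chain Tx
  chFin : Chain Tx

section Full

variable {n : ℕ} {Tx : Type*}

def FullState.init : FullState n Tx :=
  ⟨∅, Chain.genesis, ⟨Chain.genesis, 0⟩, Chain.genesis, Chain.genesis⟩

abbrev FullExecution (n : ℕ) (Tx : Type*) :=
  Execution n Tx (FinVote Tx) (Checkpoint Tx) (FullState n Tx)

/-- Validity of a propose message. No certificate is needed if `chC` is the chain of the proposed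
greatest justified checkpoint. -/
def fullValid (proposer : ℕ → Fin n) (q : Proposal n Tx (FinVote Tx) (Checkpoint Tx)) : Prop :=
  q.sender = proposer q.slot ∧ q.chain.p = q.slot ∧
    (Certifies q.Q q.chC ((q.slot : ℤ) - 1) ∨ (q.Q = ∅ ∧ q.chC = q.gj.chain))

/-- The update of `(gjFrozen, chFrozen)` when a received proposal is processed and `V` is the set of
received votes. -/
def fullOnProposal (proposer : ℕ → Fin n) (V : Finset (Vote n Tx (FinVote Tx)))
    (x : Checkpoint Tx × Chain Tx) (q : Proposal n Tx (FinVote Tx) (Checkpoint Tx)) :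
    Checkpoint Tx × Chain Tx :=
  if fullValid proposer q ∧ Justified V q.gj ∧ x.1.le q.gj then
    let c := if q.gj.chain ≼ x.2 then x.2 else q.gj.chain
    (q.gj, if c ≼ q.chC then q.chC else c)
  else x

/-- The target checkpoint of the finality vote in slot `t`. -/
def finTarget (gj : Checkpoint Tx) (ava : Chain Tx) (t : ℕ) : Checkpoint Tx :=
  if gj.c + 1 = t then ⟨ava, t⟩ else ⟨gj.chain, t⟩

/-- What the honest validator `i`, awake at round `r`, does in this round; `s` and `s'` are its
states before and after the round, `V` is its set of received votes, and `t` is the slot of `r`. -/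
structure FullStep (e : FullExecution n Tx) (proposer : ℕ → Fin n) (Δ κ : ℕ)
    (r : ℕ) (i : Fin n) (t : ℕ) (V : Finset (Vote n Tx (FinVote Tx)))
    (s s' : FullState n Tx) : Prop where
  propose :
    if r = proposing Δ t ∧ i ∈ e.active Δ r ∧ i = proposer t then
      ∃ c, IsExtend (e.pool r) (mfc V V (fastConfirm V ((t : ℤ) - 1)).1 t) t c ∧
        (e.sent r i).proposals = {⟨c, (fastConfirm V ((t : ℤ) - 1)).1,
          (fastConfirm V ((t : ℤ) - 1)).2, greatestJustified V, t, i⟩}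
    else (e.sent r i).proposals = ∅
  vote :
    if r = voting Δ t ∧ i ∈ e.active Δ r then
      ∃ c, e.IsVoteChoice proposer i r t (mfc s.frozen V s'.chFrozen t) c ∧
        (e.sent r i).votes = {⟨c, ⟨s'.gjFrozen, finTarget s'.gjFrozen s'.chAva t⟩, t, i⟩}
    else (e.sent r i).votes = ∅
  chAva : s'.chAva =
    if r = voting Δ t ∧ i ∈ e.active Δ r then
      Chain.longest {c | (c = s.chAva ∨ c = (mfc s.frozen V s'.chFrozen t).deep κ t ∨
          c = s'.gjFrozen.chain) ∧ c ≼ mfc s.frozen V s'.chFrozen t}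
    else if r = fastConfirming Δ t ∧ i ∈ e.active Δ r ∧ ¬ (fastConfirm V t).1 ≼ s.chAva then
      (fastConfirm V t).1
    else s.chAva
  chFin : s'.chFin =
    if r = voting Δ t ∧ i ∈ e.active Δ r then
      Chain.longest {c | c ≼ s'.chAva ∧ c ≼ (greatestFinalized V).chain}
    else if r = fastConfirming Δ t ∧ i ∈ e.active Δ r then (greatestFinalized V).chain
    else s.chFin
  frozen : s'.frozen = if r = merging Δ t then V else s.frozen
  /-- Outside merge rounds, `gjFrozen` and `chFrozen` are only updated in the vote round, by the
  proposals for slot `t` received in the rounds from `4Δt` to `4Δt + Δ`, in some order. -/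
  gjChFrozen :
    if r = merging Δ t then
      s'.gjFrozen = greatestJustified V ∧ s'.chFrozen = (fastConfirm V t).1
    else if r = voting Δ t then
      ∃ l : List (Proposal n Tx (FinVote Tx) (Checkpoint Tx)), l.Nodup ∧
        l.toFinset = (e.newProposals i (proposing Δ t) r).filter (fun q => q.slot = t) ∧
        (s'.gjFrozen, s'.chFrozen) =
          l.foldl (fullOnProposal proposer V) (s.gjFrozen, s.chFrozen)
    else s'.gjFrozen = s.gjFrozen ∧ s'.chFrozen = s.chFrozen

/-- All honest validators follow the full protocol; those that are asleep do nothing. -/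
def FullFollows (e : FullExecution n Tx) (proposer : ℕ → Fin n) (Δ κ : ℕ) : Prop :=
  ∀ r i, e.Honest r i →
    (i ∈ e.awake r → FullStep e proposer Δ κ r i (slotOf Δ r) (e.view r i).votes
      (e.prev FullState.init r i) (e.state r i)) ∧
    (i ∉ e.awake r → e.state r i = e.prev FullState.init r i ∧ e.sent r i = MsgSet.empty)

/-- A compliant execution with `GST = 0` of the full protocol. -/
def IsFullExecution (e : FullExecution n Tx) (proposer : ℕ → Fin n) (Δ κ : ℕ) : Prop :=
  e.Compliant Δ ∧ e.Synchronous Δ ∧ FullFollows e proposer Δ κ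

end Full

/-! ### Proposer election and adaptive adversaries -/

section Probability

open MeasureTheory ProbabilityTheory

variable {n : ℕ} {Ω : Type*} [m : MeasurableSpace Ω]

/-- A fair and unpredictable election of one proposer per slot. The σ-algebra `𝓕 t` is the
information available when the proposer of slot `t` has not yet been revealed. -/
structure IsElection (P : Measure Ω) (𝓕 : Filtration ℕ m) (proposer : ℕ → Ω → Fin n) : Prop where
  fair : ∀ t i, P {ω | proposer t ω = i} = (n : ENNReal)⁻¹
  unpredictable : ∀ t, Indep (𝓕 t) (MeasurableSpace.comap (proposer t) ⊤) P
  revealed : ∀ t, Measurable[𝓕 (t + 1)] (proposer t)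

/-- The adversary is adaptive: which validators are corrupted and which ones are asleep in the
rounds up to the propose round of slot `t` is decided on the basis of the information `𝓕 t`. -/
def Adapted {Tx F G S : Type*} (𝓕 : Filtration ℕ m) (Δ : ℕ) (e : Ω → Execution n Tx F G S) :
    Prop :=
  ∀ t r, r ≤ proposing Δ t → ∀ i, MeasurableSet[𝓕 t] {ω | i ∈ (e ω).corrupt r} ∧
    MeasurableSet[𝓕 t] {ω | i ∈ (e ω).awake r}

/-- Negligible functions: those that decay faster than the inverse of every polynomial. -/
def Negligible (ε : ℕ → ℝ) : Prop :=
  Asymptotics.SuperpolynomialDecay Filter.atTop (fun κ : ℕ => (κ : ℝ)) ε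

end Probability

end

end SleepyTOB

/-!
The proof separates a deterministic part, common to both protocols, from the election.

**Fixed chains.** A chain `c` is *fixed* at slot `t` (`FixedAt`) if all votes that active validators
cast in slot `t` extend `c`. The votes of a slot reach everyone before the next merge round, and by
the sleepiness constraint the validators that cast them and stay honest outnumber the corrupted
ones; so a chain fixed at `t` has majority support, in the frozen and in the current votes, in the
fork choice of slot `t + 1` (`VotesOncePerSlot.majoritySupport_of_fixedAt`). It stays fixed as soon
as the root of the fork choice is comparable with it (`AvailableRun.fixedAt_succ`). A root that is
fast-confirmed by votes of slot `t` is comparable, since more than a third of all validators are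
honest and among its voters. In the full protocol the root may also be the chain of a justified
checkpoint; such a chain was the available chain of an honest voter in an earlier slot
(`IsFullExecution.justified_out`), hence is itself fixed, by induction on slots.

**Confirmed chains are fixed.** A fast confirmation in slot `t` is gossiped before the merge round,
so that all roots of slot `t + 1` lie above the confirmed chain. For the `κ`-deep prefix, call a
slot *good* if its proposer is active at the propose round and still honest at the vote round. In a
good slot all active validators vote for the proposed chain (`AvailableRun.exists_proposed`): the
frozen votes of each of them are contained in the votes known to the proposer, and these in the
current votes, so that the fork choice of the proposer extends theirs
(`MajoritySupport.sandwich`). Hence the proposed chain is fixed, it contains the transaction pool,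
and the `κ`-deep prefixes taken during the next `κ` slots lie below it. If every window of `κ` slots
has a good slot, this gives safety, because two chains fixed at the same slot are comparable, and
liveness after `2κ` slots.

`AvailableRun` collects what this argument has to know about a protocol, and is established for the
protocol without and with finality component in `IsTobExecution.availableRun` and
`IsFullExecution.availableRun`.

**Election.** In each slot the proposer is active with probability at least `1 / n`, conditionally
on the past. An adaptive adversary may corrupt a proposer right after it is revealed, but spends a
new corruption on it. So a window of `κ` slots is split into `n` blocks of `κ / n` slots; if each of
them has an active proposer, one of these proposers stays honest (`exists_goodSlot`). A union bound
gives the error probability `errorBound`, which decays exponentially in `κ`.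
-/

namespace SleepyTOB

open scoped Classical

/-! ### Chains and their prefix order -/

namespace Chain

variable {Tx : Type*} {a b c d m : Chain Tx}

theorem eq_of_blocks (h : a.blocks = b.blocks) : a = b := by
  cases a; cases b; simp_all

theorem IsPrefix.refl (a : Chain Tx) : a ≼ a := List.prefix_refl _

theorem IsPrefix.trans (h : a ≼ b) (h' : b ≼ c) : a ≼ c := List.IsPrefix.trans h h'

theorem IsPrefix.antisymm (h : a ≼ b) (h' : b ≼ a) : a = b :=
  eq_of_blocks (h.eq_of_length (le_antisymm h.length_le h'.length_le))

theorem genesis_isPrefix (a : Chain Tx) : genesis ≼ a := List.nil_prefix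

theorem IsPrefix.total (h : a ≼ c) (h' : b ≼ c) : a ≼ b ∨ b ≼ a :=
  List.prefix_or_prefix_of_prefix h h'

theorem IsPrefix.contains (h : a ≼ b) {tx : Tx} (ha : a.Contains tx) : b.Contains tx := by
  obtain ⟨x, hx, ht⟩ := ha
  exact ⟨x, h.subset hx, ht⟩

theorem p_genesis : (genesis : Chain Tx).p = -1 := rfl

theorem slot_le_p {x : Block Tx} (hx : x ∈ a.blocks) : (x.slot : ℤ) ≤ a.p := by
  have hinc := a.increasing
  have hne : a.blocks ≠ [] := List.ne_nil_of_mem hx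
  unfold p
  rw [List.getLast?_eq_some_getLast hne]
  rw [← List.dropLast_append_getLast hne, List.mem_append] at hx
  rw [← List.dropLast_append_getLast hne, List.pairwise_append] at hinc
  rcases hx with hx | hx
  · have := hinc.2.2 x hx _ (List.mem_singleton.2 rfl)
    simp only [Nat.cast_le]; omega
  · rw [List.mem_singleton] at hx; rw [hx]

theorem p_le_of_forall {B : ℤ} (hB : -1 ≤ B) (h : ∀ x ∈ a.blocks, (x.slot : ℤ) ≤ B) :
    a.p ≤ B := by
  unfold p
  cases hl : a.blocks.getLast? with
  | none => exact hB
  | some x => exact h x (List.mem_of_getLast? hl)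

theorem neg_one_le_p (a : Chain Tx) : -1 ≤ a.p := by
  unfold p
  cases a.blocks.getLast? with
  | none => exact le_rfl
  | some x => simp only; omega

theorem IsPrefix.p_le (h : a ≼ b) : a.p ≤ b.p :=
  p_le_of_forall (neg_one_le_p b) fun _ hx => slot_le_p (h.subset hx)

/-- A prefix that is not lower is the whole chain, because slots increase strictly. -/
theorem IsPrefix.eq_of_p_le (h : a ≼ b) (hp : b.p ≤ a.p) : a = b := by
  obtain ⟨s, hs⟩ := h
  rcases List.eq_nil_or_concat s with rfl | ⟨l, x, rfl⟩
  · exact eq_of_blocks (by simpa using hs)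
  · exfalso
    have hinc := b.increasing
    have hx : x ∈ b.blocks := by rw [← hs]; simp
    have hxp := slot_le_p hx
    rw [← hs, List.pairwise_append] at hinc
    have : a.p ≤ (x.slot : ℤ) - 1 := p_le_of_forall (by omega) fun y hy => by
      have := hinc.2.2 y hy x (by simp)
      omega
    omega

theorem IsPrefix.of_p_le (ha : a ≼ m) (hb : b ≼ m) (hp : a.p ≤ b.p) : a ≼ b := by
  rcases ha.total hb with h | h
  · exact h
  · rw [h.eq_of_p_le hp]; exact IsPrefix.refl _

theorem deep_isPrefix (κ t : ℕ) (c : Chain Tx) : c.deep κ t ≼ c := List.takeWhile_prefix _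

theorem deep_slot_le {κ t : ℕ} {x : Block Tx} (hx : x ∈ (c.deep κ t).blocks) :
    (x.slot : ℤ) ≤ (t : ℤ) - κ := by
  have := List.all_takeWhile (p := fun b : Block Tx => decide ((b.slot : ℤ) ≤ (t : ℤ) - (κ : ℤ)))
    (l := c.blocks)
  rw [List.all_eq_true] at this
  simpa using this x hx

theorem deep_eq_genesis {κ t : ℕ} (h : t < κ) : c.deep κ t = genesis := by
  have h0 : (c.deep κ t).blocks = [] := List.eq_nil_iff_forall_not_mem.2 fun x hx => by
    have := deep_slot_le hx
    omega
  exact eq_of_blocks h0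

/-- The `κ`-deep prefix is dominated by every comparable chain that reaches slot `t - κ`. -/
theorem deep_isPrefix_of_le {κ t : ℕ} (hd : c.deep κ t ≼ m) (hb : b ≼ m)
    (hp : (t : ℤ) - κ ≤ b.p) : c.deep κ t ≼ b := by
  rcases hd.total hb with h | h
  · exact h
  · refine hd.of_p_le hb (p_le_of_forall (neg_one_le_p b) fun x hx => ?_)
    exact (deep_slot_le hx).trans hp

/-- The `κ`-deep prefix contains every prefix of height at most `t - κ`. -/
theorem isPrefix_deep {κ t : ℕ} (h : b ≼ c) (hp : b.p ≤ (t : ℤ) - κ) : b ≼ c.deep κ t := by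
  obtain ⟨s, hs⟩ := h
  unfold IsPrefix deep
  simp only
  rw [← hs, List.takeWhile_append_of_pos]
  · exact List.prefix_append _ _
  · intro x hx
    simpa using (slot_le_p hx).trans hp

theorem longest_spec {s : Set (Chain Tx)} (hne : s.Nonempty) {B : ℤ} (hB : ∀ c ∈ s, c.p ≤ B) :
    longest s ∈ s ∧ ∀ d ∈ s, d.p ≤ (longest s).p := by
  have hex : ∃ c, c ∈ s ∧ ∀ d ∈ s, d.p ≤ c.p := by
    obtain ⟨z, ⟨c, hc, rfl⟩, hmax⟩ := Int.exists_greatest_of_bdd (P := fun z => ∃ c ∈ s, c.p = z)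
      ⟨B, by rintro _ ⟨c, hc, rfl⟩; exact hB c hc⟩ ⟨_, hne.some, hne.some_mem, rfl⟩
    exact ⟨c, hc, fun d hd => hmax _ ⟨d, hd, rfl⟩⟩
  exact Classical.epsilon_spec (p := fun c => c ∈ s ∧ ∀ d ∈ s, d.p ≤ c.p) hex

/-- In a set of pairwise comparable chains of bounded height, `longest` is the greatest element for
the prefix order. -/
theorem longest_isGreatest {s : Set (Chain Tx)} (hne : s.Nonempty) {B : ℤ}
    (hB : ∀ c ∈ s, c.p ≤ B) (hcomp : ∀ c ∈ s, ∀ d ∈ s, c ≼ d ∨ d ≼ c) :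
    longest s ∈ s ∧ ∀ d ∈ s, d ≼ longest s := by
  obtain ⟨h1, h2⟩ := longest_spec hne hB
  refine ⟨h1, fun d hd => ?_⟩
  rcases hcomp d hd _ h1 with h | h
  · exact h
  · rw [h.eq_of_p_le (h2 d hd)]; exact IsPrefix.refl _

theorem longest_isGreatest_of_isPrefix {s : Set (Chain Tx)} (hne : s.Nonempty)
    (hm : ∀ c ∈ s, c ≼ m) : longest s ∈ s ∧ ∀ d ∈ s, d ≼ longest s :=
  longest_isGreatest hne (fun c hc => (hm c hc).p_le) fun c hc d hd => (hm c hc).total (hm d hd)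

end Chain

/-! ### Majority fork choice -/

section ForkChoice

variable {n : ℕ} {Tx F : Type*} {V V' W : Finset (Vote n Tx F)} {c d cC : Chain Tx} {t : ℕ}

theorem mem_equivocators {k : Fin n} : k ∈ equivocators V ↔
    ∃ v ∈ V, ∃ w ∈ V, v.voter = k ∧ w.voter = k ∧ v.slot = w.slot ∧ v.chain ≠ w.chain := Iff.rfl

theorem mem_supporting {x : Chain Tx × ℕ × Fin n} : x ∈ supporting V c t ↔
    ∃ v ∈ V, v.voter ∉ equivocators V ∧ t ≤ v.slot + 1 ∧
      (∀ w ∈ V, w.voter = v.voter → w.slot ≤ v.slot) ∧ c ≼ v.chain ∧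
      x = (v.chain, v.slot, v.voter) := by
  simp only [supporting, filLmd, filExp, filEq, Finset.mem_image, Finset.mem_filter]
  constructor
  · rintro ⟨v, ⟨⟨⟨⟨hv, he⟩, hs⟩, hl⟩, hc⟩, rfl⟩
    refine ⟨v, hv, he, hs, fun w hw hwv => ?_, hc, rfl⟩
    by_cases h : t ≤ w.slot + 1
    · exact hl w ⟨⟨hw, hwv ▸ he⟩, h⟩ hwv
    · omega
  · rintro ⟨v, hv, he, hs, hl, hc, rfl⟩
    exact ⟨v, ⟨⟨⟨⟨hv, he⟩, hs⟩, fun w hw => hl w hw.1.1⟩, hc⟩, rfl⟩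

theorem mem_unexpiredVoters {k : Fin n} :
    k ∈ unexpiredVoters V t ↔ ∃ v ∈ V, t ≤ v.slot + 1 ∧ v.voter = k := by
  simp only [unexpiredVoters, filExp, Finset.mem_image, Finset.mem_filter, and_assoc]

theorem supporting_voter_mem {x : Chain Tx × ℕ × Fin n} (hx : x ∈ supporting V c t) :
    x.2.2 ∈ unexpiredVoters V t := by
  obtain ⟨v, hv, -, hs, -, -, rfl⟩ := mem_supporting.1 hx
  exact mem_unexpiredVoters.2 ⟨v, hv, hs, rfl⟩

theorem supporting_isPrefix {x : Chain Tx × ℕ × Fin n} (hx : x ∈ supporting V c t) : c ≼ x.1 := by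
  obtain ⟨v, -, -, -, -, hc, rfl⟩ := mem_supporting.1 hx
  exact hc

/-- Every validator contributes at most one vote to the fork choice. -/
theorem supporting_voter_inj {x y : Chain Tx × ℕ × Fin n} (hx : x ∈ supporting V c t)
    (hy : y ∈ supporting V d t) (h : x.2.2 = y.2.2) : x = y := by
  obtain ⟨v, hv, he, hs, hl, hc, rfl⟩ := mem_supporting.1 hx
  obtain ⟨w, hw, he', hs', hl', hc', rfl⟩ := mem_supporting.1 hy
  simp only at h
  have hslot : v.slot = w.slot := le_antisymm (hl' v hv h) (hl w hw h.symm)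
  have hch : v.chain = w.chain := by
    by_contra hne
    exact he (mem_equivocators.2 ⟨v, hv, w, hw, rfl, h.symm, hslot, hne⟩)
  rw [hslot, hch, h]

/-- The condition that a candidate other than the root has to satisfy in `mfc V V' cC t`. -/
def MajoritySupport (V V' : Finset (Vote n Tx F)) (c : Chain Tx) (t : ℕ) : Prop :=
  (unexpiredVoters V' t).card < 2 * (supporting V c t ∩ supporting V' c t).card

theorem card_image_voter_inter :
    ((supporting V c t ∩ supporting V' c t).image fun x => x.2.2).card =
      (supporting V c t ∩ supporting V' c t).card := by
  refine Finset.card_image_of_injOn fun x hx y hy h => ?_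
  exact supporting_voter_inj (Finset.mem_inter.1 hx).2 (Finset.mem_inter.1 hy).2 h

theorem image_voter_inter_subset :
    ((supporting V c t ∩ supporting V' c t).image fun x => x.2.2) ⊆ unexpiredVoters V' t := by
  intro k hk
  obtain ⟨x, hx, rfl⟩ := Finset.mem_image.1 hk
  exact supporting_voter_mem (Finset.mem_inter.1 hx).2

/-- Two majorities share a voter, whose latest vote extends both chains. -/
theorem MajoritySupport.total (hc : MajoritySupport V V' c t) (hd : MajoritySupport V V' d t) :
    c ≼ d ∨ d ≼ c := by
  unfold MajoritySupport at hc hd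
  rw [← card_image_voter_inter] at hc hd
  obtain ⟨k, hk⟩ := Finset.inter_nonempty_of_card_lt_card_add_card
    (image_voter_inter_subset (V := V) (V' := V') (c := c) (t := t))
    (image_voter_inter_subset (V := V) (V' := V') (c := d) (t := t)) (by omega)
  rw [Finset.mem_inter, Finset.mem_image, Finset.mem_image] at hk
  obtain ⟨⟨x, hx, rfl⟩, ⟨y, hy, hxy⟩⟩ := hk
  rw [Finset.mem_inter] at hx hy
  have := supporting_voter_inj hy.2 hx.2 hxy
  subst this
  exact (supporting_isPrefix hx.2).total (supporting_isPrefix hy.2)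

theorem exists_bound_p (V : Finset (Vote n Tx F)) : ∃ B : ℤ, ∀ v ∈ V, v.chain.p ≤ B := by
  obtain ⟨B, hB⟩ := (V.image fun v => v.chain.p).bddAbove
  exact ⟨B, fun v hv => hB (Finset.mem_coe.2 (Finset.mem_image_of_mem _ hv))⟩

theorem MajoritySupport.exists_vote (hc : MajoritySupport V V' c t) :
    ∃ v ∈ V', c ≼ v.chain := by
  unfold MajoritySupport at hc
  obtain ⟨x, hx⟩ := Finset.card_pos.1 (by omega :
    0 < (supporting V c t ∩ supporting V' c t).card)
  obtain ⟨v, hv, -, -, -, h, -⟩ := mem_supporting.1 (Finset.mem_inter.1 hx).2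
  exact ⟨v, hv, h⟩

theorem mfc_spec (V V' : Finset (Vote n Tx F)) (cC : Chain Tx) (t : ℕ) :
    (cC ≼ mfc V V' cC t ∧ (mfc V V' cC t = cC ∨ MajoritySupport V V' (mfc V V' cC t) t)) ∧
      ∀ d, cC ≼ d → MajoritySupport V V' d t → d ≼ mfc V V' cC t := by
  obtain ⟨B, hB⟩ := exists_bound_p V'
  have := Chain.longest_isGreatest
    (s := {c | cC ≼ c ∧ (c = cC ∨ MajoritySupport V V' c t)}) (B := max B cC.p)
    ⟨cC, Chain.IsPrefix.refl _, Or.inl rfl⟩ ?_ ?_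
  · exact ⟨this.1, fun d h1 h2 => this.2 d ⟨h1, Or.inr h2⟩⟩
  · rintro c ⟨-, rfl | hc⟩
    · exact le_max_right _ _
    · obtain ⟨v, hv, h⟩ := hc.exists_vote
      exact (h.p_le.trans (hB v hv)).trans (le_max_left _ _)
  · rintro c ⟨hc, rfl | hc'⟩ d ⟨hd, rfl | hd'⟩
    · exact Or.inl hd
    · exact Or.inl hd
    · exact Or.inr hc
    · exact hc'.total hd'

theorem mfc_empty (V : Finset (Vote n Tx F)) (cC : Chain Tx) (t : ℕ) : mfc ∅ V cC t = cC := by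
  rcases (mfc_spec ∅ V cC t).1.2 with h | h
  · exact h
  · exfalso
    unfold MajoritySupport at h
    have : supporting (∅ : Finset (Vote n Tx F)) (mfc ∅ V cC t) t = ∅ := by
      ext x; simp [mem_supporting]
    rw [this] at h
    simp at h

/-- A majority for the pair `V ⊆ V'` is a majority in every intermediate set of votes. -/
theorem MajoritySupport.sandwich (h : MajoritySupport V V' c t) (hVW : V ⊆ W) (hW : W ⊆ V') :
    MajoritySupport W W c t := by
  unfold MajoritySupport at h ⊢
  have h1 : unexpiredVoters W t ⊆ unexpiredVoters V' t := by
    intro k hk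
    obtain ⟨v, hv, h2⟩ := mem_unexpiredVoters.1 hk
    exact mem_unexpiredVoters.2 ⟨v, hW hv, h2⟩
  have h2 : supporting V c t ∩ supporting V' c t ⊆ supporting W c t ∩ supporting W c t := by
    intro x hx
    rw [Finset.inter_self]
    rw [Finset.mem_inter] at hx
    obtain ⟨v, hv, -, hs, -, hc, rfl⟩ := mem_supporting.1 hx.1
    obtain ⟨w, hw, he, -, hl, -, hvw⟩ := mem_supporting.1 hx.2
    simp only [Prod.mk.injEq] at hvw
    refine mem_supporting.2 ⟨v, hVW hv, ?_, hs, ?_, hc, rfl⟩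
    · rw [hvw.2.2]
      rintro ⟨a, ha, b, hb, hab⟩
      exact he ⟨a, hW ha, b, hW hb, hab⟩
    · intro u hu huv
      rw [hvw.2.1]
      exact hl u (hW hu) (huv.trans hvw.2.2)
  have := Finset.card_le_card h1
  have := Finset.card_le_card h2
  omega

/-- If the voters in `H` have voted for extensions of `c` in slot `t` and nothing later, and they
outnumber the other voters, then `c` has majority support in slot `t + 1`. -/
theorem majoritySupport_of_votes (hVV : V ⊆ V') {H A : Finset (Fin n)} (hcard : A.card < H.card)
    (hH : ∀ k ∈ H, ∃ v ∈ V, v.voter = k ∧ v.slot = t ∧ c ≼ v.chain)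
    (hlast : ∀ k ∈ H, ∀ w ∈ V', w.voter = k → w.slot ≤ t)
    (heq : ∀ k ∈ H, k ∉ equivocators V')
    (hvoters : unexpiredVoters V' (t + 1) ⊆ H ∪ A) :
    MajoritySupport V V' c (t + 1) := by
  unfold MajoritySupport
  rw [← card_image_voter_inter]
  have h1 : H ⊆ (supporting V c (t + 1) ∩ supporting V' c (t + 1)).image fun x => x.2.2 := by
    intro k hk
    obtain ⟨v, hv, rfl, rfl, hc⟩ := hH k hk
    refine Finset.mem_image.2 ⟨(v.chain, v.slot, v.voter), Finset.mem_inter.2 ⟨?_, ?_⟩, rfl⟩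
    · refine mem_supporting.2 ⟨v, hv, ?_, le_rfl, fun w hw => hlast _ hk w (hVV hw), hc, rfl⟩
      rintro ⟨a, ha, b, hb, hab⟩
      exact heq _ hk ⟨a, hVV ha, b, hVV hb, hab⟩
    · exact mem_supporting.2 ⟨v, hVV hv, heq _ hk, le_rfl, hlast _ hk, hc, rfl⟩
  have h2 := Finset.card_le_card h1
  have h3 := (Finset.card_le_card hvoters).trans (Finset.card_union_le _ _)
  omega

/-- If the voters in `H` outnumber those in `A` and there are no others, then a majority contains a
voter from `H`. -/
theorem MajoritySupport.exists_mem (h : MajoritySupport V V' c t) {H A : Finset (Fin n)}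
    (hcard : A.card < H.card) (hH : H ⊆ unexpiredVoters V' t)
    (hvoters : unexpiredVoters V' t ⊆ H ∪ A) :
    ∃ v ∈ V', v.voter ∈ H ∧ t ≤ v.slot + 1 ∧ c ≼ v.chain := by
  unfold MajoritySupport at h
  rw [← card_image_voter_inter] at h
  set S := (supporting V c t ∩ supporting V' c t).image fun x => x.2.2 with hS
  by_cases hd : Disjoint S H
  · exfalso
    have hSA : S ⊆ A := fun k hk => by
      rcases Finset.mem_union.1 (hvoters (image_voter_inter_subset hk)) with h' | h'
      · exact absurd h' (Finset.disjoint_left.1 hd hk)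
      · exact h'
    have h1 := Finset.card_le_card hSA
    have h2 := Finset.card_le_card (Finset.union_subset image_voter_inter_subset hH :
      S ∪ H ⊆ unexpiredVoters V' t)
    rw [Finset.card_union_of_disjoint hd] at h2
    omega
  · rw [Finset.not_disjoint_iff] at hd
    obtain ⟨k, hk, hkH⟩ := hd
    obtain ⟨x, hx, rfl⟩ := Finset.mem_image.1 hk
    obtain ⟨v, hv, -, hs, -, hc, rfl⟩ := mem_supporting.1 (Finset.mem_inter.1 hx).2
    exact ⟨v, hv, hkH, hs, hc⟩

/-! ### Fast confirmation -/

theorem mem_fastCands {s : ℤ} : c ∈ fastCands V s ↔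
    2 * n ≤ 3 * ((V.filter (fun v => (v.slot : ℤ) = s ∧ c ≼ v.chain)).image Vote.voter).card :=
  Iff.rfl

theorem fastCands_mono {s : ℤ} (h : V ⊆ W) : fastCands V s ⊆ fastCands W s := by
  intro c hc
  rw [mem_fastCands] at hc ⊢
  have := Finset.card_le_card (Finset.image_subset_image (f := Vote.voter)
    (Finset.filter_subset_filter (fun v => (v.slot : ℤ) = s ∧ c ≼ v.chain) h))
  omega

theorem Certifies.mem_fastCands {Q : Finset (Vote n Tx F)} {s : ℤ} (h : Certifies Q c s)
    (hQ : Q ⊆ V) : c ∈ fastCands V s := by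
  have h1 : Q ⊆ V.filter (fun v => (v.slot : ℤ) = s ∧ c ≼ v.chain) := fun v hv =>
    Finset.mem_filter.2 ⟨hQ hv, h.1 v hv⟩
  have := Finset.card_le_card (Finset.image_subset_image (f := Vote.voter) h1)
  have := h.2
  show 2 * n ≤ _
  omega

theorem fastCands_bounded (hn : 0 < n) (V : Finset (Vote n Tx F)) (s : ℤ) :
    ∃ B : ℤ, ∀ c ∈ fastCands V s, c.p ≤ B := by
  obtain ⟨B, hB⟩ := exists_bound_p V
  refine ⟨B, fun c hc => ?_⟩
  rw [mem_fastCands] at hc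
  obtain ⟨k, hk⟩ := Finset.card_pos.1 (by omega : 0 <
    ((V.filter (fun v => (v.slot : ℤ) = s ∧ c ≼ v.chain)).image Vote.voter).card)
  obtain ⟨v, hv, -⟩ := Finset.mem_image.1 hk
  rw [Finset.mem_filter] at hv
  exact hv.2.2.p_le.trans (hB v hv.1)

theorem fastConfirmSimple_mem (hn : 0 < n) {s : ℤ} (h : (fastCands V s).Nonempty) :
    (fastConfirmSimple V s).1 ∈ fastCands V s := by
  obtain ⟨B, hB⟩ := fastCands_bounded hn V s
  rw [fastConfirmSimple, if_pos h]
  exact (Chain.longest_spec h hB).1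

theorem fastConfirmSimple_eq_genesis {s : ℤ} (h : ¬ (fastCands V s).Nonempty) :
    fastConfirmSimple V s = (Chain.genesis, ∅) := by
  rw [fastConfirmSimple, if_neg h]

theorem fastConfirmSimple_mem_or (hn : 0 < n) (V : Finset (Vote n Tx F)) (s : ℤ) :
    (fastConfirmSimple V s).1 ∈ fastCands V s ∨ (fastConfirmSimple V s).1 = Chain.genesis := by
  by_cases h : (fastCands V s).Nonempty
  · exact Or.inl (fastConfirmSimple_mem hn h)
  · exact Or.inr (by rw [fastConfirmSimple_eq_genesis h])

theorem isPrefix_fastConfirmSimple (hn : 0 < n) {s : ℤ}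
    (hcomp : ∀ c ∈ fastCands V s, ∀ d ∈ fastCands V s, c ≼ d ∨ d ≼ c) (h : c ∈ fastCands V s) :
    c ≼ (fastConfirmSimple V s).1 := by
  obtain ⟨B, hB⟩ := fastCands_bounded hn V s
  rw [fastConfirmSimple, if_pos ⟨c, h⟩]
  exact (Chain.longest_isGreatest ⟨c, h⟩ hB hcomp).2 c h

theorem fastConfirmSimple_mono (hn : 0 < n) {s : ℤ} (hVW : V ⊆ W)
    (hcomp : ∀ c ∈ fastCands W s, ∀ d ∈ fastCands W s, c ≼ d ∨ d ≼ c) :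
    (fastConfirmSimple V s).1 ≼ (fastConfirmSimple W s).1 := by
  rcases fastConfirmSimple_mem_or hn V s with h | h
  · exact isPrefix_fastConfirmSimple hn hcomp (fastCands_mono hVW h)
  · rw [h]; exact Chain.genesis_isPrefix _

theorem certifies_fastConfirmSimple (hn : 0 < n) (V : Finset (Vote n Tx F)) (s : ℤ) :
    Certifies (fastConfirmSimple V s).2 (fastConfirmSimple V s).1 s ∨
      ((fastConfirmSimple V s).2 = ∅ ∧ (fastConfirmSimple V s).1 = Chain.genesis) := by
  by_cases h : (fastCands V s).Nonempty
  · left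
    have hm := fastConfirmSimple_mem hn h
    rw [fastConfirmSimple, if_pos h] at hm ⊢
    exact ⟨fun v hv => (Finset.mem_filter.1 hv).2, hm⟩
  · right
    rw [fastConfirmSimple_eq_genesis h]
    exact ⟨rfl, rfl⟩

end ForkChoice

/-! ### The round structure -/

section Time

variable {Δ t t' r : ℕ}

theorem voting_lt_iff (hΔ : 0 < Δ) : voting Δ t < voting Δ t' ↔ t < t' := by
  unfold voting
  simp [hΔ]

theorem voting_le_iff (hΔ : 0 < Δ) : voting Δ t ≤ voting Δ t' ↔ t ≤ t' := by
  unfold voting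
  simp [hΔ]

theorem voting_inj (hΔ : 0 < Δ) : voting Δ t = voting Δ t' ↔ t = t' := by
  unfold voting
  simp [hΔ.ne']

theorem proposing_add : proposing Δ t + Δ = voting Δ t := rfl

theorem merging_add : merging Δ t + Δ = proposing Δ (t + 1) := by
  unfold merging proposing; ring

theorem voting_add : voting Δ t + Δ = fastConfirming Δ t := by
  unfold voting fastConfirming; ring

theorem fastConfirming_add : fastConfirming Δ t + Δ = merging Δ t := by
  unfold merging fastConfirming; ring

theorem le_voting (hΔ : 0 < Δ) (t : ℕ) : t ≤ voting Δ t := by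
  unfold voting
  nlinarith

theorem slotOf_eq (h : proposing Δ t ≤ r) (h' : r < proposing Δ (t + 1)) : slotOf Δ r = t := by
  unfold proposing at h h'
  exact Nat.div_eq_of_lt_le (by linarith) (by linarith)

theorem merging_lt_iff (hΔ : 0 < Δ) : merging Δ t < merging Δ t' ↔ t < t' := by
  unfold merging
  simp [hΔ]

theorem ne_merging (hΔ : 0 < Δ) (h : merging Δ t < r) (h' : r ≤ voting Δ (t + 1)) (s : ℕ) :
    r ≠ merging Δ s := by
  rintro rfl
  have h1 := (merging_lt_iff hΔ).1 h
  have h2 := (merging_lt_iff hΔ (t := s) (t' := t + 1)).1 (lt_of_le_of_lt h' (by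
    unfold voting merging; omega))
  omega

theorem ne_merging_of_le_voting_zero (hΔ : 0 < Δ) (h : r ≤ voting Δ 0) (s : ℕ) :
    r ≠ merging Δ s := by
  rintro rfl
  unfold merging voting at h
  nlinarith

theorem slotOf_proposing (hΔ : 0 < Δ) : slotOf Δ (proposing Δ t) = t :=
  slotOf_eq le_rfl (by unfold proposing; nlinarith)

theorem slotOf_voting (hΔ : 0 < Δ) : slotOf Δ (voting Δ t) = t :=
  slotOf_eq (by unfold proposing voting; omega) (by unfold proposing voting; nlinarith)

theorem slotOf_merging (hΔ : 0 < Δ) : slotOf Δ (merging Δ t) = t :=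
  slotOf_eq (by unfold proposing merging; omega) (by unfold proposing merging; nlinarith)

end Time

/-! ### Sleepy executions -/

namespace Execution

variable {n : ℕ} {Tx F G S : Type*} {e : Execution n Tx F G S} {Δ t r r' : ℕ} {i k : Fin n}

theorem honest_of_le (hc : e.Compliant Δ) (h : r ≤ r') (hi : e.Honest r' i) : e.Honest r i :=
  fun hr => hi (hc.corrupt_mono r r' h hr)

theorem awake_of_active (h : i ∈ e.active Δ r) : i ∈ e.awake r := by
  rcases h.2 with h | ⟨t, ht, h⟩
  · exact h r le_rfl
  · refine h r (le_trans ?_ ht) le_rfl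
    unfold voting; nlinarith

/-- A validator that is active in a vote round has been awake since the fast-confirm round of the
preceding slot. -/
theorem awake_of_active_voting (hΔ : 0 < Δ) (h : i ∈ e.active Δ (voting Δ (t + 1)))
    (h1 : fastConfirming Δ t ≤ r) (h2 : r ≤ voting Δ (t + 1)) : i ∈ e.awake r := by
  rcases h.2 with h | ⟨t0, ht, h⟩
  · exact h r h2
  · refine h r (le_trans ?_ h1) h2
    rw [voting_le_iff hΔ] at ht
    rw [← voting_add]
    have := (voting_le_iff hΔ (t := t0) (t' := t)).2 (by omega)
    omega

theorem awake_of_active_voting_zero (hΔ : 0 < Δ) (h : i ∈ e.active Δ (voting Δ 0))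
    (h2 : r ≤ voting Δ 0) : i ∈ e.awake r := by
  rcases h.2 with h | ⟨t0, ht, h⟩
  · exact h r h2
  · rw [voting_le_iff hΔ] at ht; omega

/-- A validator that is active at some round was already active at the last vote round, because
validators that join become active only in vote rounds. -/
theorem active_voting_of_active (hΔ : 0 < Δ) (hc : e.Compliant Δ) (h : i ∈ e.active Δ r)
    (h1 : voting Δ t ≤ r) (h2 : r < voting Δ (t + 1)) : i ∈ e.active Δ (voting Δ t) := by
  refine ⟨honest_of_le hc h1 h.1, ?_⟩
  rcases h.2 with h | ⟨t0, ht, h⟩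
  · exact Or.inl fun r' hr' => h r' (hr'.trans h1)
  · refine Or.inr ⟨t0, ?_, fun r' a b => h r' a (b.trans h1)⟩
    have := (voting_lt_iff hΔ).1 (ht.trans_lt h2)
    exact (voting_le_iff hΔ).2 (by omega)

theorem active_voting_nonempty (hc : e.Compliant Δ) (t : ℕ) :
    (e.active Δ (voting Δ t)).Nonempty := by
  have := hc.sleepiness t
  obtain ⟨i, hi⟩ := Set.nonempty_of_ncard_ne_zero (by omega :
    (e.active Δ (voting Δ t) \ (e.corrupt (voting Δ (t + 1)) : Set (Fin n))).ncard ≠ 0)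
  exact ⟨i, hi.1⟩

theorem view_mono (hc : e.Compliant Δ) (hs : e.Synchronous Δ) (h : r ≤ r') (hi : e.Honest r' i) :
    (e.view r i).votes ⊆ (e.view r' i).votes := by
  induction r', h using Nat.le_induction with
  | base => exact subset_rfl
  | succ k hk ih =>
    exact (ih (honest_of_le hc k.le_succ hi)).trans (hs.view_votes_mono k i hi)

/-- Among voters that are at least two thirds of all validators, one is never corrupted. -/
theorem exists_neverCorrupt (hc : e.Compliant Δ) {s : Finset (Fin n)} (h : 2 * n ≤ 3 * s.card) :
    ∃ k ∈ s, ∀ r, e.Honest r k := by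
  by_contra! hcon
  have hsub : (s : Set (Fin n)) ⊆ e.everCorrupt := fun k hk => by
    obtain ⟨r, hr⟩ := hcon k hk
    exact ⟨r, not_not.1 hr⟩
  have h1 := Set.ncard_le_ncard hsub (Set.toFinite _)
  rw [Set.ncard_coe_finset] at h1
  have := hc.few_corrupt
  omega

/-- Two sets of at least two thirds of all validators share a validator that is never corrupted. -/
theorem exists_neverCorrupt_inter (hc : e.Compliant Δ) {s s' : Finset (Fin n)}
    (h : 2 * n ≤ 3 * s.card) (h' : 2 * n ≤ 3 * s'.card) :
    ∃ k ∈ s, k ∈ s' ∧ ∀ r, e.Honest r k := by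
  by_contra! hcon
  have hsub : ((s ∩ s' : Finset (Fin n)) : Set (Fin n)) ⊆ e.everCorrupt := fun k hk => by
    rw [Finset.mem_coe, Finset.mem_inter] at hk
    obtain ⟨r, hr⟩ := hcon k hk.1 hk.2
    exact ⟨r, not_not.1 hr⟩
  have h1 := Set.ncard_le_ncard hsub (Set.toFinite _)
  rw [Set.ncard_coe_finset] at h1
  have h2 := Finset.card_union_add_card_inter s s'
  have h3 : (s ∪ s').card ≤ n := by simpa using Finset.card_le_univ (s ∪ s')
  have := hc.few_corrupt
  omega

theorem pos_of_compliant (hc : e.Compliant Δ) : 0 < n := by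
  have := hc.few_corrupt
  omega

end Execution

/-! ### Votes of honest validators and the fork choice -/

section Voting

variable {n : ℕ} {Tx F G S : Type*}

/-- The facts on compliant, synchronous executions and on the votes of honest validators that do not
depend on how votes are computed: an honest validator votes in the vote rounds in which it is active,
exactly once. -/
structure VotesOncePerSlot (e : Execution n Tx F G S) (Δ : ℕ) : Prop where
  delta_pos : 0 < Δ
  compliant : e.Compliant Δ
  sync : e.Synchronous Δ
  sent_vote : ∀ r i, e.Honest r i → ∀ v ∈ (e.sent r i).votes,
    r = voting Δ v.slot ∧ i ∈ e.active Δ r ∧ v.voter = i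
  exists_vote : ∀ t, ∀ i ∈ e.active Δ (voting Δ t), ∃ v, (e.sent (voting Δ t) i).votes = {v}

/-- `c` is fixed at slot `t`: all votes that active validators cast in slot `t` extend `c`. -/
def FixedAt (e : Execution n Tx F G S) (Δ t : ℕ) (c : Chain Tx) : Prop :=
  ∀ i ∈ e.active Δ (voting Δ t), ∀ v ∈ (e.sent (voting Δ t) i).votes, c ≼ v.chain

/-- Some active validator votes for an extension of `c` in slot `t`. -/
def BackedAt (e : Execution n Tx F G S) (Δ t : ℕ) (c : Chain Tx) : Prop :=
  ∃ i ∈ e.active Δ (voting Δ t), ∃ v ∈ (e.sent (voting Δ t) i).votes, c ≼ v.chain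

/-- The active validators of slot `t` that are still honest in the vote round of slot `t + 1`. -/
noncomputable def stayers (e : Execution n Tx F G S) (Δ t : ℕ) : Finset (Fin n) :=
  Finset.univ.filter fun k => k ∈ e.active Δ (voting Δ t) ∧ e.Honest (voting Δ (t + 1)) k

theorem FixedAt.total {e : Execution n Tx F G S} {Δ t : ℕ} {c d : Chain Tx} (hc : FixedAt e Δ t c) (hd : BackedAt e Δ t d) :
    c ≼ d ∨ d ≼ c := by
  obtain ⟨i, hi, v, hv, hdv⟩ := hd
  exact (hc i hi v hv).total hdv

namespace VotesOncePerSlot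

variable {e : Execution n Tx F G S} {Δ t r : ℕ} {i k : Fin n} {v w : Vote n Tx F} {c d : Chain Tx}

theorem of_mem_view (h : VotesOncePerSlot e Δ) (hi : e.Honest r i) (hv : v ∈ (e.view r i).votes)
    (hk : e.Honest r v.voter) : voting Δ v.slot < r ∧ v.voter ∈ e.active Δ (voting Δ v.slot) ∧
      v ∈ (e.sent (voting Δ v.slot) v.voter).votes := by
  obtain ⟨r', hr', hs⟩ := h.sync.unforgeable_vote r i hi v hv hk
  obtain ⟨rfl, h2, -⟩ := h.sent_vote r' _ (Execution.honest_of_le h.compliant hr'.le hk) v hs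
  exact ⟨hr', h2, hs⟩

theorem sent_unique (h : VotesOncePerSlot e Δ) (hi : i ∈ e.active Δ (voting Δ t))
    (hv : v ∈ (e.sent (voting Δ t) i).votes) (hw : w ∈ (e.sent (voting Δ t) i).votes) : v = w := by
  obtain ⟨u, hu⟩ := h.exists_vote t i hi
  rw [hu, Finset.mem_singleton] at hv hw
  rw [hv, hw]

theorem view_unique (h : VotesOncePerSlot e Δ) (hi : e.Honest r i) (hv : v ∈ (e.view r i).votes)
    (hw : w ∈ (e.view r i).votes) (hk : e.Honest r v.voter) (hvw : w.voter = v.voter)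
    (hs : w.slot = v.slot) : v = w := by
  obtain ⟨-, h2, h3⟩ := h.of_mem_view hi hv hk
  obtain ⟨-, -, h4⟩ := h.of_mem_view hi hw (hvw ▸ hk)
  rw [hvw, hs] at h4
  exact h.sent_unique h2 h3 h4

theorem fixedAt_genesis : FixedAt e Δ t Chain.genesis := fun _ _ _ _ => Chain.genesis_isPrefix _

theorem backedAt_of_fixedAt (h : VotesOncePerSlot e Δ) (hc : FixedAt e Δ t c) :
    BackedAt e Δ t c := by
  obtain ⟨i, hi⟩ := Execution.active_voting_nonempty h.compliant t
  obtain ⟨v, hv⟩ := h.exists_vote t i hi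
  have hv' : v ∈ (e.sent (voting Δ t) i).votes := by rw [hv]; exact Finset.mem_singleton_self v
  exact ⟨i, hi, v, hv', hc i hi v hv'⟩

/-- A fast-confirmed chain has been voted for by an honest validator. -/
theorem backedAt_of_mem_fastCands (h : VotesOncePerSlot e Δ) (hi : e.Honest r i)
    (hc : c ∈ fastCands (e.view r i).votes t) : BackedAt e Δ t c := by
  obtain ⟨k, hk, hh⟩ := Execution.exists_neverCorrupt h.compliant hc
  obtain ⟨v, hv, rfl⟩ := Finset.mem_image.1 hk
  rw [Finset.mem_filter, Nat.cast_inj] at hv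
  obtain ⟨hv, rfl, hcv⟩ := hv
  obtain ⟨-, h2, h3⟩ := h.of_mem_view hi hv (hh r)
  exact ⟨_, h2, v, h3, hcv⟩

theorem slot_nonneg_of_mem_fastCands (h : VotesOncePerSlot e Δ) {s : ℤ}
    (hc : c ∈ fastCands (e.view r i).votes s) : 0 ≤ s := by
  obtain ⟨k, hk, hh⟩ := Execution.exists_neverCorrupt h.compliant hc
  obtain ⟨v, hv, rfl⟩ := Finset.mem_image.1 hk
  rw [Finset.mem_filter] at hv
  omega

theorem fastCands_total (h : VotesOncePerSlot e Δ) (hi : e.Honest r i) {s : ℤ} :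
    ∀ c ∈ fastCands (e.view r i).votes s, ∀ d ∈ fastCands (e.view r i).votes s,
      c ≼ d ∨ d ≼ c := by
  intro c hc d hd
  obtain ⟨k, hk, hk', hh⟩ := Execution.exists_neverCorrupt_inter h.compliant hc hd
  obtain ⟨v, hv, rfl⟩ := Finset.mem_image.1 hk
  obtain ⟨w, hw, hvw⟩ := Finset.mem_image.1 hk'
  rw [Finset.mem_filter] at hv hw
  obtain rfl := h.view_unique hi hv.1 hw.1 (hh r) hvw (by omega)
  exact hv.2.2.total hw.2.2

theorem card_lt_card_stayers (h : VotesOncePerSlot e Δ) (t : ℕ) :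
    (e.corrupt (voting Δ (t + 1))).card < (stayers e Δ t).card := by
  have := h.compliant.sleepiness t
  rw [← Set.ncard_coe_finset (stayers e Δ t)]
  convert this using 2
  ext k
  rw [Finset.mem_coe, stayers, Finset.mem_filter]
  simp [Execution.Honest]

/-- In the views of honest validators up to the vote round of slot `t + 1`, the voters that count in
slot `t + 1` are active validators of slot `t` and corrupted ones. -/
theorem unexpiredVoters_subset (h : VotesOncePerSlot e Δ) (hi : e.Honest r i)
    (hr : r ≤ voting Δ (t + 1)) :
    unexpiredVoters (e.view r i).votes (t + 1) ⊆
      stayers e Δ t ∪ e.corrupt (voting Δ (t + 1)) := by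
  intro k hk
  obtain ⟨v, hv, hs, rfl⟩ := mem_unexpiredVoters.1 hk
  by_cases hh : e.Honest (voting Δ (t + 1)) v.voter
  · obtain ⟨h1, h2, -⟩ := h.of_mem_view hi hv (Execution.honest_of_le h.compliant hr hh)
    have := (voting_lt_iff h.delta_pos).1 (h1.trans_le hr)
    have hst : v.slot = t := by omega
    rw [hst] at h2
    exact Finset.mem_union_left _ (by simp [stayers, h2, hh])
  · exact Finset.mem_union_right _ (not_not.1 hh)

theorem slot_le_of_mem_view (h : VotesOncePerSlot e Δ) (hi : e.Honest r i)
    (hr : r ≤ voting Δ (t + 1)) (hv : v ∈ (e.view r i).votes)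
    (hk : e.Honest (voting Δ (t + 1)) v.voter) : v.slot ≤ t := by
  obtain ⟨h1, -, -⟩ := h.of_mem_view hi hv (Execution.honest_of_le h.compliant hr hk)
  have := (voting_lt_iff h.delta_pos).1 (h1.trans_le hr)
  omega

theorem vote_mem_view (h : VotesOncePerSlot e Δ) (hk : k ∈ e.active Δ (voting Δ t))
    (hr : merging Δ t ≤ r) (hi : e.Honest r i) (ha : i ∈ e.awake r) :
    (e.sent (voting Δ t) k).votes ⊆ (e.view r i).votes := by
  refine h.sync.deliver_vote _ k r i hk.1 (le_trans ?_ hr) hi ha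
  unfold voting merging; omega

/-- A chain fixed at slot `t` has majority support in slot `t + 1`. -/
theorem majoritySupport_of_fixedAt (h : VotesOncePerSlot e Δ) (hc : FixedAt e Δ t c)
    {V : Finset (Vote n Tx F)} (hV : V ⊆ (e.view r i).votes) (hi : e.Honest r i)
    (hr : r ≤ voting Δ (t + 1))
    (hsent : ∀ k ∈ e.active Δ (voting Δ t), (e.sent (voting Δ t) k).votes ⊆ V) :
    MajoritySupport V (e.view r i).votes c (t + 1) := by
  refine majoritySupport_of_votes hV (h.card_lt_card_stayers t) ?_ ?_ ?_
    (h.unexpiredVoters_subset hi hr)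
  · intro k hk
    simp only [stayers, Finset.mem_filter, Finset.mem_univ, true_and] at hk
    obtain ⟨v, hv⟩ := h.exists_vote t k hk.1
    have hv' : v ∈ (e.sent (voting Δ t) k).votes := by rw [hv]; exact Finset.mem_singleton_self v
    obtain ⟨h1, -, h3⟩ := h.sent_vote _ k hk.1.1 v hv'
    exact ⟨v, hsent k hk.1 hv', h3, ((voting_inj h.delta_pos).1 h1).symm, hc k hk.1 v hv'⟩
  · rintro k hk w hw rfl
    simp only [stayers, Finset.mem_filter, Finset.mem_univ, true_and] at hk
    exact h.slot_le_of_mem_view hi hr hw hk.2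
  · rintro k hk ⟨v, hv, w, hw, rfl, hwv, hs, hne⟩
    simp only [stayers, Finset.mem_filter, Finset.mem_univ, true_and] at hk
    exact hne (congrArg _ (h.view_unique hi hv hw
      (Execution.honest_of_le h.compliant hr hk.2) hwv hs.symm))

/-- A chain with majority support in slot `t + 1` is backed by an active validator of slot `t`. -/
theorem backedAt_of_majoritySupport (h : VotesOncePerSlot e Δ) {V : Finset (Vote n Tx F)}
    (hm : MajoritySupport V (e.view r i).votes c (t + 1)) (hi : e.Honest r i)
    (ha : i ∈ e.awake r) (hr : merging Δ t ≤ r) (hr' : r ≤ voting Δ (t + 1)) :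
    BackedAt e Δ t c := by
  have hsub : stayers e Δ t ⊆ unexpiredVoters (e.view r i).votes (t + 1) := by
    intro k hk
    simp only [stayers, Finset.mem_filter, Finset.mem_univ, true_and] at hk
    obtain ⟨v, hv⟩ := h.exists_vote t k hk.1
    have hv' : v ∈ (e.sent (voting Δ t) k).votes := by rw [hv]; exact Finset.mem_singleton_self v
    obtain ⟨h1, -, h3⟩ := h.sent_vote _ k hk.1.1 v hv'
    have := (voting_inj h.delta_pos).1 h1
    exact mem_unexpiredVoters.2 ⟨v, h.vote_mem_view hk.1 hr hi ha hv', by omega, h3⟩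
  obtain ⟨v, hv, hH, hs, hcv⟩ := hm.exists_mem (h.card_lt_card_stayers t) hsub
    (h.unexpiredVoters_subset hi hr')
  simp only [stayers, Finset.mem_filter, Finset.mem_univ, true_and] at hH
  obtain ⟨h1, h2, h3⟩ := h.of_mem_view hi hv (Execution.honest_of_le h.compliant hr' hH.2)
  have := (voting_lt_iff h.delta_pos).1 (h1.trans_le hr')
  have hst : v.slot = t := by omega
  rw [hst] at h2 h3
  exact ⟨_, h2, v, h3, hcv⟩

end VotesOncePerSlot

end Voting

/-! ### Safety and liveness from good slots -/

section Available

variable {n : ℕ} {Tx F G S : Type*}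

/-- What the security argument has to know about the local computations of a protocol: `frozen t i`
and `root t i` are the frozen votes and the frozen chain that `i` feeds into the fork choice in the
vote round of slot `t`, `justified r i c` says that `c` is the chain of a justified checkpoint in the
view of `i` at round `r`, `out` is the confirmed chain and `init` the initial state. -/
structure LocalData (n : ℕ) (Tx F S : Type*) where
  frozen : ℕ → Fin n → Finset (Vote n Tx F)
  root : ℕ → Fin n → Chain Tx
  justified : ℕ → Fin n → Chain Tx → Prop
  out : S → Chain Tx
  init : S

namespace LocalData

/-- The output of the fork choice of `i` in the vote round of slot `t`. -/
noncomputable def head (D : LocalData n Tx F S) (e : Execution n Tx F G S) (Δ t : ℕ) (i : Fin n) :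
    Chain Tx :=
  mfc (D.frozen t i) (e.view (voting Δ t) i).votes (D.root t i) t

/-- The chains that `i` may use as root of the fork choice of slot `t + 1`: those fast-confirmed by
votes of slot `t`, and the justified ones. -/
def IsRoot (D : LocalData n Tx F S) (e : Execution n Tx F G S) (r : ℕ) (i : Fin n) (t : ℕ)
    (c : Chain Tx) : Prop :=
  c ∈ fastCands (e.view r i).votes t ∨ D.justified r i c

/-- All possible roots are pairwise comparable. -/
def RootsTotal (D : LocalData n Tx F S) (e : Execution n Tx F G S) (r : ℕ) (i : Fin n) (t : ℕ) :
    Prop :=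
  ∀ c d, D.IsRoot e r i t c → D.IsRoot e r i t d → c ≼ d ∨ d ≼ c

end LocalData

/-- The proposer of slot `t` is active when it proposes, and is not corrupted before the vote round,
so that it does not send a second proposal. -/
def GoodSlot (e : Execution n Tx F G S) (proposer : ℕ → Fin n) (Δ t : ℕ) : Prop :=
  proposer t ∈ e.active Δ (proposing Δ t) ∧ e.Honest (voting Δ t) (proposer t)

/-- Every window of `κ` consecutive slots that starts after slot `a`, for `a ≤ N`, has a good
slot. -/
def GoodWindows (e : Execution n Tx F G S) (proposer : ℕ → Fin n) (Δ κ N : ℕ) :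
    Prop :=
  ∀ a ≤ N, ∃ s, a < s ∧ s ≤ a + κ ∧ GoodSlot e proposer Δ s

/-- A validator that is still honest has no proposal in circulation but the one it has sent. -/
theorem eq_of_mem_view_proposals {e : Execution n Tx F G S} {Δ t r : ℕ} {i p : Fin n}
    {q q' : Proposal n Tx F G} (hc : e.Compliant Δ) (hs : e.Synchronous Δ)
    (hsent : ∀ r i, e.Honest r i → ∀ q ∈ (e.sent r i).proposals, r = proposing Δ q.slot)
    (hq : (e.sent (proposing Δ t) p).proposals = {q}) (hp : e.Honest r p) (hi : e.Honest r i)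
    (hq' : q' ∈ (e.view r i).proposals) (ht : q'.slot = t) (hsender : q'.sender = p) :
    q' = q ∧ proposing Δ t < r := by
  subst hsender
  obtain ⟨r', hr', hm⟩ := hs.unforgeable_proposal r i hi q' hq' hp
  have := hsent r' _ (Execution.honest_of_le hc hr'.le hp) q' hm
  rw [ht] at this
  subst this
  rw [hq, Finset.mem_singleton] at hm
  exact ⟨hm, hr'⟩

/-- An execution of a protocol with an available chain. The clauses hold both with and without the
finality component, and they are all that safety needs. -/
structure AvailableRun (e : Execution n Tx F G S) (proposer : ℕ → Fin n) (Δ κ : ℕ)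
    (D : LocalData n Tx F S) : Prop extends VotesOncePerSlot e Δ where
  kappa_pos : 0 < κ
  vote_choice : ∀ t, ∀ i ∈ e.active Δ (voting Δ t), ∀ v ∈ (e.sent (voting Δ t) i).votes,
    e.IsVoteChoice proposer i (voting Δ t) t (D.head e Δ t i) v.chain
  sent_proposal : ∀ r i, e.Honest r i → ∀ q ∈ (e.sent r i).proposals, r = proposing Δ q.slot
  propose : ∀ t, proposer (t + 1) ∈ e.active Δ (proposing Δ (t + 1)) →
    ∃ q, (e.sent (proposing Δ (t + 1)) (proposer (t + 1))).proposals = {q} ∧ q.slot = t + 1 ∧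
      q.sender = proposer (t + 1) ∧
      IsExtend (e.pool (proposing Δ (t + 1)))
        (mfc (e.view (proposing Δ (t + 1)) (proposer (t + 1))).votes
          (e.view (proposing Δ (t + 1)) (proposer (t + 1))).votes q.chC (t + 1)) (t + 1) q.chain ∧
      D.IsRoot e (proposing Δ (t + 1)) (proposer (t + 1)) t q.chC
  frozen_zero : ∀ i ∈ e.active Δ (voting Δ 0), D.frozen 0 i = ∅
  frozen_succ : ∀ t, ∀ i ∈ e.active Δ (voting Δ (t + 1)),
    D.frozen (t + 1) i = (e.view (merging Δ t) i).votes
  root_zero : ∀ i ∈ e.active Δ (voting Δ 0), D.justified (voting Δ 0) i (D.root 0 i)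
  root_succ : ∀ t, ∀ i ∈ e.active Δ (voting Δ (t + 1)),
    D.IsRoot e (voting Δ (t + 1)) i t (D.root (t + 1) i)
  /-- A chain fast-confirmed by the votes known at the merge round stays below the root. -/
  le_root : ∀ t, ∀ i ∈ e.active Δ (voting Δ (t + 1)), D.RootsTotal e (voting Δ (t + 1)) i t →
    ∀ c ∈ fastCands (e.view (merging Δ t) i).votes t, c ≼ D.root (t + 1) i
  /-- The root is updated by the proposal of a good slot. -/
  root_proposal : ∀ t, GoodSlot e proposer Δ (t + 1) →
    ∀ q ∈ (e.sent (proposing Δ (t + 1)) (proposer (t + 1))).proposals, q.chain.p = q.slot →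
    ∀ i ∈ e.active Δ (voting Δ (t + 1)), D.RootsTotal e (voting Δ (t + 1)) i t →
      q.chC ≼ D.root (t + 1) i ∧
        (D.root (t + 1) i ≼ q.chC ∨ D.justified (voting Δ (t + 1)) i (D.root (t + 1) i))
  /-- Justified chains have been confirmed by honest validators in earlier vote rounds. -/
  justified_out : ∀ r i c, e.Honest r i → D.justified r i c → c = Chain.genesis ∨
    ∃ s k, voting Δ s < r ∧ k ∈ e.active Δ (voting Δ s) ∧ c = D.out (e.state (voting Δ s) k)
  out_init : D.out D.init = Chain.genesis
  out_step : ∀ r i, e.Honest r i → D.out (e.state r i) = D.out (e.prev D.init r i) ∨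
    (∃ t, r = voting Δ t ∧ i ∈ e.active Δ r ∧
      (D.out (e.state r i) = (D.head e Δ t i).deep κ t ∨ D.justified r i (D.out (e.state r i)))) ∨
    (∃ t, r = fastConfirming Δ t ∧ i ∈ e.active Δ r ∧ D.IsRoot e r i t (D.out (e.state r i)))

namespace AvailableRun

variable {e : Execution n Tx F G S} {proposer : ℕ → Fin n} {Δ κ t r : ℕ} {D : LocalData n Tx F S}
  {i : Fin n} {c : Chain Tx}

/-- The invariant of the induction on slots: confirmed chains and the chains proposed in good slots
are fixed, and votes are not higher than their slot. -/
structure Invariant (e : Execution n Tx F G S) (proposer : ℕ → Fin n) (Δ : ℕ)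
    (D : LocalData n Tx F S) (t : ℕ) : Prop where
  out_fixed : ∀ r ≤ voting Δ t, ∀ i, e.Honest r i → FixedAt e Δ t (D.out (e.state r i))
  height : ∀ i ∈ e.active Δ (voting Δ t), ∀ v ∈ (e.sent (voting Δ t) i).votes, v.chain.p ≤ t
  proposed : ∀ s, 0 < s → s ≤ t → GoodSlot e proposer Δ s → ∃ c : Chain Tx, c.p = s ∧
    FixedAt e Δ t c ∧ ∀ tx ∈ e.pool (proposing Δ s), c.Contains tx

theorem head_isPrefix_vote (h : AvailableRun e proposer Δ κ D)
    (hi : i ∈ e.active Δ (voting Δ t)) {v : Vote n Tx F}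
    (hv : v ∈ (e.sent (voting Δ t) i).votes) : D.head e Δ t i ≼ v.chain := by
  have hc := h.vote_choice t i hi v hv
  unfold Execution.IsVoteChoice at hc
  by_cases hP : Set.Nonempty {d | D.head e Δ t i ≼ d ∧ d.p = t ∧
    ∃ q ∈ (e.view (voting Δ t) i).proposals, q.slot = t ∧ q.sender = proposer t ∧ q.chain = d}
  · exact (hc.1 hP).1
  · rw [hc.2 hP]; exact Chain.IsPrefix.refl _

theorem vote_p_le (h : AvailableRun e proposer Δ κ D)
    (hi : i ∈ e.active Δ (voting Δ t)) {v : Vote n Tx F}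
    (hv : v ∈ (e.sent (voting Δ t) i).votes) (hp : (D.head e Δ t i).p ≤ t) : v.chain.p ≤ t := by
  have hc := h.vote_choice t i hi v hv
  unfold Execution.IsVoteChoice at hc
  by_cases hP : Set.Nonempty {d | D.head e Δ t i ≼ d ∧ d.p = t ∧
    ∃ q ∈ (e.view (voting Δ t) i).proposals, q.slot = t ∧ q.sender = proposer t ∧ q.chain = d}
  · exact (hc.1 hP).2.1.le
  · rw [hc.2 hP]; exact hp

theorem awake_merging (h : AvailableRun e proposer Δ κ D)
    (hi : i ∈ e.active Δ (voting Δ (t + 1))) : i ∈ e.awake (merging Δ t) :=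
  Execution.awake_of_active_voting h.delta_pos hi (by unfold merging fastConfirming; omega)
    (by unfold merging voting; nlinarith)

theorem honest_merging (h : AvailableRun e proposer Δ κ D)
    (hi : i ∈ e.active Δ (voting Δ (t + 1))) : e.Honest (merging Δ t) i :=
  Execution.honest_of_le h.compliant (by unfold merging voting; nlinarith) hi.1

theorem fixedAt_of_justified (h : AvailableRun e proposer Δ κ D)
    (I : Invariant e proposer Δ D t) (hr : r ≤ voting Δ (t + 1)) (hi : e.Honest r i)
    (hc : D.justified r i c) : FixedAt e Δ t c := by
  rcases h.justified_out r i c hi hc with rfl | ⟨s, k, hs, hk, rfl⟩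
  · exact VotesOncePerSlot.fixedAt_genesis
  · have := (voting_lt_iff h.delta_pos).1 (hs.trans_le hr)
    exact I.out_fixed _ ((voting_le_iff h.delta_pos).2 (by omega)) k hk.1

theorem backedAt_of_isRoot (h : AvailableRun e proposer Δ κ D)
    (I : Invariant e proposer Δ D t) (hr : r ≤ voting Δ (t + 1)) (hi : e.Honest r i)
    (hc : D.IsRoot e r i t c) : BackedAt e Δ t c := by
  rcases hc with hc | hc
  · exact h.backedAt_of_mem_fastCands hi hc
  · exact h.backedAt_of_fixedAt (h.fixedAt_of_justified I hr hi hc)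

theorem rootsTotal (h : AvailableRun e proposer Δ κ D)
    (I : Invariant e proposer Δ D t) (hr : r ≤ voting Δ (t + 1)) (hi : e.Honest r i) :
    D.RootsTotal e r i t := by
  rintro c d (hc | hc) hd
  · rcases hd with hd | hd
    · exact h.fastCands_total hi c hc d hd
    · exact ((h.fixedAt_of_justified I hr hi hd).total (h.backedAt_of_mem_fastCands hi hc)).symm
  · exact (h.fixedAt_of_justified I hr hi hc).total (h.backedAt_of_isRoot I hr hi hd)

/-- A fixed chain lies below the output of every later fork choice whose root is backed. -/
theorem isPrefix_mfc_of_fixedAt (h : AvailableRun e proposer Δ κ D) (hc : FixedAt e Δ t c)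
    {V : Finset (Vote n Tx F)} (hV : V ⊆ (e.view r i).votes) (hi : e.Honest r i)
    (hr : r ≤ voting Δ (t + 1))
    (hsent : ∀ k ∈ e.active Δ (voting Δ t), (e.sent (voting Δ t) k).votes ⊆ V)
    {d : Chain Tx} (hd : BackedAt e Δ t d) :
    c ≼ mfc V (e.view r i).votes d (t + 1) := by
  have hspec := mfc_spec V (e.view r i).votes d (t + 1)
  rcases hc.total hd with hcd | hdc
  · exact hcd.trans hspec.1.1
  · exact hspec.2 c hdc (h.majoritySupport_of_fixedAt hc hV hi hr hsent)

theorem frozen_subset (h : AvailableRun e proposer Δ κ D)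
    (hi : i ∈ e.active Δ (voting Δ (t + 1))) :
    D.frozen (t + 1) i ⊆ (e.view (voting Δ (t + 1)) i).votes := by
  rw [h.frozen_succ t i hi]
  exact Execution.view_mono h.compliant h.sync (by unfold merging voting; nlinarith) hi.1

/-- The induction step that keeps a chain fixed: it is a prefix of the next fork choice. -/
theorem isPrefix_head_of_fixedAt (h : AvailableRun e proposer Δ κ D)
    (I : Invariant e proposer Δ D t) (hc : FixedAt e Δ t c)
    (hi : i ∈ e.active Δ (voting Δ (t + 1))) : c ≼ D.head e Δ (t + 1) i := by
  refine h.isPrefix_mfc_of_fixedAt hc (h.frozen_subset hi) hi.1 le_rfl ?_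
    (h.backedAt_of_isRoot I le_rfl hi.1 (h.root_succ t i hi))
  intro k hk
  rw [h.frozen_succ t i hi]
  exact h.vote_mem_view hk le_rfl (h.honest_merging hi) (h.awake_merging hi)

theorem fixedAt_succ_of_head (h : AvailableRun e proposer Δ κ D)
    (hc : ∀ i ∈ e.active Δ (voting Δ (t + 1)), c ≼ D.head e Δ (t + 1) i) :
    FixedAt e Δ (t + 1) c :=
  fun i hi _ hv => (hc i hi).trans (h.head_isPrefix_vote hi hv)

theorem fixedAt_succ (h : AvailableRun e proposer Δ κ D)
    (I : Invariant e proposer Δ D t) (hc : FixedAt e Δ t c) : FixedAt e Δ (t + 1) c :=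
  h.fixedAt_succ_of_head fun _ hi => h.isPrefix_head_of_fixedAt I hc hi

/-- Gossip turns a fast confirmation in slot `t` into a lower bound on all roots of slot `t + 1`. -/
theorem fixedAt_succ_of_mem_fastCands (h : AvailableRun e proposer Δ κ D)
    (I : Invariant e proposer Δ D t) (hi : i ∈ e.active Δ (fastConfirming Δ t))
    (hc : c ∈ fastCands (e.view (fastConfirming Δ t) i).votes t) : FixedAt e Δ (t + 1) c := by
  refine h.fixedAt_succ_of_head fun j hj => ?_
  refine (h.le_root t j hj (h.rootsTotal I le_rfl hj.1) c ?_).trans (mfc_spec _ _ _ _).1.1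
  refine fastCands_mono ?_ hc
  exact h.sync.gossip_vote _ i _ j hi.1 (Execution.awake_of_active hi) fastConfirming_add.le
    (h.honest_merging hj) (h.awake_merging hj)

theorem p_le_of_backedAt (I : Invariant e proposer Δ D t) (hc : BackedAt e Δ t c) : c.p ≤ t := by
  obtain ⟨i, hi, v, hv, hcv⟩ := hc
  exact hcv.p_le.trans (I.height i hi v hv)

/-- Fork choices in slot `t + 1` return chains backed in slot `t`. -/
theorem backedAt_mfc (h : AvailableRun e proposer Δ κ D) {V : Finset (Vote n Tx F)}
    (hi : e.Honest r i) (ha : i ∈ e.awake r) (hr : merging Δ t ≤ r) (hr' : r ≤ voting Δ (t + 1))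
    (hd : BackedAt e Δ t c) : BackedAt e Δ t (mfc V (e.view r i).votes c (t + 1)) := by
  rcases (mfc_spec V (e.view r i).votes c (t + 1)).1.2 with hm | hm
  · rwa [hm]
  · exact h.backedAt_of_majoritySupport hm hi ha hr hr'

theorem backedAt_head (h : AvailableRun e proposer Δ κ D) (I : Invariant e proposer Δ D t)
    (hi : i ∈ e.active Δ (voting Δ (t + 1))) : BackedAt e Δ t (D.head e Δ (t + 1) i) :=
  h.backedAt_mfc hi.1 (Execution.awake_of_active hi) (by unfold merging voting; nlinarith) le_rfl
    (h.backedAt_of_isRoot I le_rfl hi.1 (h.root_succ t i hi))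

/-- In a good slot all active validators vote for the proposed chain: the proposer has seen all votes
in their frozen sets, and they have seen all votes the proposer has seen, so its fork choice extends
theirs. -/
theorem exists_proposed (h : AvailableRun e proposer Δ κ D) (I : Invariant e proposer Δ D t)
    (hg : GoodSlot e proposer Δ (t + 1)) : ∃ c : Chain Tx, c.p = (t + 1 : ℕ) ∧
      FixedAt e Δ (t + 1) c ∧ ∀ tx ∈ e.pool (proposing Δ (t + 1)), c.Contains tx := by
  obtain ⟨hpa, hph⟩ := hg
  obtain ⟨q, hq, hqs, hqp, hext, hroot⟩ := h.propose t hpa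
  set p := proposer (t + 1) with hp
  have hle : proposing Δ (t + 1) ≤ voting Δ (t + 1) := by unfold proposing voting; omega
  have hmp : merging Δ t ≤ proposing Δ (t + 1) := by unfold proposing merging; nlinarith
  have hpaw := Execution.awake_of_active hpa
  have hback := h.backedAt_of_isRoot I hle hpa.1 hroot
  have hm := p_le_of_backedAt I (h.backedAt_mfc (V := (e.view (proposing Δ (t + 1)) p).votes)
    hpa.1 hpaw hmp hle hback)
  obtain ⟨hext1, hext2, hext3⟩ := hext (by push_cast; omega)
  refine ⟨q.chain, by rw [hext2], fun i hi v hv => ?_, hext3⟩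
  have hspec := mfc_spec (e.view (proposing Δ (t + 1)) p).votes
    (e.view (proposing Δ (t + 1)) p).votes q.chC (t + 1)
  have hqmem : q ∈ (e.sent (proposing Δ (t + 1)) p).proposals := by
    rw [hq]; exact Finset.mem_singleton_self q
  obtain ⟨hr1, hr2⟩ := h.root_proposal t ⟨hpa, hph⟩ q hqmem (by rw [hext2, hqs]) i hi (h.rootsTotal I le_rfl hi.1)
  have hhead := mfc_spec (D.frozen (t + 1) i) (e.view (voting Δ (t + 1)) i).votes
    (D.root (t + 1) i) (t + 1)
  have hprefix : D.head e Δ (t + 1) i ≼ q.chain := by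
    refine Chain.IsPrefix.trans ?_ hext1
    unfold LocalData.head
    rcases hhead.1.2 with hm | hm
    · rw [hm]
      rcases hr2 with hr2 | hr2
      · exact hr2.trans hspec.1.1
      · exact h.isPrefix_mfc_of_fixedAt (h.fixedAt_of_justified I le_rfl hi.1 hr2) subset_rfl
          hpa.1 hle (fun k hk => h.vote_mem_view hk hmp hpa.1 hpaw) hback
    · refine hspec.2 _ (hr1.trans hhead.1.1) (hm.sandwich ?_ ?_)
      · rw [h.frozen_succ t i hi]
        exact h.sync.gossip_vote _ i _ p (h.honest_merging hi) (h.awake_merging hi)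
          merging_add.le hpa.1 hpaw
      · exact h.sync.gossip_vote _ p _ i hpa.1 hpaw proposing_add.le hi.1
          (Execution.awake_of_active hi)
  have hqv : q ∈ (e.view (voting Δ (t + 1)) i).proposals :=
    h.sync.deliver_proposal _ p _ i hpa.1 proposing_add.le hi.1 (Execution.awake_of_active hi) hqmem
  have hc := h.vote_choice (t + 1) i hi v hv
  obtain ⟨-, -, q', hq', hs', hp', hv'⟩ := hc.1 ⟨q.chain, hprefix, hext2, q, hqv, hqs, hqp, rfl⟩
  rw [← hp] at hp'
  rw [← hv', (eq_of_mem_view_proposals h.compliant h.sync h.sent_proposal hq hph hi.1 hq' hs'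
    hp').1]
  exact Chain.IsPrefix.refl _

theorem fixedAt_zero (h : AvailableRun e proposer Δ κ D) (hr : r ≤ voting Δ 0)
    (hi : e.Honest r i) : FixedAt e Δ 0 (D.out (e.state r i)) := by
  have hgen : D.out (e.state r i) = Chain.genesis := by
    induction r with
    | zero =>
      rcases h.out_step 0 i hi with h1 | ⟨t, ht, -⟩ | ⟨t, ht, -⟩
      · rw [h1]; exact h.out_init
      · have := h.delta_pos; unfold voting at ht; omega
      · have := h.delta_pos; unfold fastConfirming at ht; omega
    | succ r ih =>
      rcases h.out_step (r + 1) i hi with h1 | ⟨t, ht, -, hd⟩ | ⟨t, ht, -⟩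
      · rw [h1]
        exact ih (by omega) (Execution.honest_of_le h.compliant r.le_succ hi)
      · have := (voting_le_iff h.delta_pos).1 (ht ▸ hr)
        rcases hd with hd | hd
        · rw [hd]
          have := h.kappa_pos
          exact Chain.deep_eq_genesis (by omega)
        · rcases h.justified_out _ i _ hi hd with hd | ⟨s, k, hs, -⟩
          · exact hd
          · have := (voting_lt_iff h.delta_pos).1 (hs.trans_le hr)
            omega
      · have := h.delta_pos; unfold fastConfirming at ht; unfold voting at hr
        nlinarith
  rw [hgen]
  exact VotesOncePerSlot.fixedAt_genesis

theorem invariant_zero (h : AvailableRun e proposer Δ κ D) : Invariant e proposer Δ D 0 where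
  out_fixed r hr i hi := h.fixedAt_zero hr hi
  height i hi v hv := by
    refine h.vote_p_le hi hv ?_
    unfold LocalData.head
    rw [h.frozen_zero i hi, mfc_empty]
    rcases h.justified_out _ i _ hi.1 (h.root_zero i hi) with h1 | ⟨s, k, hs, -⟩
    · rw [h1, Chain.p_genesis]; omega
    · have := (voting_lt_iff h.delta_pos).1 hs
      omega
  proposed s hs hs' := by omega

theorem proposed_succ (h : AvailableRun e proposer Δ κ D) (I : Invariant e proposer Δ D t)
    {s : ℕ} (hs : 0 < s) (hst : s ≤ t + 1) (hg : GoodSlot e proposer Δ s) :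
    ∃ c : Chain Tx, c.p = s ∧ FixedAt e Δ (t + 1) c ∧
      ∀ tx ∈ e.pool (proposing Δ s), c.Contains tx := by
  rcases Nat.lt_or_ge t s with hlt | hle
  · obtain rfl : s = t + 1 := by omega
    exact h.exists_proposed I hg
  · obtain ⟨c, h1, h2, h3⟩ := I.proposed s hs hle hg
    exact ⟨c, h1, h.fixedAt_succ I h2, h3⟩

theorem out_fixed_succ (h : AvailableRun e proposer Δ κ D) (I : Invariant e proposer Δ D t)
    (hgood : κ ≤ t + 1 → ∃ s, t + 1 < s + κ ∧ s ≤ t + 1 ∧ GoodSlot e proposer Δ s)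
    (hr : r ≤ voting Δ (t + 1)) (hi : e.Honest r i) :
    FixedAt e Δ (t + 1) (D.out (e.state r i)) := by
  induction r with
  | zero => exact h.fixedAt_succ I (I.out_fixed 0 (Nat.zero_le _) i hi)
  | succ r ih =>
    by_cases hrt : r + 1 ≤ voting Δ t
    · exact h.fixedAt_succ I (I.out_fixed _ hrt i hi)
    rcases h.out_step (r + 1) i hi with h1 | ⟨t', ht, ha, hd⟩ | ⟨t', ht, ha, hd⟩
    · rw [h1]
      exact ih (by omega) (Execution.honest_of_le h.compliant r.le_succ hi)
    · have h1 := (voting_le_iff h.delta_pos).1 (ht ▸ hr)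
      have h2 := (voting_lt_iff h.delta_pos).1 (ht ▸ not_le.1 hrt)
      obtain rfl : t' = t + 1 := by omega
      rcases hd with hd | hd
      · rw [hd]
        by_cases hκ : κ ≤ t + 1
        · -- The deep prefix does not reach beyond the chain proposed in the last good slot.
          obtain ⟨s, hs1, hs2, hg⟩ := hgood hκ
          obtain ⟨c, hc1, hc2, -⟩ := h.proposed_succ I (by omega) hs2 hg
          rw [ht] at ha
          obtain ⟨v, hv⟩ := h.exists_vote (t + 1) i ha
          have hv' : v ∈ (e.sent (voting Δ (t + 1)) i).votes := by
            rw [hv]; exact Finset.mem_singleton_self v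
          have hdc : (D.head e Δ (t + 1) i).deep κ (t + 1) ≼ c :=
            Chain.deep_isPrefix_of_le
              ((Chain.deep_isPrefix _ _ _).trans (h.head_isPrefix_vote ha hv'))
              (hc2 i ha v hv') (by rw [hc1]; omega)
          exact fun j hj w hw => hdc.trans (hc2 j hj w hw)
        · rw [Chain.deep_eq_genesis (by omega)]
          exact VotesOncePerSlot.fixedAt_genesis
      · exact h.fixedAt_succ I (h.fixedAt_of_justified I hr hi hd)
    · obtain rfl : t' = t := by
        have hΔ := h.delta_pos
        have h1 : fastConfirming Δ t' ≤ voting Δ (t + 1) := ht ▸ hr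
        have h2 : voting Δ t < fastConfirming Δ t' := ht ▸ not_le.1 hrt
        have h3 : voting Δ t' < voting Δ (t + 1) := by
          rw [← voting_add] at h1; omega
        have h4 : voting Δ t < voting Δ (t' + 1) := by
          unfold fastConfirming at h2; unfold voting at h2 ⊢; nlinarith
        rw [voting_lt_iff hΔ] at h3 h4
        omega
      rcases hd with hd | hd
      · rw [ht] at ha hd ⊢
        exact h.fixedAt_succ_of_mem_fastCands I ha hd
      · exact h.fixedAt_succ I (h.fixedAt_of_justified I hr hi hd)

theorem invariant (h : AvailableRun e proposer Δ κ D) {N : ℕ}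
    (hg : GoodWindows e proposer Δ κ N) (ht : t ≤ N) : Invariant e proposer Δ D t := by
  induction t with
  | zero => exact h.invariant_zero
  | succ t ih =>
    have I := ih (by omega)
    refine ⟨fun r hr i hi => h.out_fixed_succ I (fun hκ => ?_) hr hi, fun i hi v hv => ?_,
      fun s hs hst hgs => h.proposed_succ I hs hst hgs⟩
    · obtain ⟨s, h1, h2, h3⟩ := hg (t + 1 - κ) (by omega)
      exact ⟨s, by omega, by omega, h3⟩
    · refine h.vote_p_le hi hv ((p_le_of_backedAt I (h.backedAt_head I hi)).trans ?_)
      push_cast; omega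

theorem out_total (h : AvailableRun e proposer Δ κ D) (I : Invariant e proposer Δ D t) {r' : ℕ}
    {j : Fin n} (hr : r ≤ voting Δ t) (hr' : r' ≤ voting Δ t) (hi : e.Honest r i)
    (hj : e.Honest r' j) :
    D.out (e.state r i) ≼ D.out (e.state r' j) ∨ D.out (e.state r' j) ≼ D.out (e.state r i) :=
  (I.out_fixed r hr i hi).total (h.backedAt_of_fixedAt (I.out_fixed r' hr' j hj))

theorem safeUpTo (h : AvailableRun e proposer Δ κ D) {N : ℕ}
    (hg : GoodWindows e proposer Δ κ N) : e.SafeUpTo D.out N := by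
  intro r r' i j hr hr' hi hj
  have hN := le_voting h.delta_pos N
  exact h.out_total (h.invariant hg le_rfl) (hr.trans hN) (hr'.trans hN) hi hj

/-- Liveness needs, in addition, that the deep prefix of the fork choice is confirmed in vote rounds
and that the confirmed chain is not shortened in other rounds. -/
theorem liveUpTo (h : AvailableRun e proposer Δ κ D) {N : ℕ}
    (hg : GoodWindows e proposer Δ κ N)
    (hdeep : ∀ t, ∀ i ∈ e.active Δ (voting Δ t),
      (D.head e Δ t i).deep κ t ≼ D.out (e.state (voting Δ t) i))
    (hgrow : ∀ r i, e.Honest r i → (∀ t, r ≠ voting Δ t) →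
      D.out (e.state r i) = D.out (e.prev D.init r i) ∨
        ¬ D.out (e.state r i) ≼ D.out (e.prev D.init r i)) :
    e.LiveUpTo D.out Δ N (8 * κ * Δ + Δ) := by
  intro r r' i hrr hr'N hi tx htx
  have hΔ := h.delta_pos
  have hκ := h.kappa_pos
  obtain ⟨t, ht1, ht2⟩ : ∃ t, voting Δ t ≤ r' ∧ r' < voting Δ (t + 1) := by
    refine ⟨(r' - Δ) / (4 * Δ), ?_, ?_⟩
    · have := Nat.mul_div_le (r' - Δ) (4 * Δ)
      unfold voting; omega
    · have := Nat.lt_mul_div_succ (r' - Δ) (by omega : 0 < 4 * Δ)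
      unfold voting; omega
  have htN : t ≤ N := by have := le_voting hΔ t; omega
  obtain ⟨a, ha1, ha2, haN⟩ : ∃ a, 4 * Δ * a ≤ r ∧ r < 4 * Δ * (a + 1) ∧ a ≤ N := by
    refine ⟨r / (4 * Δ), Nat.mul_div_le r (4 * Δ), Nat.lt_mul_div_succ r (by omega), ?_⟩
    exact (Nat.div_le_self r (4 * Δ)).trans (by omega)
  obtain ⟨s, hs1, hs2, hgs⟩ := hg a haN
  have hat : a + 2 * κ ≤ t := by
    have h1 : voting Δ (a + 2 * κ) < voting Δ (t + 1) := by
      refine lt_of_le_of_lt ?_ ht2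
      unfold voting
      nlinarith
    have := (voting_lt_iff hΔ).1 h1
    omega
  obtain ⟨t, rfl⟩ : ∃ t', t = t' + 1 := ⟨t - 1, by omega⟩
  have I := h.invariant hg (show t ≤ N by omega)
  have hit := Execution.active_voting_of_active hΔ h.compliant hi ht1 ht2
  obtain ⟨c, hc1, hc2, hc3⟩ := I.proposed s (by omega) (by omega) hgs
  have hctx : c.Contains tx := hc3 tx (h.sync.pool_mono _ _ (by
    unfold proposing
    exact ha2.le.trans (Nat.mul_le_mul_left _ hs1)) htx)
  have hcout : c ≼ D.out (e.state (voting Δ (t + 1)) i) :=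
    (Chain.isPrefix_deep (h.isPrefix_head_of_fixedAt I hc2 hit) (by rw [hc1]; omega)).trans
      (hdeep _ i hit)
  have IN := h.invariant hg (le_refl N)
  have hN := le_voting hΔ N
  refine Chain.IsPrefix.contains ?_ hctx
  replace hi : e.Honest r' i := hi.1
  clear hrr htx
  induction r', ht1 using Nat.le_induction with
  | base => exact hcout
  | succ r' hr' ih =>
    have hh := Execution.honest_of_le h.compliant r'.le_succ hi
    have ih' := ih (by omega) (by omega) hh
    have hprev : e.prev D.init (r' + 1) i = e.state r' i := by simp [Execution.prev]
    rcases hgrow (r' + 1) i hi (fun u hu => by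
      rw [hu] at ht2
      have h1 := (voting_lt_iff hΔ).1 ht2
      have h2 := (voting_lt_iff hΔ).1 (by omega : voting Δ (t + 1) < voting Δ u)
      omega) with h1 | h1
    · rw [h1, hprev]; exact ih'
    · rw [hprev] at h1
      rcases h.out_total IN (by omega : r' + 1 ≤ voting Δ N) (by omega : r' ≤ voting Δ N) hi hh
        with h2 | h2
      · exact absurd h2 h1
      · exact ih'.trans h2

end AvailableRun

end Available

/-! ### Evolution of local states -/

theorem prev_zero {n : ℕ} {Tx F G S : Type*} (e : Execution n Tx F G S) (s₀ : S) (i : Fin n) :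
    e.prev s₀ 0 i = s₀ := by simp [Execution.prev]

theorem prev_succ {n : ℕ} {Tx F G S : Type*} (e : Execution n Tx F G S) (s₀ : S) (r : ℕ)
    (i : Fin n) : e.prev s₀ (r + 1) i = e.state r i := by simp [Execution.prev]

/-- A component of the local state that is only carried over after round `r₀` keeps its value. -/
theorem eq_of_forall_eq_prev {n : ℕ} {Tx F G S β : Type*} {e : Execution n Tx F G S} {s₀ : S}
    {i : Fin n} {f : S → β} {b : β} {r₀ R r : ℕ} (h0 : f (e.state r₀ i) = b)
    (hc : ∀ r, r₀ < r → r ≤ R → f (e.state r i) = f (e.prev s₀ r i)) (h1 : r₀ ≤ r) (h2 : r ≤ R) :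
    f (e.state r i) = b := by
  induction r, h1 using Nat.le_induction with
  | base => exact h0
  | succ r hr ih =>
    rw [hc _ (Nat.lt_succ_of_le hr) h2, prev_succ]
    exact ih (by omega)

/-- A component of the local state that has never been updated has its initial value. -/
theorem prev_eq_init {n : ℕ} {Tx F G S β : Type*} {e : Execution n Tx F G S} {s₀ : S}
    {i : Fin n} {f : S → β} {r : ℕ} (hc : ∀ r' < r, f (e.state r' i) = f (e.prev s₀ r' i)) :
    f (e.prev s₀ r i) = f s₀ := by
  induction r with
  | zero => rw [prev_zero]
  | succ r ih =>
    rw [prev_succ, hc r (Nat.lt_succ_self r)]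
    exact ih fun r' hr' => hc r' (by omega)

theorem exists_voting_eq_succ {Δ : ℕ} (hΔ : 0 < Δ) (t : ℕ) : ∃ r, voting Δ t = r + 1 :=
  ⟨voting Δ t - 1, by unfold voting; omega⟩

/-- Folding a list in which some element moves every state below `C` to `C`, while no element moves
a state below `C` away from below `C`, nor `C` itself, ends in `C`. -/
theorem foldl_eq_of_mem {α β : Type*} {P : β → Prop} {f : β → α → β} {C : β} {l : List α} {a : α}
    (ha : a ∈ l) {b : β} (hb : P b) (hP : ∀ b, P b → ∀ x ∈ l, P (f b x))
    (haC : ∀ b, P b → f b a = C) (hC : ∀ x ∈ l, f C x = C) : l.foldl f b = C := by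
  obtain ⟨l₁, l₂, rfl⟩ := List.append_of_mem ha
  rw [List.foldl_append, List.foldl_cons, haC]
  · exact List.foldlRecOn (motive := fun b => b = C) l₂ f rfl fun b hb x hx => by
      rw [hb]; exact hC x (by simp [hx])
  · exact List.foldlRecOn (motive := P) l₁ f hb fun b hb x hx => hP b hb x (by simp [hx])

/-- If only one element of a duplicate-free list has an effect, folding the list applies it once. -/
theorem foldl_eq_of_nodup {α β : Type*} {f : β → α → β} {l : List α} {a : α} (ha : a ∈ l)
    (hl : l.Nodup) (hf : ∀ b, ∀ x ∈ l, x ≠ a → f b x = b) (b : β) : l.foldl f b = f b a := by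
  obtain ⟨l₁, l₂, rfl⟩ := List.append_of_mem ha
  have hd := List.nodup_append.1 hl
  have h2 := List.nodup_cons.1 hd.2.1
  rw [List.foldl_append, List.foldl_cons]
  have e1 : l₁.foldl f b = b := List.foldlRecOn (motive := fun c => c = b) l₁ f rfl
    fun c hc x hx => by
      rw [hc]
      exact hf b x (by simp [hx]) (hd.2.2 x hx a (by simp))
  rw [e1]
  exact List.foldlRecOn (motive := fun c => c = f b a) l₂ f rfl fun c hc x hx => by
    rw [hc]
    exact hf _ x (by simp [hx]) (fun hxa => h2.1 (hxa ▸ hx))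

/-! ### The protocol without finality component -/

section Tob

variable {n : ℕ} {Tx : Type*} {e : TobExecution n Tx} {proposer : ℕ → Fin n} {Δ κ t r : ℕ}
  {guarded : Prop} {i : Fin n}

/-- The local data of the protocol without finality component, in which only genesis is
justified. -/
def tobData (e : TobExecution n Tx) (Δ : ℕ) :
    LocalData n Tx Unit (TobState n Tx) where
  frozen t i := (e.prev TobState.init (voting Δ t) i).frozen
  root t i := (e.state (voting Δ t) i).chFrozen
  justified _ _ c := c = Chain.genesis
  out := TobState.confirmed
  init := TobState.init

namespace IsTobExecution

theorem step (h : IsTobExecution e proposer Δ κ guarded) (hi : e.Honest r i)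
    (ha : i ∈ e.awake r) :
    TobStep e proposer Δ κ guarded r i (slotOf Δ r) (e.view r i).votes
      (e.prev TobState.init r i) (e.state r i) :=
  (h.2.2 r i hi).1 ha

theorem step_voting (h : IsTobExecution e proposer Δ κ guarded) (hΔ : 0 < Δ)
    (hi : i ∈ e.active Δ (voting Δ t)) :
    TobStep e proposer Δ κ guarded (voting Δ t) i t (e.view (voting Δ t) i).votes
      (e.prev TobState.init (voting Δ t) i) (e.state (voting Δ t) i) := by
  have := h.step hi.1 (Execution.awake_of_active hi)
  rwa [slotOf_voting hΔ] at this

theorem sent_vote (h : IsTobExecution e proposer Δ κ guarded) (hi : e.Honest r i)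
    {v : Vote n Tx Unit} (hv : v ∈ (e.sent r i).votes) :
    r = voting Δ v.slot ∧ i ∈ e.active Δ r ∧ v.voter = i := by
  by_cases ha : i ∈ e.awake r
  · have hs := (h.step hi ha).vote
    split_ifs at hs with hc
    · obtain ⟨c, -, hs⟩ := hs
      rw [hs, Finset.mem_singleton] at hv
      subst hv
      exact ⟨hc.1, hc.2, rfl⟩
    · rw [hs] at hv; simp at hv
  · rw [((h.2.2 r i hi).2 ha).2] at hv
    simp [MsgSet.empty] at hv

theorem sent_proposal (h : IsTobExecution e proposer Δ κ guarded) (hi : e.Honest r i)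
    {q : Proposal n Tx Unit Unit} (hq : q ∈ (e.sent r i).proposals) :
    r = proposing Δ q.slot := by
  by_cases ha : i ∈ e.awake r
  · have hs := (h.step hi ha).propose
    split_ifs at hs with hc
    · obtain ⟨c, -, hs⟩ := hs
      rw [hs, Finset.mem_singleton] at hq
      subst hq
      exact hc.1
    · rw [hs] at hq; simp at hq
  · rw [((h.2.2 r i hi).2 ha).2] at hq
    simp [MsgSet.empty] at hq

theorem vote_eq (h : IsTobExecution e proposer Δ κ guarded) (hΔ : 0 < Δ)
    (hi : i ∈ e.active Δ (voting Δ t)) :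
    ∃ c, e.IsVoteChoice proposer i (voting Δ t) t ((tobData e Δ).head e Δ t i) c ∧
      (e.sent (voting Δ t) i).votes = {⟨c, (), t, i⟩} := by
  have hs := (h.step_voting hΔ hi).vote
  rwa [if_pos ⟨rfl, hi⟩] at hs

theorem votesOncePerSlot (h : IsTobExecution e proposer Δ κ guarded) (hΔ : 0 < Δ) :
    VotesOncePerSlot e Δ where
  delta_pos := hΔ
  compliant := h.1
  sync := h.2.1
  sent_vote _ _ hi _ hv := h.sent_vote hi hv
  exists_vote _ _ hi := by
    obtain ⟨c, -, hs⟩ := h.vote_eq hΔ hi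
    exact ⟨_, hs⟩

theorem propose_eq (h : IsTobExecution e proposer Δ κ guarded) (hΔ : 0 < Δ)
    (hp : proposer t ∈ e.active Δ (proposing Δ t)) :
    ∃ c, IsExtend (e.pool (proposing Δ t))
        (mfc (e.view (proposing Δ t) (proposer t)).votes
          (e.view (proposing Δ t) (proposer t)).votes
          (fastConfirmSimple (e.view (proposing Δ t) (proposer t)).votes ((t : ℤ) - 1)).1 t) t c ∧
      (e.sent (proposing Δ t) (proposer t)).proposals =
        {⟨c, (fastConfirmSimple (e.view (proposing Δ t) (proposer t)).votes ((t : ℤ) - 1)).1,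
          (fastConfirmSimple (e.view (proposing Δ t) (proposer t)).votes ((t : ℤ) - 1)).2, (), t,
          proposer t⟩} := by
  have hs := (h.step hp.1 (Execution.awake_of_active hp)).propose
  rwa [slotOf_proposing hΔ, if_pos ⟨rfl, hp, rfl⟩] at hs

theorem step_of_le_voting_zero (h : IsTobExecution e proposer Δ κ guarded) (hΔ : 0 < Δ)
    (hi : i ∈ e.active Δ (voting Δ 0)) (hr : r ≤ voting Δ 0) :
    TobStep e proposer Δ κ guarded r i 0 (e.view r i).votes (e.prev TobState.init r i)
      (e.state r i) := by
  have hs := h.step (Execution.honest_of_le h.1 hr hi.1)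
    (Execution.awake_of_active_voting_zero hΔ hi hr)
  rwa [slotOf_eq (t := 0) (by simp [proposing])
    (hr.trans_lt (by unfold voting proposing; omega))] at hs

theorem prev_voting_zero (h : IsTobExecution e proposer Δ κ guarded) (hΔ : 0 < Δ)
    (hi : i ∈ e.active Δ (voting Δ 0)) :
    (e.prev TobState.init (voting Δ 0) i).frozen = ∅ :=
  prev_eq_init (f := TobState.frozen) fun r hr => by
    have hs := (h.step_of_le_voting_zero hΔ hi hr.le).frozen
    rwa [if_neg (ne_merging_of_le_voting_zero hΔ hr.le 0)] at hs

/-- The first root is genesis, as no certificate for slot `-1` exists. -/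
theorem root_voting_zero (h : IsTobExecution e proposer Δ κ guarded) (hΔ : 0 < Δ)
    (hi : i ∈ e.active Δ (voting Δ 0)) :
    (e.state (voting Δ 0) i).chFrozen = Chain.genesis := by
  have key : ∀ r ≤ voting Δ 0, (e.prev TobState.init r i).chFrozen = Chain.genesis →
      (e.state r i).chFrozen = Chain.genesis := by
    intro r hr hc
    have hh := Execution.honest_of_le h.1 hr hi.1
    have hs := (h.step_of_le_voting_zero hΔ hi hr).chFrozen
    rw [if_neg (ne_merging_of_le_voting_zero hΔ hr 0), if_pos hr] at hs
    obtain ⟨l, -, hl, hs⟩ := hs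
    rw [hs]
    refine List.foldlRecOn (motive := fun c => c = Chain.genesis) l _ hc fun c hc q hq => ?_
    unfold tobOnProposal
    split_ifs with hv
    · rcases hv.1.2.2 with hcert | hgen
      · exfalso
        rw [← List.mem_toFinset, hl, Finset.mem_filter, Execution.newProposals,
          Finset.mem_sdiff] at hq
        rw [hq.2] at hcert
        have := (h.votesOncePerSlot hΔ).slot_nonneg_of_mem_fastCands
          (hcert.mem_fastCands (h.2.1.embedded r i hh q hq.1.1))
        norm_num at this
      · exact hgen.2
    · exact hc
  have all : ∀ r ≤ voting Δ 0, (e.state r i).chFrozen = Chain.genesis := by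
    intro r hr
    induction r with
    | zero => exact key 0 (Nat.zero_le _) (by rw [prev_zero]; rfl)
    | succ r ih => exact key _ hr (by rw [prev_succ]; exact ih (by omega))
  exact all _ le_rfl

theorem frozen_eq (h : IsTobExecution e proposer Δ κ guarded) (hΔ : 0 < Δ)
    (hi : i ∈ e.active Δ (voting Δ (t + 1))) (h1 : merging Δ t ≤ r)
    (h2 : r ≤ voting Δ (t + 1)) : (e.state r i).frozen = (e.view (merging Δ t) i).votes := by
  have hst : ∀ r, merging Δ t ≤ r → r ≤ voting Δ (t + 1) → _ := fun r hr hr' =>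
    (h.step (Execution.honest_of_le h.1 hr' hi.1) (Execution.awake_of_active_voting hΔ hi
      (le_trans (by rw [← fastConfirming_add]; omega) hr) hr')).frozen
  refine eq_of_forall_eq_prev (s₀ := TobState.init) (f := TobState.frozen) ?_
    (fun r hr hr' => ?_) h1 h2
  · have hs := hst _ le_rfl (h1.trans h2)
    rwa [slotOf_merging hΔ, if_pos rfl] at hs
  · have hs := hst r hr.le hr'
    rwa [if_neg (ne_merging hΔ hr hr' _)] at hs

/-- How the frozen chain evolves between the merge round of slot `t` and the vote round of slot
`t + 1`. -/
theorem root_induction (h : IsTobExecution e proposer Δ κ guarded) (hΔ : 0 < Δ)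
    (hi : i ∈ e.active Δ (voting Δ (t + 1))) (Q : ℕ → Chain Tx → Prop)
    (base : Q (merging Δ t) (fastConfirmSimple (e.view (merging Δ t) i).votes t).1)
    (succ : ∀ r c (l : List (Proposal n Tx Unit Unit)), merging Δ t ≤ r → r + 1 ≤ voting Δ (t + 1) → Q r c →
      (∀ q ∈ l, q ∈ (e.view (r + 1) i).proposals ∧ q.slot = t + 1) →
      (proposing Δ (t + 1) ≤ r + 1 → ∀ q ∈ (e.view (r + 1) i).proposals, q.slot = t + 1 →
        q ∉ (e.view r i).proposals → q ∈ l) →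
      Q (r + 1) (l.foldl (tobOnProposal proposer) c)) :
    Q (voting Δ (t + 1)) (e.state (voting Δ (t + 1)) i).chFrozen := by
  have hmv : merging Δ t ≤ voting Δ (t + 1) := by unfold merging voting; nlinarith
  suffices H : ∀ r, merging Δ t ≤ r → r ≤ voting Δ (t + 1) → Q r (e.state r i).chFrozen from
    H _ hmv le_rfl
  intro r h1 h2
  have haw : ∀ r, merging Δ t ≤ r → r ≤ voting Δ (t + 1) → i ∈ e.awake r := fun r hr hr' =>
    Execution.awake_of_active_voting hΔ hi (le_trans (by rw [← fastConfirming_add]; omega) hr) hr'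
  induction r, h1 using Nat.le_induction with
  | base =>
    have hs := (h.step (Execution.honest_of_le h.1 h2 hi.1) (haw _ le_rfl h2)).chFrozen
    rw [slotOf_merging hΔ, if_pos rfl] at hs
    rw [hs]; exact base
  | succ r hr ih =>
    have hs := (h.step (Execution.honest_of_le h.1 h2 hi.1) (haw _ (by omega) h2)).chFrozen
    rw [if_neg (ne_merging hΔ (Nat.lt_succ_of_le hr) h2 _), prev_succ] at hs
    have ih' := ih (by omega)
    by_cases hp : proposing Δ (t + 1) ≤ r + 1
    · rw [slotOf_eq hp (h2.trans_lt (by unfold voting proposing; nlinarith)), if_pos h2] at hs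
      obtain ⟨l, -, hl, hs⟩ := hs
      rw [hs]
      have hl' : ∀ q, q ∈ l ↔ (q ∈ (e.view (r + 1) i).proposals ∧
          q ∉ (e.view r i).proposals) ∧ q.slot = t + 1 := fun q => by
        rw [← List.mem_toFinset, hl]
        simp [Execution.newProposals]
      exact succ r _ l hr h2 ih' (fun q hq => ⟨((hl' q).1 hq).1.1, ((hl' q).1 hq).2⟩)
        fun _ q hq hqs hq' => (hl' q).2 ⟨⟨hq, hq'⟩, hqs⟩
    · rw [slotOf_eq (t := t) (le_trans (by unfold proposing merging; omega)
        (hr.trans r.le_succ)) (not_le.1 hp), if_neg (by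
          unfold merging at hr; unfold voting; omega)] at hs
      rw [hs]
      exact succ r _ [] hr h2 ih' (by simp) fun hp' => absurd hp' hp

theorem isRoot_root (h : IsTobExecution e proposer Δ κ guarded) (hΔ : 0 < Δ)
    (hi : i ∈ e.active Δ (voting Δ (t + 1))) :
    (tobData e Δ).IsRoot e (voting Δ (t + 1)) i t (e.state (voting Δ (t + 1)) i).chFrozen := by
  refine h.root_induction hΔ hi (fun r c => (tobData e Δ).IsRoot e r i t c) ?_ ?_
  · exact fastConfirmSimple_mem_or (Execution.pos_of_compliant h.1) _ _
  · intro r c l hr hr' hc hl _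
    have hh := Execution.honest_of_le h.1 hr' hi.1
    refine List.foldlRecOn
      (motive := fun c => (tobData e Δ).IsRoot e (r + 1) i t c) l _ ?_ fun c hc q hq => ?_
    · exact hc.imp (fun hc => fastCands_mono (h.2.1.view_votes_mono r i hh) hc) id
    · unfold tobOnProposal
      split_ifs with hv
      · obtain ⟨hqv, hqs⟩ := hl q hq
        rcases hv.1.2.2 with hcert | hgen
        · rw [hqs] at hcert
          left
          have := hcert.mem_fastCands (h.2.1.embedded _ i hh q hqv)
          simpa using this
        · exact Or.inr hgen.2
      · exact hc

theorem le_root (h : IsTobExecution e proposer Δ κ guarded) (hΔ : 0 < Δ)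
    (hi : i ∈ e.active Δ (voting Δ (t + 1))) {c : Chain Tx}
    (hc : c ∈ fastCands (e.view (merging Δ t) i).votes t) :
    c ≼ (e.state (voting Δ (t + 1)) i).chFrozen := by
  refine h.root_induction hΔ hi (fun _ d => c ≼ d) ?_ ?_
  · exact isPrefix_fastConfirmSimple (Execution.pos_of_compliant h.1)
      ((h.votesOncePerSlot hΔ).fastCands_total (Execution.honest_of_le h.1
        (by unfold merging voting; nlinarith) hi.1)) hc
  · intro r d l _ _ hd _ _
    refine List.foldlRecOn (motive := fun d => c ≼ d) l _ hd fun d hd q _ => ?_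
    unfold tobOnProposal
    split_ifs with hv
    · exact hd.trans hv.2
    · exact hd

/-- In a good slot, all active validators adopt the root of the proposer. -/
theorem root_eq (h : IsTobExecution e proposer Δ κ guarded) (hΔ : 0 < Δ)
    (hg : GoodSlot e proposer Δ (t + 1)) {q : Proposal n Tx Unit Unit}
    (hq : q ∈ (e.sent (proposing Δ (t + 1)) (proposer (t + 1))).proposals)
    (hqp : q.chain.p = q.slot) (hi : i ∈ e.active Δ (voting Δ (t + 1))) :
    (e.state (voting Δ (t + 1)) i).chFrozen = q.chC := by
  have hone := h.votesOncePerSlot hΔ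
  have hn := Execution.pos_of_compliant h.1
  obtain ⟨c, -, hsent⟩ := h.propose_eq hΔ hg.1
  have hq' := hq
  rw [hsent, Finset.mem_singleton] at hq'
  have hslot : q.slot = t + 1 := by rw [hq']
  have hsender : q.sender = proposer (t + 1) := by rw [hq']
  have hchC : q.chC =
      (fastConfirmSimple (e.view (proposing Δ (t + 1)) (proposer (t + 1))).votes t).1 := by
    rw [hq']; simp
  have hvalid : tobValid proposer q := by
    refine ⟨by rw [hsender, hslot], hqp, ?_⟩
    rw [hq']
    exact certifies_fastConfirmSimple hn _ _
  rw [← hq'] at hsent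
  have hh : ∀ r ≤ voting Δ (t + 1), e.Honest r i := fun r hr => Execution.honest_of_le h.1 hr hi.1
  have hp : ∀ r ≤ voting Δ (t + 1), e.Honest r (proposer (t + 1)) := fun r hr =>
    Execution.honest_of_le h.1 hr hg.2
  have huniq : ∀ r ≤ voting Δ (t + 1), ∀ q' ∈ (e.view r i).proposals, q'.slot = t + 1 →
      q'.sender = proposer (t + 1) → q' = q ∧ proposing Δ (t + 1) < r := fun r hr q' hv hs hs' =>
    eq_of_mem_view_proposals h.1 h.2.1 (fun _ _ hi _ hq => h.sent_proposal hi hq) hsent (hp r hr)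
      (hh r hr) hv hs hs'
  have hmp : merging Δ t ≤ voting Δ (t + 1) := by unfold merging voting; nlinarith
  have key := h.root_induction hΔ hi
    (fun r d => d ≼ q.chC ∧ (q ∈ (e.view r i).proposals → d = q.chC)) ?_ ?_
  · exact key.2 (h.2.1.deliver_proposal _ _ _ i hg.1.1 proposing_add.le hi.1
      (Execution.awake_of_active hi) hq)
  · refine ⟨?_, fun hqv => ?_⟩
    · rw [hchC]
      refine fastConfirmSimple_mono hn ?_ (hone.fastCands_total hg.1.1)
      exact h.2.1.gossip_vote _ i _ _ (hh _ hmp) (Execution.awake_of_active_voting hΔ hi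
        (by rw [← fastConfirming_add]; omega) hmp) merging_add.le hg.1.1
        (Execution.awake_of_active hg.1)
    · have := (huniq _ hmp q hqv hslot hsender).2
      unfold merging proposing at this
      nlinarith
  · rintro r d l hr hr' ⟨hd, hdq⟩ hl hl'
    have hstep : ∀ x ∈ l, ∀ d : Chain Tx, d ≼ q.chC → tobOnProposal proposer d x = d ∨
        tobOnProposal proposer d x = q.chC := by
      intro x hx d hd
      unfold tobOnProposal
      split_ifs with hv
      · obtain ⟨hx1, hx2⟩ := hl x hx
        rw [(huniq _ hr' x hx1 hx2 (by rw [hv.1.1, hx2])).1]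
        exact Or.inr rfl
      · exact Or.inl rfl
    have hle : ∀ b, b ≼ q.chC → ∀ x ∈ l, tobOnProposal proposer b x ≼ q.chC := by
      intro b hb x hx
      rcases hstep x hx b hb with h1 | h1
      · rw [h1]; exact hb
      · rw [h1]; exact Chain.IsPrefix.refl _
    have hC : ∀ x ∈ l, tobOnProposal proposer q.chC x = q.chC := fun x hx => by
      rcases hstep x hx _ (Chain.IsPrefix.refl _) with h1 | h1 <;> exact h1
    refine ⟨List.foldlRecOn (motive := fun d => d ≼ q.chC) l _ hd hle, fun hqv => ?_⟩
    by_cases hqr : q ∈ (e.view r i).proposals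
    · rw [hdq hqr]
      exact List.foldlRecOn (motive := fun d => d = q.chC) l _ rfl fun d hd x hx => by
        rw [hd]; exact hC x hx
    · refine foldl_eq_of_mem (P := fun d => d ≼ q.chC)
        (hl' (huniq _ hr' q hqv hslot hsender).2.le q hqv hslot hqr) hd hle (fun b hb => ?_) hC
      rw [tobOnProposal, if_pos ⟨hvalid, hb⟩]

theorem confirmed_voting (h : IsTobExecution e proposer Δ κ guarded) (hΔ : 0 < Δ)
    (hi : i ∈ e.active Δ (voting Δ t)) :
    ((e.state (voting Δ t) i).confirmed = (e.prev TobState.init (voting Δ t) i).confirmed ∨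
      (e.state (voting Δ t) i).confirmed = ((tobData e Δ).head e Δ t i).deep κ t) ∧
    ((tobData e Δ).head e Δ t i).deep κ t ≼ (e.state (voting Δ t) i).confirmed := by
  have hs := (h.step_voting hΔ hi).confirmed
  rw [if_pos ⟨rfl, hi⟩] at hs
  have hlong := Chain.longest_isGreatest_of_isPrefix (m := (tobData e Δ).head e Δ t i)
    (s := {c | (c = (e.prev TobState.init (voting Δ t) i).confirmed ∨
      c = ((tobData e Δ).head e Δ t i).deep κ t) ∧ c ≼ (tobData e Δ).head e Δ t i})
    ⟨_, Or.inr rfl, Chain.deep_isPrefix _ _ _⟩ fun c hc => hc.2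
  rw [hs]
  exact ⟨hlong.1.1, hlong.2 _ ⟨Or.inr rfl, Chain.deep_isPrefix _ _ _⟩⟩

/-- Outside vote rounds, the confirmed chain changes only by fast confirmations. -/
theorem confirmed_not_voting (h : IsTobExecution e proposer Δ κ guarded) (hi : e.Honest r i)
    (hr : ¬ (r = voting Δ (slotOf Δ r) ∧ i ∈ e.active Δ r)) :
    (e.state r i).confirmed = (e.prev TobState.init r i).confirmed ∨
      ((guarded → ¬ (e.state r i).confirmed ≼ (e.prev TobState.init r i).confirmed) ∧
        r = fastConfirming Δ (slotOf Δ r) ∧ i ∈ e.active Δ r ∧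
        (tobData e Δ).IsRoot e r i (slotOf Δ r) (e.state r i).confirmed) := by
  by_cases ha : i ∈ e.awake r
  · have hs := (h.step hi ha).confirmed
    rw [if_neg hr] at hs
    split_ifs at hs with hc
    · rw [hs]
      exact Or.inr ⟨hc.2.2.2, hc.1, hc.2.1,
        fastConfirmSimple_mem_or (Execution.pos_of_compliant h.1) _ _⟩
    · exact Or.inl hs
  · left
    rw [((h.2.2 r i hi).2 ha).1]

theorem availableRun (h : IsTobExecution e proposer Δ κ guarded) (hΔ : 0 < Δ) (hκ : 0 < κ) :
    AvailableRun e proposer Δ κ (tobData e Δ) where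
  toVotesOncePerSlot := h.votesOncePerSlot hΔ
  kappa_pos := hκ
  vote_choice t i hi v hv := by
    obtain ⟨c, hc, hs⟩ := h.vote_eq hΔ hi
    rw [hs, Finset.mem_singleton] at hv
    rw [hv]; exact hc
  sent_proposal _ _ hi _ hq := h.sent_proposal hi hq
  propose t hp := by
    obtain ⟨c, hc, hs⟩ := h.propose_eq hΔ hp
    refine ⟨_, hs, rfl, rfl, hc, ?_⟩
    have := fastConfirmSimple_mem_or (Execution.pos_of_compliant h.1)
      (e.view (proposing Δ (t + 1)) (proposer (t + 1))).votes (t : ℤ)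
    simpa [LocalData.IsRoot, tobData] using this
  frozen_zero i hi := h.prev_voting_zero hΔ hi
  frozen_succ t i hi := by
    obtain ⟨r, hr⟩ := exists_voting_eq_succ hΔ (t + 1)
    have := h.frozen_eq hΔ hi (r := r) (by unfold merging; unfold voting at hr; nlinarith)
      (by omega)
    simp only [tobData, hr, prev_succ, this]
  root_zero i hi := h.root_voting_zero hΔ hi
  root_succ t i hi := h.isRoot_root hΔ hi
  le_root t i hi _ c hc := h.le_root hΔ hi hc
  root_proposal t hg q hq hqp i hi _ := by
    have := h.root_eq hΔ hg hq hqp hi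
    simp only [tobData, this]
    exact ⟨Chain.IsPrefix.refl _, Or.inl (Chain.IsPrefix.refl _)⟩
  justified_out r i c _ hc := Or.inl hc
  out_init := rfl
  out_step r i hi := by
    by_cases hr : r = voting Δ (slotOf Δ r) ∧ i ∈ e.active Δ r
    · obtain ⟨hr, ha⟩ := hr
      rw [hr] at ha ⊢
      rcases (h.confirmed_voting hΔ ha).1 with h1 | h1
      · exact Or.inl h1
      · exact Or.inr (Or.inl ⟨_, rfl, ha, Or.inl h1⟩)
    · rcases h.confirmed_not_voting hi hr with h1 | ⟨-, h1, h2, h3⟩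
      · exact Or.inl h1
      · exact Or.inr (Or.inr ⟨_, h1, h2, h3⟩)

theorem safeUpTo (h : IsTobExecution e proposer Δ κ guarded) (hΔ : 0 < Δ) (hκ : 0 < κ) {N : ℕ}
    (hg : GoodWindows e proposer Δ κ N) : e.SafeUpTo TobState.confirmed N :=
  (h.availableRun hΔ hκ).safeUpTo hg

theorem liveUpTo (h : IsTobExecution e proposer Δ κ True) (hΔ : 0 < Δ) (hκ : 0 < κ) {N : ℕ}
    (hg : GoodWindows e proposer Δ κ N) :
    e.LiveUpTo TobState.confirmed Δ N (8 * κ * Δ + Δ) :=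
  (h.availableRun hΔ hκ).liveUpTo hg (fun _ _ hi => (h.confirmed_voting hΔ hi).2)
    fun _ _ hi hr => (h.confirmed_not_voting hi fun hr' => hr _ hr'.1).imp id fun h1 =>
      h1.1 trivial

end IsTobExecution

end Tob

/-! ### Justification -/

section Justification

variable {n : ℕ} {Tx : Type*} {V W : Finset (Vote n Tx (FinVote Tx))} {C D : Checkpoint Tx}
  {t : ℤ}

theorem Justified.mono (h : Justified V C) (hVW : V ⊆ W) : Justified W C := by
  induction h with
  | genesis => exact Justified.genesis
  | link S C _ hv hs ih =>
    refine Justified.link S C ih hv (le_trans hs ?_)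
    exact Nat.mul_le_mul_left _ (Finset.card_le_card (Finset.image_subset_image
      (Finset.filter_subset_filter _ hVW)))

theorem greatestJustified_spec (hn : 0 < n) (V : Finset (Vote n Tx (FinVote Tx))) :
    Justified V (greatestJustified V) ∧ ∀ D, Justified V D → D.c ≤ (greatestJustified V).c := by
  have hex : ∃ C, Justified V C ∧ ∀ D, Justified V D → D.c ≤ C.c := by
    obtain ⟨B, hB⟩ := (V.image fun v => v.fin.target.c).bddAbove
    have hbound : ∀ C, Justified V C → C.c ≤ B := by
      rintro C (_ | ⟨S, _, _, _, hs⟩)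
      · exact Nat.zero_le _
      · unfold Supermajority at hs
        obtain ⟨k, hk⟩ := Finset.card_pos.1 (by omega :
          0 < ((V.filter (fun v => v.fin = ⟨S, C⟩)).image Vote.voter).card)
        obtain ⟨v, hv, -⟩ := Finset.mem_image.1 hk
        rw [Finset.mem_filter] at hv
        have := hB (Finset.mem_coe.2 (Finset.mem_image_of_mem
          (fun v : Vote n Tx (FinVote Tx) => v.fin.target.c) hv.1))
        simpa [hv.2] using this
    have hbdd : BddAbove {c | ∃ C, Justified V C ∧ C.c = c} :=
      ⟨B, by rintro _ ⟨C, hC, rfl⟩; exact hbound C hC⟩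
    obtain ⟨C, hC, hCc⟩ := Nat.sSup_mem (s := {c | ∃ C, Justified V C ∧ C.c = c})
      ⟨0, _, Justified.genesis, rfl⟩ hbdd
    exact ⟨C, hC, fun D hD => hCc ▸ le_csSup hbdd ⟨D, hD, rfl⟩⟩
  exact Classical.epsilon_spec (p := fun C => Justified V C ∧ ∀ D, Justified V D → D.c ≤ C.c) hex

theorem fastConfirm_cases (V : Finset (Vote n Tx (FinVote Tx))) (t : ℤ) :
    ((greatestJustified V).chain ≼ (fastConfirmSimple V t).1 ∧
      fastConfirm V t = fastConfirmSimple V t) ∨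
    (¬ (greatestJustified V).chain ≼ (fastConfirmSimple V t).1 ∧
      fastConfirm V t = ((greatestJustified V).chain, ∅)) := by
  by_cases h : (greatestJustified V).chain ≼ (fastConfirmSimple V t).1
  · exact Or.inl ⟨h, by rw [fastConfirm, if_pos h]⟩
  · exact Or.inr ⟨h, by rw [fastConfirm, if_neg h]⟩

theorem greatestJustified_isPrefix_fastConfirm (V : Finset (Vote n Tx (FinVote Tx))) (t : ℤ) :
    (greatestJustified V).chain ≼ (fastConfirm V t).1 := by
  rcases fastConfirm_cases V t with ⟨h, he⟩ | ⟨-, he⟩ <;> rw [he]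
  · exact h
  · exact Chain.IsPrefix.refl _

theorem certifies_fastConfirm (hn : 0 < n) (V : Finset (Vote n Tx (FinVote Tx))) (t : ℤ) :
    Certifies (fastConfirm V t).2 (fastConfirm V t).1 t ∨
      ((fastConfirm V t).2 = ∅ ∧ (fastConfirm V t).1 = (greatestJustified V).chain) := by
  rcases fastConfirm_cases V t with ⟨h, he⟩ | ⟨-, he⟩
  · rw [he]
    rcases certifies_fastConfirmSimple hn V t with h1 | ⟨h1, h2⟩
    · exact Or.inl h1
    · refine Or.inr ⟨h1, ?_⟩
      rw [h2] at h ⊢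
      exact (Chain.genesis_isPrefix _).antisymm h
  · rw [he]; exact Or.inr ⟨rfl, rfl⟩

end Justification

/-! ### The full protocol -/

section Full

variable {n : ℕ} {Tx : Type*} {e : FullExecution n Tx} {proposer : ℕ → Fin n} {Δ κ t r : ℕ}
  {i : Fin n} {C C' : Checkpoint Tx}

/-- The effect of processing one proposal. -/
theorem fullOnProposal_cases (V : Finset (Vote n Tx (FinVote Tx))) (x : Checkpoint Tx × Chain Tx)
    (q : Proposal n Tx (FinVote Tx) (Checkpoint Tx)) :
    fullOnProposal proposer V x q = x ∨
      (fullValid proposer q ∧ Justified V q.gj ∧ (fullOnProposal proposer V x q).1 = q.gj ∧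
        ∃ d, (d = x.2 ∨ d = q.gj.chain ∧ ¬ q.gj.chain ≼ x.2) ∧
          ((fullOnProposal proposer V x q).2 = d ∨
            (fullOnProposal proposer V x q).2 = q.chC ∧ d ≼ q.chC)) := by
  unfold fullOnProposal
  by_cases hv : fullValid proposer q ∧ Justified V q.gj ∧ x.1.le q.gj
  · right
    rw [if_pos hv]
    refine ⟨hv.1, hv.2.1, rfl, if q.gj.chain ≼ x.2 then x.2 else q.gj.chain, ?_, ?_⟩
    · by_cases h : q.gj.chain ≼ x.2
      · exact Or.inl (if_pos h)
      · exact Or.inr ⟨if_neg h, h⟩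
    · by_cases h : (if q.gj.chain ≼ x.2 then x.2 else q.gj.chain) ≼ q.chC
      · exact Or.inr ⟨if_pos h, h⟩
      · exact Or.inl (if_neg h)
  · exact Or.inl (if_neg hv)

/-- The local data of the full protocol. -/
def fullData (e : FullExecution n Tx) (Δ : ℕ) :
    LocalData n Tx (FinVote Tx) (FullState n Tx) where
  frozen t i := (e.prev FullState.init (voting Δ t) i).frozen
  root t i := (e.state (voting Δ t) i).chFrozen
  justified r i c := ∃ C, Justified (e.view r i).votes C ∧ C.chain = c
  out := FullState.chAva
  init := FullState.init

namespace IsFullExecution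

theorem step (h : IsFullExecution e proposer Δ κ) (hi : e.Honest r i) (ha : i ∈ e.awake r) :
    FullStep e proposer Δ κ r i (slotOf Δ r) (e.view r i).votes
      (e.prev FullState.init r i) (e.state r i) :=
  (h.2.2 r i hi).1 ha

theorem step_voting (h : IsFullExecution e proposer Δ κ) (hΔ : 0 < Δ)
    (hi : i ∈ e.active Δ (voting Δ t)) :
    FullStep e proposer Δ κ (voting Δ t) i t (e.view (voting Δ t) i).votes
      (e.prev FullState.init (voting Δ t) i) (e.state (voting Δ t) i) := by
  have := h.step hi.1 (Execution.awake_of_active hi)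
  rwa [slotOf_voting hΔ] at this

theorem sent_vote (h : IsFullExecution e proposer Δ κ) (hi : e.Honest r i)
    {v : Vote n Tx (FinVote Tx)} (hv : v ∈ (e.sent r i).votes) :
    r = voting Δ v.slot ∧ i ∈ e.active Δ r ∧ v.voter = i := by
  by_cases ha : i ∈ e.awake r
  · have hs := (h.step hi ha).vote
    split_ifs at hs with hc
    · obtain ⟨c, -, hs⟩ := hs
      rw [hs, Finset.mem_singleton] at hv
      subst hv
      exact ⟨hc.1, hc.2, rfl⟩
    · rw [hs] at hv; simp at hv
  · rw [((h.2.2 r i hi).2 ha).2] at hv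
    simp [MsgSet.empty] at hv

theorem sent_proposal (h : IsFullExecution e proposer Δ κ) (hi : e.Honest r i)
    {q : Proposal n Tx (FinVote Tx) (Checkpoint Tx)} (hq : q ∈ (e.sent r i).proposals) :
    r = proposing Δ q.slot := by
  by_cases ha : i ∈ e.awake r
  · have hs := (h.step hi ha).propose
    split_ifs at hs with hc
    · obtain ⟨c, -, hs⟩ := hs
      rw [hs, Finset.mem_singleton] at hq
      subst hq
      exact hc.1
    · rw [hs] at hq; simp at hq
  · rw [((h.2.2 r i hi).2 ha).2] at hq
    simp [MsgSet.empty] at hq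

theorem vote_eq (h : IsFullExecution e proposer Δ κ) (hΔ : 0 < Δ)
    (hi : i ∈ e.active Δ (voting Δ t)) :
    ∃ c, e.IsVoteChoice proposer i (voting Δ t) t ((fullData e Δ).head e Δ t i) c ∧
      (e.sent (voting Δ t) i).votes = {⟨c, ⟨(e.state (voting Δ t) i).gjFrozen,
        finTarget (e.state (voting Δ t) i).gjFrozen (e.state (voting Δ t) i).chAva t⟩, t, i⟩} := by
  have hs := (h.step_voting hΔ hi).vote
  rwa [if_pos ⟨rfl, hi⟩] at hs

theorem votesOncePerSlot (h : IsFullExecution e proposer Δ κ) (hΔ : 0 < Δ) :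
    VotesOncePerSlot e Δ where
  delta_pos := hΔ
  compliant := h.1
  sync := h.2.1
  sent_vote _ _ hi _ hv := h.sent_vote hi hv
  exists_vote _ _ hi := by
    obtain ⟨c, -, hs⟩ := h.vote_eq hΔ hi
    exact ⟨_, hs⟩

theorem propose_eq (h : IsFullExecution e proposer Δ κ) (hΔ : 0 < Δ)
    (hp : proposer t ∈ e.active Δ (proposing Δ t)) :
    ∃ c, IsExtend (e.pool (proposing Δ t))
        (mfc (e.view (proposing Δ t) (proposer t)).votes
          (e.view (proposing Δ t) (proposer t)).votes
          (fastConfirm (e.view (proposing Δ t) (proposer t)).votes ((t : ℤ) - 1)).1 t) t c ∧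
      (e.sent (proposing Δ t) (proposer t)).proposals =
        {⟨c, (fastConfirm (e.view (proposing Δ t) (proposer t)).votes ((t : ℤ) - 1)).1,
          (fastConfirm (e.view (proposing Δ t) (proposer t)).votes ((t : ℤ) - 1)).2,
          greatestJustified (e.view (proposing Δ t) (proposer t)).votes, t, proposer t⟩} := by
  have hs := (h.step hp.1 (Execution.awake_of_active hp)).propose
  rwa [slotOf_proposing hΔ, if_pos ⟨rfl, hp, rfl⟩] at hs

theorem finTarget_c (C : Checkpoint Tx) (c : Chain Tx) (t : ℕ) : (finTarget C c t).c = t := by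
  unfold finTarget
  split_ifs <;> rfl

/-- The finality vote of an honest validator, as seen in a view. -/
theorem fin_eq (h : IsFullExecution e proposer Δ κ) (hΔ : 0 < Δ) (hi : e.Honest r i)
    {v : Vote n Tx (FinVote Tx)} (hv : v ∈ (e.view r i).votes) (hk : e.Honest r v.voter) :
    v.fin = ⟨(e.state (voting Δ v.slot) v.voter).gjFrozen,
      finTarget (e.state (voting Δ v.slot) v.voter).gjFrozen
        (e.state (voting Δ v.slot) v.voter).chAva v.slot⟩ := by
  obtain ⟨-, h2, h3⟩ := (h.votesOncePerSlot hΔ).of_mem_view hi hv hk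
  obtain ⟨c, -, hs⟩ := h.vote_eq hΔ h2
  rw [hs, Finset.mem_singleton] at h3
  conv_lhs => rw [h3]

/-- In every slot at most one checkpoint is justified. -/
theorem justified_unique (h : IsFullExecution e proposer Δ κ) (hΔ : 0 < Δ) (hi : e.Honest r i)
    (hC : Justified (e.view r i).votes C) (hC' : Justified (e.view r i).votes C')
    (hc : C.c = C'.c) : C = C' := by
  rcases hC with _ | ⟨S, _, _, hv, hs⟩ <;> rcases hC' with _ | ⟨S', _, _, hv', hs'⟩
  · rfl
  · exact absurd hv'.2 (by simp [← hc])
  · exact absurd hv.2 (by simp [hc])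
  · obtain ⟨k, hk, hk', hh⟩ := Execution.exists_neverCorrupt_inter h.1 hs hs'
    obtain ⟨v, hv, rfl⟩ := Finset.mem_image.1 hk
    obtain ⟨w, hw, hvw⟩ := Finset.mem_image.1 hk'
    rw [Finset.mem_filter] at hv hw
    have e1 : C.c = v.slot := by
      have := h.fin_eq hΔ hi hv.1 (hh r)
      rw [hv.2] at this
      rw [(FinVote.mk.inj this).2, finTarget_c]
    have e2 : C'.c = w.slot := by
      have := h.fin_eq hΔ hi hw.1 (hvw ▸ hh r)
      rw [hw.2] at this
      rw [(FinVote.mk.inj this).2, finTarget_c]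
    have := (h.votesOncePerSlot hΔ).view_unique hi hv.1 hw.1 (hh r) hvw (by omega)
    subst this
    exact (FinVote.mk.inj (hv.2.symm.trans hw.2)).2

/-- The chain of a justified checkpoint is an available chain of an honest voter, or the chain of an
earlier justified checkpoint. -/
theorem justified_out (h : IsFullExecution e proposer Δ κ) (hΔ : 0 < Δ) (hi : e.Honest r i)
    (hC : Justified (e.view r i).votes C) : C.chain = Chain.genesis ∨
      ∃ s k, voting Δ s < r ∧ k ∈ e.active Δ (voting Δ s) ∧
        C.chain = (e.state (voting Δ s) k).chAva := by
  induction hC with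
  | genesis => exact Or.inl rfl
  | link S C _ _ hs ih =>
    obtain ⟨k, hk, hh⟩ := Execution.exists_neverCorrupt h.1 hs
    obtain ⟨v, hv, rfl⟩ := Finset.mem_image.1 hk
    rw [Finset.mem_filter] at hv
    obtain ⟨h1, h2, -⟩ := (h.votesOncePerSlot hΔ).of_mem_view hi hv.1 (hh r)
    have hf := h.fin_eq hΔ hi hv.1 (hh r)
    rw [hv.2] at hf
    obtain ⟨hS, hC⟩ := FinVote.mk.inj hf
    unfold finTarget at hC
    split_ifs at hC
    · exact Or.inr ⟨_, _, h1, h2, by rw [hC]⟩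
    · rw [hC, ← hS]; exact ih

theorem isRoot_fastConfirm (h : IsFullExecution e proposer Δ κ) :
    (fullData e Δ).IsRoot e r i t (fastConfirm (e.view r i).votes t).1 := by
  have hn := Execution.pos_of_compliant h.1
  rcases fastConfirm_cases (e.view r i).votes t with ⟨-, he⟩ | ⟨-, he⟩ <;> rw [he]
  · exact (fastConfirmSimple_mem_or hn _ _).imp id fun hg =>
      ⟨_, Justified.genesis, hg.symm⟩
  · exact Or.inr ⟨_, (greatestJustified_spec hn _).1, rfl⟩

theorem isRoot_mono {r' : ℕ} {j : Fin n} {c : Chain Tx}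
    (hV : (e.view r i).votes ⊆ (e.view r' j).votes) (hc : (fullData e Δ).IsRoot e r i t c) :
    (fullData e Δ).IsRoot e r' j t c :=
  hc.imp (fun hc => fastCands_mono hV hc) fun ⟨C, hC, hc⟩ => ⟨C, hC.mono hV, hc⟩

/-! ### The frozen state between merge and vote rounds -/

theorem step_of_le_voting_zero (h : IsFullExecution e proposer Δ κ) (hΔ : 0 < Δ)
    (hi : i ∈ e.active Δ (voting Δ 0)) (hr : r ≤ voting Δ 0) :
    FullStep e proposer Δ κ r i 0 (e.view r i).votes (e.prev FullState.init r i)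
      (e.state r i) := by
  have hs := h.step (Execution.honest_of_le h.1 hr hi.1)
    (Execution.awake_of_active_voting_zero hΔ hi hr)
  rwa [slotOf_eq (t := 0) (by simp [proposing])
    (hr.trans_lt (by unfold voting proposing; omega))] at hs

theorem prev_voting_zero (h : IsFullExecution e proposer Δ κ) (hΔ : 0 < Δ)
    (hi : i ∈ e.active Δ (voting Δ 0)) :
    (e.prev FullState.init (voting Δ 0) i).frozen = ∅ ∧
      ((e.prev FullState.init (voting Δ 0) i).gjFrozen,
        (e.prev FullState.init (voting Δ 0) i).chFrozen) =
        (⟨Chain.genesis, 0⟩, Chain.genesis) := by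
  constructor
  · refine prev_eq_init (f := FullState.frozen) fun r hr => ?_
    have hs := (h.step_of_le_voting_zero hΔ hi hr.le).frozen
    rwa [if_neg (ne_merging_of_le_voting_zero hΔ hr.le 0)] at hs
  · refine prev_eq_init (f := fun s : FullState n Tx => (s.gjFrozen, s.chFrozen)) fun r hr => ?_
    have hs := (h.step_of_le_voting_zero hΔ hi hr.le).gjChFrozen
    rw [if_neg (ne_merging_of_le_voting_zero hΔ hr.le 0), if_neg hr.ne] at hs
    simp only [hs]

theorem prev_voting_succ (h : IsFullExecution e proposer Δ κ) (hΔ : 0 < Δ)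
    (hi : i ∈ e.active Δ (voting Δ (t + 1))) :
    (e.prev FullState.init (voting Δ (t + 1)) i).frozen = (e.view (merging Δ t) i).votes ∧
      ((e.prev FullState.init (voting Δ (t + 1)) i).gjFrozen,
        (e.prev FullState.init (voting Δ (t + 1)) i).chFrozen) =
        (greatestJustified (e.view (merging Δ t) i).votes,
          (fastConfirm (e.view (merging Δ t) i).votes t).1) := by
  have hst : ∀ r, merging Δ t ≤ r → r ≤ voting Δ (t + 1) → _ := fun r hr hr' =>
    h.step (Execution.honest_of_le h.1 hr' hi.1) (Execution.awake_of_active_voting hΔ hi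
      (le_trans (by rw [← fastConfirming_add]; omega) hr) hr')
  have hmv : merging Δ t < voting Δ (t + 1) := by unfold merging voting; nlinarith
  obtain ⟨R, hR⟩ := exists_voting_eq_succ hΔ (t + 1)
  rw [hR, prev_succ]
  constructor
  · refine eq_of_forall_eq_prev (s₀ := FullState.init) (f := FullState.frozen)
      (r₀ := merging Δ t) (R := R) ?_
      (fun r hr hr' => ?_) (by omega) le_rfl
    · have hs := (hst _ le_rfl hmv.le).frozen
      rwa [slotOf_merging hΔ, if_pos rfl] at hs
    · have hs := (hst r hr.le (by omega)).frozen
      rwa [if_neg (ne_merging hΔ hr (by omega) _)] at hs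
  · refine eq_of_forall_eq_prev (s₀ := FullState.init)
      (f := fun s : FullState n Tx => (s.gjFrozen, s.chFrozen)) (r₀ := merging Δ t) (R := R) ?_
      (fun r hr hr' => ?_) (by omega) le_rfl
    · have hs := (hst _ le_rfl hmv.le).gjChFrozen
      rw [slotOf_merging hΔ, if_pos rfl] at hs
      simp only [hs]
    · have hs := (hst r hr.le (by omega)).gjChFrozen
      have hnv : r ≠ voting Δ (slotOf Δ r) := fun hv => by
        have h1 : voting Δ (slotOf Δ r) < voting Δ (t + 1) := by omega
        have h2 : voting Δ t < voting Δ (slotOf Δ r) := by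
          rw [← hv]; unfold merging at hr; unfold voting; omega
        rw [voting_lt_iff hΔ] at h1 h2
        omega
      rw [if_neg (ne_merging hΔ hr (by omega) _), if_neg hnv] at hs
      simp only [hs]

/-- The frozen checkpoint and the root in the vote round of slot `t` result from processing the
proposals for slot `t`. -/
theorem exists_foldl (h : IsFullExecution e proposer Δ κ) (hΔ : 0 < Δ)
    (hi : i ∈ e.active Δ (voting Δ t)) :
    ∃ l : List (Proposal n Tx (FinVote Tx) (Checkpoint Tx)), l.Nodup ∧
      (∀ q, q ∈ l ↔ q ∈ e.newProposals i (proposing Δ t) (voting Δ t) ∧ q.slot = t) ∧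
      ((e.state (voting Δ t) i).gjFrozen, (e.state (voting Δ t) i).chFrozen) =
        l.foldl (fullOnProposal proposer (e.view (voting Δ t) i).votes)
          ((e.prev FullState.init (voting Δ t) i).gjFrozen,
            (e.prev FullState.init (voting Δ t) i).chFrozen) := by
  have hs := (h.step_voting hΔ hi).gjChFrozen
  rw [if_neg (by unfold voting merging; omega), if_pos rfl] at hs
  obtain ⟨l, hl, hl', hs⟩ := hs
  exact ⟨l, hl, fun q => by rw [← List.mem_toFinset, hl', Finset.mem_filter], hs⟩

theorem mem_view_of_mem_newProposals {e : FullExecution n Tx} {r₀ : ℕ}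
    {q : Proposal n Tx (FinVote Tx) (Checkpoint Tx)} (hq : q ∈ e.newProposals i r₀ r) :
    q ∈ (e.view r i).proposals := (Finset.mem_sdiff.1 hq).1

theorem justified_gjFrozen (h : IsFullExecution e proposer Δ κ) (hΔ : 0 < Δ)
    (hi : i ∈ e.active Δ (voting Δ t)) :
    Justified (e.view (voting Δ t) i).votes (e.state (voting Δ t) i).gjFrozen := by
  obtain ⟨l, -, -, hs⟩ := h.exists_foldl hΔ hi
  rw [show (e.state (voting Δ t) i).gjFrozen = ((e.state (voting Δ t) i).gjFrozen,
    (e.state (voting Δ t) i).chFrozen).1 from rfl, hs]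
  refine List.foldlRecOn (motive := fun x : Checkpoint Tx × Chain Tx =>
    Justified (e.view (voting Δ t) i).votes x.1) l _ ?_ fun x hx q _ => ?_
  · cases t with
    | zero => rw [(h.prev_voting_zero hΔ hi).2]; exact Justified.genesis
    | succ t =>
      rw [(h.prev_voting_succ hΔ hi).2]
      refine (greatestJustified_spec (Execution.pos_of_compliant h.1) _).1.mono ?_
      exact Execution.view_mono h.1 h.2.1 (by unfold merging voting; nlinarith) hi.1
  · rcases fullOnProposal_cases (proposer := proposer) (e.view (voting Δ t) i).votes x q with
      h1 | ⟨-, hJ, h1, -⟩ <;> rw [h1]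
    · exact hx
    · exact hJ

theorem root_voting_zero (h : IsFullExecution e proposer Δ κ) (hΔ : 0 < Δ)
    (hi : i ∈ e.active Δ (voting Δ 0)) :
    (fullData e Δ).justified (voting Δ 0) i (e.state (voting Δ 0) i).chFrozen := by
  obtain ⟨l, -, hl, hs⟩ := h.exists_foldl hΔ hi
  rw [show (e.state (voting Δ 0) i).chFrozen = ((e.state (voting Δ 0) i).gjFrozen,
    (e.state (voting Δ 0) i).chFrozen).2 from rfl, hs]
  refine List.foldlRecOn (motive := fun x : Checkpoint Tx × Chain Tx =>
    (fullData e Δ).justified (voting Δ 0) i x.2) l _ ?_ fun x hx q hq => ?_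
  · rw [(h.prev_voting_zero hΔ hi).2]; exact ⟨_, Justified.genesis, rfl⟩
  · rcases fullOnProposal_cases (proposer := proposer) (e.view (voting Δ 0) i).votes x q with
      h1 | ⟨hv, hJ, -, d, hd, h1⟩
    · rw [h1]; exact hx
    · rcases h1 with h1 | ⟨h1, -⟩ <;> rw [h1]
      · rcases hd with rfl | ⟨rfl, -⟩
        · exact hx
        · exact ⟨_, hJ, rfl⟩
      · rcases hv.2.2 with hcert | hgen
        · exfalso
          obtain ⟨hq1, hq2⟩ := (hl q).1 hq
          rw [hq2] at hcert
          have := (h.votesOncePerSlot hΔ).slot_nonneg_of_mem_fastCands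
            (hcert.mem_fastCands (h.2.1.embedded _ i hi.1 q (mem_view_of_mem_newProposals hq1)))
          norm_num at this
        · exact ⟨_, hJ, hgen.2.symm⟩

/-- Processing proposals keeps the root among the possible ones and, if these are pairwise
comparable, never moves it down. -/
theorem root_invariant (h : IsFullExecution e proposer Δ κ) (hΔ : 0 < Δ)
    (hi : i ∈ e.active Δ (voting Δ (t + 1))) :
    (fullData e Δ).IsRoot e (voting Δ (t + 1)) i t (e.state (voting Δ (t + 1)) i).chFrozen ∧
      ((fullData e Δ).RootsTotal e (voting Δ (t + 1)) i t →
        (fastConfirm (e.view (merging Δ t) i).votes t).1 ≼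
          (e.state (voting Δ (t + 1)) i).chFrozen) := by
  obtain ⟨l, -, hl, hs⟩ := h.exists_foldl hΔ hi
  rw [show (e.state (voting Δ (t + 1)) i).chFrozen = ((e.state (voting Δ (t + 1)) i).gjFrozen,
    (e.state (voting Δ (t + 1)) i).chFrozen).2 from rfl, hs]
  refine List.foldlRecOn (motive := fun x : Checkpoint Tx × Chain Tx =>
    (fullData e Δ).IsRoot e (voting Δ (t + 1)) i t x.2 ∧
      ((fullData e Δ).RootsTotal e (voting Δ (t + 1)) i t →
        (fastConfirm (e.view (merging Δ t) i).votes t).1 ≼ x.2)) l _ ?_ fun x hx q hq => ?_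
  · rw [(h.prev_voting_succ hΔ hi).2]
    refine ⟨isRoot_mono (Execution.view_mono h.1 h.2.1 (by unfold merging voting; nlinarith) hi.1)
      h.isRoot_fastConfirm, fun _ => Chain.IsPrefix.refl _⟩
  · obtain ⟨hx1, hx2⟩ := hx
    rcases fullOnProposal_cases (proposer := proposer) (e.view (voting Δ (t + 1)) i).votes x q with
      h1 | ⟨hv, hJ, -, d, hd, h1⟩
    · rw [h1]; exact ⟨hx1, hx2⟩
    obtain ⟨hq1, hq2⟩ := (hl q).1 hq
    have hgj : (fullData e Δ).IsRoot e (voting Δ (t + 1)) i t q.gj.chain := Or.inr ⟨_, hJ, rfl⟩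
    have hchC : (fullData e Δ).IsRoot e (voting Δ (t + 1)) i t q.chC := by
      rcases hv.2.2 with hcert | hgen
      · rw [hq2] at hcert
        left
        have := hcert.mem_fastCands (h.2.1.embedded _ i hi.1 q (mem_view_of_mem_newProposals hq1))
        simpa using this
      · rw [hgen.2]; exact hgj
    have hd' : (fullData e Δ).IsRoot e (voting Δ (t + 1)) i t d ∧
        ((fullData e Δ).RootsTotal e (voting Δ (t + 1)) i t → x.2 ≼ d) := by
      rcases hd with rfl | ⟨rfl, hne⟩
      · exact ⟨hx1, fun _ => Chain.IsPrefix.refl _⟩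
      · exact ⟨hgj, fun htot => (htot _ _ hx1 hgj).resolve_right hne⟩
    rcases h1 with h1 | ⟨h1, hle⟩ <;> rw [h1]
    · exact ⟨hd'.1, fun htot => (hx2 htot).trans (hd'.2 htot)⟩
    · exact ⟨hchC, fun htot => ((hx2 htot).trans (hd'.2 htot)).trans hle⟩

theorem le_root (h : IsFullExecution e proposer Δ κ) (hΔ : 0 < Δ)
    (hi : i ∈ e.active Δ (voting Δ (t + 1)))
    (htot : (fullData e Δ).RootsTotal e (voting Δ (t + 1)) i t) {c : Chain Tx}
    (hc : c ∈ fastCands (e.view (merging Δ t) i).votes t) :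
    c ≼ (e.state (voting Δ (t + 1)) i).chFrozen := by
  have hn := Execution.pos_of_compliant h.1
  have hmv : merging Δ t ≤ voting Δ (t + 1) := by unfold merging voting; nlinarith
  have hview := Execution.view_mono h.1 h.2.1 hmv hi.1
  refine Chain.IsPrefix.trans ?_ ((h.root_invariant hΔ hi).2 htot)
  have h1 := isPrefix_fastConfirmSimple hn ((h.votesOncePerSlot hΔ).fastCands_total
    (Execution.honest_of_le h.1 hmv hi.1)) hc
  refine h1.trans ?_
  rcases fastConfirm_cases (e.view (merging Δ t) i).votes t with ⟨-, he⟩ | ⟨hne, he⟩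
  · rw [he]; exact Chain.IsPrefix.refl _
  · have hroot := isRoot_mono hview (h.isRoot_fastConfirm (r := merging Δ t) (i := i) (t := t))
    rw [he] at hroot ⊢
    exact (htot _ _ (Or.inl (fastCands_mono hview (fastConfirmSimple_mem hn ⟨c, hc⟩)))
      hroot).resolve_right hne

/-- In a good slot a validator adopts the root `chC` of the proposer, unless its own root is a
justified chain above `chC`. This happens if the proposer knows of a later justified checkpoint with
a lower chain. -/
theorem root_proposal (h : IsFullExecution e proposer Δ κ) (hΔ : 0 < Δ)
    (hg : GoodSlot e proposer Δ (t + 1)) {q : Proposal n Tx (FinVote Tx) (Checkpoint Tx)}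
    (hq : q ∈ (e.sent (proposing Δ (t + 1)) (proposer (t + 1))).proposals)
    (hqp : q.chain.p = q.slot) (hi : i ∈ e.active Δ (voting Δ (t + 1)))
    (htot : (fullData e Δ).RootsTotal e (voting Δ (t + 1)) i t) :
    q.chC ≼ (e.state (voting Δ (t + 1)) i).chFrozen ∧
      ((e.state (voting Δ (t + 1)) i).chFrozen ≼ q.chC ∨
        (fullData e Δ).justified (voting Δ (t + 1)) i
          (e.state (voting Δ (t + 1)) i).chFrozen) := by
  have hone := h.votesOncePerSlot hΔ
  have hn := Execution.pos_of_compliant h.1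
  obtain ⟨c, -, hsent⟩ := h.propose_eq hΔ hg.1
  have hq' := hq
  rw [hsent, Finset.mem_singleton] at hq'
  rw [← hq'] at hsent
  rw [show ((t + 1 : ℕ) : ℤ) - 1 = t by push_cast; ring] at hq'
  set Vp := (e.view (proposing Δ (t + 1)) (proposer (t + 1))).votes with hVp
  set Vm := (e.view (merging Δ t) i).votes with hVm
  have hslot : q.slot = t + 1 := by rw [hq']
  have hsender : q.sender = proposer (t + 1) := by rw [hq']
  have hchC : q.chC = (fastConfirm Vp t).1 := by rw [hq']
  have hgj : q.gj = greatestJustified Vp := by rw [hq']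
  have hmv : merging Δ t ≤ voting Δ (t + 1) := by unfold merging voting; nlinarith
  have hh : e.Honest (merging Δ t) i := Execution.honest_of_le h.1 hmv hi.1
  have hVmp : Vm ⊆ Vp := h.2.1.gossip_vote _ i _ _ hh (Execution.awake_of_active_voting hΔ hi
    (by rw [← fastConfirming_add]; omega) hmv) merging_add.le hg.1.1
    (Execution.awake_of_active hg.1)
  have hVpi : Vp ⊆ (e.view (voting Δ (t + 1)) i).votes :=
    h.2.1.gossip_vote _ _ _ i hg.1.1 (Execution.awake_of_active hg.1) proposing_add.le hi.1
      (Execution.awake_of_active hi)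
  have huniq : ∀ r, r ≤ voting Δ (t + 1) → ∀ q' ∈ (e.view r i).proposals, q'.slot = t + 1 →
      q'.sender = proposer (t + 1) → q' = q ∧ proposing Δ (t + 1) < r := fun r hr q' hv hs hs' =>
    eq_of_mem_view_proposals h.1 h.2.1 (fun _ _ hi _ hq => h.sent_proposal hi hq) hsent
      (Execution.honest_of_le h.1 hr hg.2) (Execution.honest_of_le h.1 hr hi.1) hv hs hs'
  have hvalid : fullValid proposer q := by
    refine ⟨by rw [hsender, hslot], hqp, ?_⟩
    have := certifies_fastConfirm hn Vp t
    rw [hslot, show ((t + 1 : ℕ) : ℤ) - 1 = t by push_cast; ring]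
    rwa [hq']
  obtain ⟨l, hnodup, hl, hs⟩ := h.exists_foldl hΔ hi
  have hql : q ∈ l := by
    refine (hl q).2 ⟨Finset.mem_sdiff.2 ⟨h.2.1.deliver_proposal _ _ _ i hg.1.1 proposing_add.le
      hi.1 (Execution.awake_of_active hi) hq, ?_⟩, hslot⟩
    split_ifs with h0
    · simp
    · intro hqv
      have h1 : proposing Δ (t + 1) - 1 ≤ voting Δ (t + 1) := by unfold proposing voting; omega
      have := (huniq _ h1 q hqv hslot hsender).2
      omega
  rw [foldl_eq_of_nodup hql hnodup, (h.prev_voting_succ hΔ hi).2] at hs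
  swap
  · intro x q' hq'l hne
    unfold fullOnProposal
    rw [if_neg]
    rintro ⟨hv, -⟩
    obtain ⟨h1, h2⟩ := (hl q').1 hq'l
    exact hne (huniq _ le_rfl q' (mem_view_of_mem_newProposals h1) h2 (by rw [hv.1, h2])).1
  have hJm := greatestJustified_spec hn Vm
  have hJp := greatestJustified_spec hn Vp
  have hcond : fullValid proposer q ∧ Justified (e.view (voting Δ (t + 1)) i).votes q.gj ∧
      (greatestJustified Vm).le q.gj := by
    refine ⟨hvalid, hgj ▸ hJp.1.mono hVpi, ?_⟩
    rw [hgj]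
    rcases (hJp.2 _ (hJm.1.mono hVmp)).lt_or_eq with hlt | heq
    · exact Or.inl hlt
    · exact Or.inr (h.justified_unique hΔ hg.1.1 (hJm.1.mono hVmp) hJp.1 heq)
  rw [fullOnProposal, if_pos hcond, Prod.mk.injEq] at hs
  have hs2 := hs.2
  simp only at hs2
  have hgC : q.gj.chain ≼ q.chC := by
    rw [hgj, hchC]; exact greatestJustified_isPrefix_fastConfirm _ _
  by_cases hc : (if q.gj.chain ≼ (fastConfirm Vm t).1 then (fastConfirm Vm t).1
      else q.gj.chain) ≼ q.chC
  · rw [if_pos hc] at hs2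
    rw [hs2]
    exact ⟨Chain.IsPrefix.refl _, Or.inl (Chain.IsPrefix.refl _)⟩
  · rw [if_neg hc] at hs2
    by_cases hgm : q.gj.chain ≼ (fastConfirm Vm t).1
    · rw [if_pos hgm] at hc hs2
      rw [hs2]
      have hroot : (fullData e Δ).IsRoot e (voting Δ (t + 1)) i t q.chC := by
        rw [hchC]; exact isRoot_mono hVpi h.isRoot_fastConfirm
      have hroot' : (fullData e Δ).IsRoot e (voting Δ (t + 1)) i t (fastConfirm Vm t).1 :=
        isRoot_mono (hVmp.trans hVpi) h.isRoot_fastConfirm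
      refine ⟨(htot _ _ hroot hroot').resolve_right hc, Or.inr ?_⟩
      rcases fastConfirm_cases Vm t with ⟨-, he⟩ | ⟨-, he⟩
      · -- A fast-confirmed root would lie below the root of the proposer.
        exfalso
        rw [he] at hc hgm
        have hle := fastConfirmSimple_mono (s := t) hn hVmp (hone.fastCands_total hg.1.1)
        rcases fastConfirm_cases Vp t with ⟨-, he'⟩ | ⟨hne, -⟩
        · rw [hchC, he'] at hc
          exact hc hle
        · rw [← hgj] at hne
          exact hne (hgm.trans hle)
      · rw [he]
        exact ⟨_, hJm.1.mono (hVmp.trans hVpi), rfl⟩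
    · rw [if_neg hgm] at hc
      exact absurd hgC hc

theorem chAva_voting (h : IsFullExecution e proposer Δ κ) (hΔ : 0 < Δ)
    (hi : i ∈ e.active Δ (voting Δ t)) :
    ((e.state (voting Δ t) i).chAva = (e.prev FullState.init (voting Δ t) i).chAva ∨
      (e.state (voting Δ t) i).chAva = ((fullData e Δ).head e Δ t i).deep κ t ∨
      (e.state (voting Δ t) i).chAva = (e.state (voting Δ t) i).gjFrozen.chain) ∧
    ((fullData e Δ).head e Δ t i).deep κ t ≼ (e.state (voting Δ t) i).chAva := by
  have hs := (h.step_voting hΔ hi).chAva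
  rw [if_pos ⟨rfl, hi⟩] at hs
  have hlong := Chain.longest_isGreatest_of_isPrefix (m := (fullData e Δ).head e Δ t i)
    (s := {c | (c = (e.prev FullState.init (voting Δ t) i).chAva ∨
      c = ((fullData e Δ).head e Δ t i).deep κ t ∨
      c = (e.state (voting Δ t) i).gjFrozen.chain) ∧ c ≼ (fullData e Δ).head e Δ t i})
    ⟨_, Or.inr (Or.inl rfl), Chain.deep_isPrefix _ _ _⟩ fun c hc => hc.2
  rw [hs]
  exact ⟨hlong.1.1, hlong.2 _ ⟨Or.inr (Or.inl rfl), Chain.deep_isPrefix _ _ _⟩⟩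

/-- Outside vote rounds, the available chain changes only by fast confirmations. -/
theorem chAva_not_voting (h : IsFullExecution e proposer Δ κ) (hi : e.Honest r i)
    (hr : ¬ (r = voting Δ (slotOf Δ r) ∧ i ∈ e.active Δ r)) :
    (e.state r i).chAva = (e.prev FullState.init r i).chAva ∨
      (¬ (e.state r i).chAva ≼ (e.prev FullState.init r i).chAva ∧
        r = fastConfirming Δ (slotOf Δ r) ∧ i ∈ e.active Δ r ∧
        (fullData e Δ).IsRoot e r i (slotOf Δ r) (e.state r i).chAva) := by
  by_cases ha : i ∈ e.awake r
  · have hs := (h.step hi ha).chAva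
    rw [if_neg hr] at hs
    split_ifs at hs with hc
    · rw [hs]
      exact Or.inr ⟨hc.2.2, hc.1, hc.2.1, h.isRoot_fastConfirm⟩
    · exact Or.inl hs
  · left
    rw [((h.2.2 r i hi).2 ha).1]

theorem availableRun (h : IsFullExecution e proposer Δ κ) (hΔ : 0 < Δ) (hκ : 0 < κ) :
    AvailableRun e proposer Δ κ (fullData e Δ) where
  toVotesOncePerSlot := h.votesOncePerSlot hΔ
  kappa_pos := hκ
  vote_choice t i hi v hv := by
    obtain ⟨c, hc, hs⟩ := h.vote_eq hΔ hi
    rw [hs, Finset.mem_singleton] at hv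
    rw [hv]; exact hc
  sent_proposal _ _ hi _ hq := h.sent_proposal hi hq
  propose t hp := by
    obtain ⟨c, hc, hs⟩ := h.propose_eq hΔ hp
    refine ⟨_, hs, rfl, rfl, hc, ?_⟩
    rw [show ((t + 1 : ℕ) : ℤ) - 1 = t by push_cast; ring]
    exact h.isRoot_fastConfirm
  frozen_zero i hi := (h.prev_voting_zero hΔ hi).1
  frozen_succ t i hi := (h.prev_voting_succ hΔ hi).1
  root_zero i hi := h.root_voting_zero hΔ hi
  root_succ t i hi := (h.root_invariant hΔ hi).1
  le_root t i hi htot c hc := h.le_root hΔ hi htot hc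
  root_proposal t hg q hq hqp i hi htot := h.root_proposal hΔ hg hq hqp hi htot
  justified_out r i c hi hc := by
    obtain ⟨C, hC, rfl⟩ := hc
    exact h.justified_out hΔ hi hC
  out_init := rfl
  out_step r i hi := by
    by_cases hr : r = voting Δ (slotOf Δ r) ∧ i ∈ e.active Δ r
    · obtain ⟨hr, ha⟩ := hr
      rw [hr] at ha ⊢
      rcases (h.chAva_voting hΔ ha).1 with h1 | h1 | h1
      · exact Or.inl h1
      · exact Or.inr (Or.inl ⟨_, rfl, ha, Or.inl h1⟩)
      · exact Or.inr (Or.inl ⟨_, rfl, ha, Or.inr ⟨_, h.justified_gjFrozen hΔ ha, h1.symm⟩⟩)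
    · rcases h.chAva_not_voting hi hr with h1 | ⟨-, h1, h2, h3⟩
      · exact Or.inl h1
      · exact Or.inr (Or.inr ⟨_, h1, h2, h3⟩)

theorem safeUpTo (h : IsFullExecution e proposer Δ κ) (hΔ : 0 < Δ) (hκ : 0 < κ) {N : ℕ}
    (hg : GoodWindows e proposer Δ κ N) : e.SafeUpTo FullState.chAva N :=
  (h.availableRun hΔ hκ).safeUpTo hg

theorem liveUpTo (h : IsFullExecution e proposer Δ κ) (hΔ : 0 < Δ) (hκ : 0 < κ) {N : ℕ}
    (hg : GoodWindows e proposer Δ κ N) :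
    e.LiveUpTo FullState.chAva Δ N (8 * κ * Δ + Δ) :=
  (h.availableRun hΔ hκ).liveUpTo hg (fun _ _ hi => (h.chAva_voting hΔ hi).2)
    fun _ _ hi hr => (h.chAva_not_voting hi fun hr' => hr _ hr'.1).imp id And.left

end IsFullExecution

end Full

/-! ### Good slots are frequent -/

section Windows

variable {n : ℕ} {Tx F G S : Type*}

/-- If each of `n` consecutive blocks of `L` slots contains a slot with an active proposer, then one
of these slots is good: every other one costs the adversary a fresh corruption. -/
theorem exists_goodSlot {e : Execution n Tx F G S} {proposer : ℕ → Fin n} {Δ a L : ℕ}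
    (hc : e.Compliant Δ)
    (h : ∀ j < n, ∃ s, a + j * L ≤ s ∧ s < a + j * L + L ∧
      proposer s ∈ e.active Δ (proposing Δ s)) :
    ∃ s, a ≤ s ∧ s < a + n * L ∧ GoodSlot e proposer Δ s := by
  by_contra! hcon
  choose f hf1 hf2 hf3 using h
  have hbad : ∀ j (hj : j < n), proposer (f j hj) ∈ e.corrupt (voting Δ (f j hj)) := by
    intro j hj
    by_contra hh
    refine hcon (f j hj) (le_trans (Nat.le_add_right _ _) (hf1 j hj))
      ((hf2 j hj).trans_le ?_) ⟨hf3 j hj, hh⟩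
    have := Nat.mul_le_mul_right L (show j + 1 ≤ n from hj)
    rw [Nat.add_mul, Nat.one_mul] at this
    omega
  have hne : ∀ j j' (hj : j < n) (hj' : j' < n), j < j' →
      proposer (f j hj) ≠ proposer (f j' hj') := by
    intro j j' hj hj' hlt heq
    have h1 : f j hj < f j' hj' := by
      have := Nat.mul_le_mul_right L (show j + 1 ≤ j' from hlt)
      rw [Nat.add_mul, Nat.one_mul] at this
      have := hf2 j hj
      have := hf1 j' hj'
      omega
    refine (hf3 j' hj').1 (hc.corrupt_mono (voting Δ (f j hj)) _ ?_ (heq ▸ hbad j hj))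
    have := Nat.mul_le_mul_left (4 * Δ) (show f j hj + 1 ≤ f j' hj' from h1)
    unfold voting proposing
    rw [Nat.mul_add] at this
    omega
  have hinj : Function.Injective fun j : Fin n => proposer (f j j.2) := by
    intro j j' heq
    rcases lt_trichotomy (j : ℕ) j' with hlt | heq' | hlt
    · exact absurd heq (hne _ _ j.2 j'.2 hlt)
    · exact Fin.ext heq'
    · exact absurd heq.symm (hne _ _ j'.2 j.2 hlt)
  have hrange : Set.range (fun j : Fin n => proposer (f j j.2)) ⊆ e.everCorrupt := by
    rintro _ ⟨j, rfl⟩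
    exact ⟨_, hbad j j.2⟩
  have h1 := Set.ncard_le_ncard hrange (Set.toFinite _)
  rw [← Set.image_univ, Set.ncard_image_of_injective _ hinj, Set.ncard_univ, Nat.card_fin] at h1
  have := hc.few_corrupt
  omega

end Windows

section Election

open MeasureTheory ProbabilityTheory

variable {n : ℕ} {Ω : Type*}

theorem measurableSet_active [MeasurableSpace Ω] {Tx F G S : Type*}
    {e : Ω → Execution n Tx F G S} {Δ r : ℕ} {i : Fin n}
    (h : ∀ r' ≤ r, MeasurableSet {ω | i ∈ (e ω).corrupt r'} ∧
      MeasurableSet {ω | i ∈ (e ω).awake r'}) :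
    MeasurableSet {ω | i ∈ (e ω).active Δ r} := by
  have haw : ∀ r', Measurable fun ω => r' ≤ r → i ∈ (e ω).awake r' := by
    intro r'
    by_cases hr : r' ≤ r
    · simpa [hr] using measurableSet_setOfPred.1 (h r' hr).2
    · simp [hr]
  refine measurableSet_setOfPred.2 ?_
  simp only [Execution.active, Execution.Honest, Set.mem_ofPred_eq]
  refine Measurable.and (measurableSet_setOfPred.1 (h r le_rfl).1).not
    (Measurable.or (Measurable.forall haw) (Measurable.exists fun t => ?_))
  exact measurable_const.and (Measurable.forall fun r' => measurable_const.imp (haw r'))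

variable [m : MeasurableSpace Ω] {P : Measure Ω} {𝓕 : Filtration ℕ m} {proposer : ℕ → Ω → Fin n}
  {B : ℕ → Fin n → Set Ω} {E : Set Ω}

theorem measurableSet_elected (h : IsElection P 𝓕 proposer)
    (hB : ∀ t i, MeasurableSet[𝓕 t] (B t i)) (t : ℕ) :
    MeasurableSet[𝓕 (t + 1)] {ω | ω ∈ B t (proposer t ω)} := by
  have : {ω | ω ∈ B t (proposer t ω)} = ⋃ i, (proposer t ⁻¹' {i} ∩ B t i) := by
    ext ω
    simp
  rw [this]
  exact MeasurableSet.iUnion fun i => (h.revealed t (MeasurableSet.of_discrete)).inter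
    (𝓕.mono t.le_succ _ (hB t i))

/-- If for each outcome some validator is eligible, the elected proposer is eligible with
probability at least `1 / n`, conditionally on the information available before the election. -/
theorem mul_le_measure_inter_elected (h : IsElection P 𝓕 proposer)
    (hB : ∀ t i, MeasurableSet[𝓕 t] (B t i)) (hne : ∀ t ω, ∃ i, ω ∈ B t i) {t : ℕ}
    (hE : MeasurableSet[𝓕 t] E) :
    (n : ENNReal)⁻¹ * P E ≤ P (E ∩ {ω | ω ∈ B t (proposer t ω)}) := by
  have hprop : ∀ i, MeasurableSet (proposer t ⁻¹' {i}) := fun i =>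
    𝓕.le (t + 1) _ (h.revealed t (MeasurableSet.of_discrete))
  have hEB : ∀ i, MeasurableSet[𝓕 t] (E ∩ B t i) := fun i => hE.inter (hB t i)
  have hunion : E ∩ {ω | ω ∈ B t (proposer t ω)} =
      ⋃ i, ((E ∩ B t i) ∩ proposer t ⁻¹' {i}) := by
    ext ω
    simp [and_assoc]
  have hdisj : Pairwise (Function.onFun Disjoint
      fun i => (E ∩ B t i) ∩ proposer t ⁻¹' {i}) := by
    intro i j hij
    refine Set.disjoint_left.2 fun ω hi hj => hij ?_
    exact hi.2.symm.trans hj.2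
  have hmul : ∀ i, P ((E ∩ B t i) ∩ proposer t ⁻¹' {i}) = P (E ∩ B t i) * (n : ENNReal)⁻¹ := by
    intro i
    rw [← h.fair t i]
    exact (Indep_iff _ _ P).1 (h.unpredictable t) _ _ (hEB i) ⟨{i}, trivial, rfl⟩
  rw [hunion, measure_iUnion hdisj fun i => (𝓕.le t _ (hEB i)).inter (hprop i), tsum_fintype]
  simp_rw [hmul]
  rw [← Finset.sum_mul, mul_comm]
  refine mul_le_mul_left ?_ _
  have hcover : E ⊆ ⋃ i, (E ∩ B t i) := fun ω hω => by
    obtain ⟨i, hi⟩ := hne t ω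
    exact Set.mem_iUnion.2 ⟨i, hω, hi⟩
  exact (measure_mono hcover).trans (measure_iUnion_fintype_le P _)

theorem measure_diff_elected_le [IsProbabilityMeasure P] (h : IsElection P 𝓕 proposer)
    (hB : ∀ t i, MeasurableSet[𝓕 t] (B t i)) (hne : ∀ t ω, ∃ i, ω ∈ B t i) {t : ℕ}
    (hE : MeasurableSet[𝓕 t] E) :
    P (E \ {ω | ω ∈ B t (proposer t ω)}) ≤ (1 - (n : ENNReal)⁻¹) * P E := by
  have hX := 𝓕.le (t + 1) _ (measurableSet_elected h hB t)
  have hadd := measure_inter_add_sdiff (μ := P) E hX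
  have hle := mul_le_measure_inter_elected h hB hne hE
  rw [ENNReal.sub_mul fun _ _ => measure_ne_top P E, one_mul]
  have hne' : P (E ∩ {ω | ω ∈ B t (proposer t ω)}) ≠ ⊤ := measure_ne_top P _
  calc P (E \ {ω | ω ∈ B t (proposer t ω)})
      = P E - P (E ∩ {ω | ω ∈ B t (proposer t ω)}) := by
        rw [← hadd, ENNReal.add_sub_cancel_left hne']
    _ ≤ P E - (n : ENNReal)⁻¹ * P E := tsub_le_tsub_left hle _

/-- The probability that no eligible proposer is elected in `L` consecutive slots. -/
theorem measure_none_elected_le [IsProbabilityMeasure P] (h : IsElection P 𝓕 proposer)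
    (hB : ∀ t i, MeasurableSet[𝓕 t] (B t i)) (hne : ∀ t ω, ∃ i, ω ∈ B t i) (a L : ℕ) :
    MeasurableSet[𝓕 (a + L)] {ω | ∀ s, a ≤ s → s < a + L → ω ∉ B s (proposer s ω)} ∧
      P {ω | ∀ s, a ≤ s → s < a + L → ω ∉ B s (proposer s ω)} ≤
        (1 - (n : ENNReal)⁻¹) ^ L := by
  induction L with
  | zero =>
    have : {ω | ∀ s, a ≤ s → s < a + 0 → ω ∉ B s (proposer s ω)} = Set.univ := by
      ext ω
      simp only [Set.mem_ofPred_eq, Set.mem_univ, iff_true]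
      intro s h1 h2
      omega
    rw [this]
    exact ⟨MeasurableSet.univ, by simp⟩
  | succ L ih =>
    have : {ω | ∀ s, a ≤ s → s < a + (L + 1) → ω ∉ B s (proposer s ω)} =
        {ω | ∀ s, a ≤ s → s < a + L → ω ∉ B s (proposer s ω)} \
          {ω | ω ∈ B (a + L) (proposer (a + L) ω)} := by
      ext ω
      simp only [Set.mem_ofPred_eq, Set.mem_sdiff]
      constructor
      · intro H
        exact ⟨fun s h1 h2 => H s h1 (by omega), H _ (by omega) (by omega)⟩
      · rintro ⟨H1, H2⟩ s h1 h2
        rcases Nat.lt_or_ge s (a + L) with h3 | h3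
        · exact H1 s h1 h3
        · obtain rfl : s = a + L := by omega
          exact H2
    rw [this]
    refine ⟨(𝓕.mono (Nat.le_succ (a + L)) _ ih.1).diff (measurableSet_elected h hB (a + L)), ?_⟩
    refine (measure_diff_elected_le h hB hne ih.1).trans ?_
    rw [pow_succ']
    gcongr
    exact ih.2

/-- With overwhelming probability, every window of `κ` slots contains a good slot. -/
theorem measure_not_goodWindows_le [IsProbabilityMeasure P] (h : IsElection P 𝓕 proposer)
    {Tx F G S : Type*} {e : Ω → Execution n Tx F G S} {Δ : ℕ} (hA : Adapted 𝓕 Δ e)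
    (hc : ∀ ω, (e ω).Compliant Δ) (κ N : ℕ) :
    P {ω | ¬ GoodWindows (e ω) (fun t => proposer t ω) Δ κ N} ≤
      ((N + 1 : ℕ) : ENNReal) * (n * (1 - (n : ENNReal)⁻¹) ^ (κ / n)) := by
  set B : ℕ → Fin n → Set Ω := fun t i => {ω | i ∈ (e ω).active Δ (proposing Δ t)} with hBdef
  have hB : ∀ t i, MeasurableSet[𝓕 t] (B t i) := fun t i =>
    @measurableSet_active n Ω (𝓕 t) _ _ _ _ e Δ _ i fun r' hr' => hA t r' hr' i
  have hne : ∀ t ω, ∃ i, ω ∈ B t i := fun t ω => (hc ω).proposer_exists t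
  set L := κ / n with hL
  have hsub : {ω | ¬ GoodWindows (e ω) (fun t => proposer t ω) Δ κ N} ⊆
      ⋃ a ∈ Finset.range (N + 1), ⋃ j ∈ Finset.range n,
        {ω | ∀ s, a + 1 + j * L ≤ s → s < a + 1 + j * L + L → ω ∉ B s (proposer s ω)} := by
    intro ω hω
    by_contra hcon
    refine hω fun a ha => ?_
    simp only [Set.mem_iUnion, not_exists, Finset.mem_range, Set.mem_ofPred_eq] at hcon
    obtain ⟨s, h1, h2, h3⟩ := exists_goodSlot (e := e ω) (proposer := fun t => proposer t ω)
      (a := a + 1) (L := L) (hc ω) (fun j hj => by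
        have := hcon a (by omega) j hj
        push Not at this
        exact this)
    have : n * L ≤ κ := Nat.mul_div_le κ n
    exact ⟨s, by omega, by omega, h3⟩
  refine (measure_mono hsub).trans ?_
  refine (measure_biUnion_finset_le _ _).trans ?_
  refine (Finset.sum_le_card_nsmul _ _ (n * (1 - (n : ENNReal)⁻¹) ^ L) fun a _ => ?_).trans ?_
  · refine (measure_biUnion_finset_le _ _).trans ?_
    refine (Finset.sum_le_card_nsmul _ _ ((1 - (n : ENNReal)⁻¹) ^ L) fun j _ =>
      (measure_none_elected_le h hB hne _ _).2).trans ?_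
    simp
  · simp

end Election

/-! ### The error bound is negligible -/

section Negligible

open Filter Topology

/-- The error probability for `n` validators and horizon `T`. -/
noncomputable def errorBound (n : ℕ) (T : Polynomial ℕ) (κ : ℕ) : ℝ :=
  ((T.eval κ + 1 : ℕ) : ℝ) * (n * (1 - 1 / ((n : ℝ) + 1)) ^ (κ / n))

theorem negligible_errorBound (n : ℕ) (T : Polynomial ℕ) : Negligible (errorBound n T) := by
  rcases Nat.eq_zero_or_pos n with rfl | hn
  · intro k
    simp [errorBound]
  set q : ℝ := 1 - 1 / ((n : ℝ) + 1) with hq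
  have hn' : (0 : ℝ) < n := by exact_mod_cast hn
  have hq1 : q < 1 := by
    have : 0 < 1 / ((n : ℝ) + 1) := by positivity
    linarith
  have hq0 : 0 < q := by
    have : q = n / (n + 1) := by rw [hq]; field_simp; ring
    rw [this]; positivity
  have hdecay : Negligible fun κ => q ^ (κ / n) := by
    intro k
    have h1 := tendsto_pow_const_mul_const_pow_of_abs_lt_one k (abs_lt.2 ⟨by linarith, hq1⟩)
    have h2 : Tendsto (fun κ : ℕ => κ / n + 1) atTop atTop :=
      (tendsto_add_atTop_nat 1).comp (Nat.tendsto_div_const_atTop hn.ne')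
    have h3 := (h1.comp h2).const_mul ((n : ℝ) ^ k * q⁻¹)
    rw [mul_zero] at h3
    refine squeeze_zero (fun κ => by positivity) (fun κ => ?_) h3
    have h4 : (κ : ℝ) ≤ n * ((κ / n + 1 : ℕ) : ℝ) := by
      exact_mod_cast (Nat.lt_mul_div_succ κ hn).le
    calc (κ : ℝ) ^ k * q ^ (κ / n) ≤ (n * ((κ / n + 1 : ℕ) : ℝ)) ^ k * q ^ (κ / n) := by gcongr
      _ = _ := by
        simp only [Function.comp, mul_pow, pow_succ]
        field_simp
  have hpoly := (hdecay.polynomial_mul ((T + 1).map (Nat.castRingHom ℝ))).mul_const (n : ℝ)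
  refine hpoly.congr fun κ => ?_
  simp only [errorBound, hq, Polynomial.map_add,
    Polynomial.map_one, Polynomial.eval_add, Polynomial.eval_one, Nat.cast_add, Nat.cast_one]
  simp
  ring

theorem le_ofReal_errorBound {n : ℕ} (hn : 0 < n) (T : Polynomial ℕ) (κ : ℕ) :
    ((T.eval κ + 1 : ℕ) : ENNReal) * (n * (1 - (n : ENNReal)⁻¹) ^ (κ / n)) ≤
      ENNReal.ofReal (errorBound n T κ) := by
  have hn' : (0 : ℝ) < n := by exact_mod_cast hn
  have hq0 : 0 ≤ 1 - 1 / ((n : ℝ) + 1) := by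
    have : 1 / ((n : ℝ) + 1) ≤ 1 := by
      rw [div_le_one (by positivity)]; linarith
    linarith
  unfold errorBound
  rw [ENNReal.ofReal_mul (by positivity), ENNReal.ofReal_mul (by positivity),
    ENNReal.ofReal_pow hq0, ENNReal.ofReal_natCast, ENNReal.ofReal_natCast]
  gcongr
  rw [ENNReal.ofReal_sub _ (by positivity), ENNReal.ofReal_one]
  refine tsub_le_tsub_left ?_ _
  rw [one_div, ENNReal.ofReal_inv_of_pos (by positivity)]
  refine ENNReal.inv_le_inv.2 ?_
  rw [← ENNReal.ofReal_natCast]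
  exact ENNReal.ofReal_le_ofReal (by linarith)

end Negligible

section Combination

open MeasureTheory

/-- A property that follows deterministically from good windows fails with negligible
probability. -/
theorem measure_not_le_errorBound {n : ℕ} {Ω : Type*} [m : MeasurableSpace Ω] {P : Measure Ω}
    [IsProbabilityMeasure P] {𝓕 : Filtration ℕ m} {proposer : ℕ → Ω → Fin n}
    (h : IsElection P 𝓕 proposer) {Tx F G S : Type*} {e : Ω → Execution n Tx F G S} {Δ κ : ℕ}
    (T : Polynomial ℕ) (hA : Adapted 𝓕 Δ e) (hc : ∀ ω, (e ω).Compliant Δ) {p : Ω → Prop}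
    (hp : ∀ ω, GoodWindows (e ω) (fun t => proposer t ω) Δ κ (T.eval κ) → p ω) :
    P {ω | ¬ p ω} ≤ ENNReal.ofReal (errorBound n T κ) := by
  have hn : 0 < n := by
    obtain ⟨ω⟩ := nonempty_of_isProbabilityMeasure P
    exact Execution.pos_of_compliant (hc ω)
  have hsub : {ω | ¬ p ω} ⊆
      {ω | ¬ GoodWindows (e ω) (fun t => proposer t ω) Δ κ (T.eval κ)} :=
    fun ω hω hg => hω (hp ω hg)
  exact (measure_mono hsub).trans ((measure_not_goodWindows_le h hA hc κ _).trans
    (le_ofReal_errorBound hn T κ))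

end Combination

end SleepyTOB

theorem mainTheorem2 (n : ℕ) (T : Polynomial ℕ) :
    ∃ ε : ℕ → ℝ, SleepyTOB.Negligible ε ∧
      ∀ (κ Δ : ℕ), 1 < κ → 0 < Δ →
      ∀ (Tx : Type*) (Ω : Type*) [m : MeasurableSpace Ω] (P : MeasureTheory.Measure Ω)
        [MeasureTheory.IsProbabilityMeasure P] (𝓕 : MeasureTheory.Filtration ℕ m)
        (proposer : ℕ → Ω → Fin n), SleepyTOB.IsElection P 𝓕 proposer →
        -- the variant of TOB-SVD with fast confirmations is safe and live
        (∀ e : Ω → SleepyTOB.TobExecution n Tx, SleepyTOB.Adapted 𝓕 Δ e →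
          (∀ ω, SleepyTOB.IsTobExecution (e ω) (fun t => proposer t ω) Δ κ True) →
          P {ω | ¬ ((e ω).SafeUpTo SleepyTOB.TobState.confirmed (T.eval κ) ∧
              (e ω).LiveUpTo SleepyTOB.TobState.confirmed Δ (T.eval κ) (8 * κ * Δ + Δ))} ≤
            ENNReal.ofReal (ε κ)) ∧
        -- it is safe even if fast confirmations may shorten the confirmed chain
        (∀ e : Ω → SleepyTOB.TobExecution n Tx, SleepyTOB.Adapted 𝓕 Δ e →
          (∀ ω, SleepyTOB.IsTobExecution (e ω) (fun t => proposer t ω) Δ κ False) →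
          P {ω | ¬ (e ω).SafeUpTo SleepyTOB.TobState.confirmed (T.eval κ)} ≤
            ENNReal.ofReal (ε κ)) ∧
        -- the available chain of the full protocol is safe and live
        (∀ e : Ω → SleepyTOB.FullExecution n Tx, SleepyTOB.Adapted 𝓕 Δ e →
          (∀ ω, SleepyTOB.IsFullExecution (e ω) (fun t => proposer t ω) Δ κ) →
          P {ω | ¬ ((e ω).SafeUpTo SleepyTOB.FullState.chAva (T.eval κ) ∧
              (e ω).LiveUpTo SleepyTOB.FullState.chAva Δ (T.eval κ) (8 * κ * Δ + Δ))} ≤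
            ENNReal.ofReal (ε κ)) := by
  refine ⟨SleepyTOB.errorBound n T, SleepyTOB.negligible_errorBound n T, ?_⟩
  intro κ Δ hκ hΔ Tx Ω m P _ 𝓕 proposer hel
  have hκ0 : 0 < κ := by omega
  refine ⟨fun e hA he => ?_, fun e hA he => ?_, fun e hA he => ?_⟩
  · exact SleepyTOB.measure_not_le_errorBound hel T hA (fun ω => (he ω).1) fun ω hg =>
      ⟨(he ω).safeUpTo hΔ hκ0 hg, (he ω).liveUpTo hΔ hκ0 hg⟩
  · exact SleepyTOB.measure_not_le_errorBound hel T hA (fun ω => (he ω).1) fun ω hg =>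
      (he ω).safeUpTo hΔ hκ0 hg
  · exact SleepyTOB.measure_not_le_errorBound hel T hA (fun ω => (he ω).1) fun ω hg =>
      ⟨(he ω).safeUpTo hΔ hκ0 hg, (he ω).liveUpTo hΔ hκ0 hg⟩
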